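/- Let $d\ge 0$ be an integer, $A$ a real $d\times d$ matrix, and $s,\sigma>0$ with $s+\sigma\ge 1$ and $(s,\sigma)\ne(\tfrac12,\tfrac12)$. Let $\Sigma_s^\sigma(\mathbf R^d)$ be the space of all $f\in C^\infty(\mathbf R^d)$ (complex valued) such that $$\|f\|_{\mathcal S_{s;h}^\sigma}=\sup_{\alpha,\beta\in\mathbf N^d}\sup_{x\in\mathbf R^d}\frac{|x^\alpha\partial^\beta f(x)|}{h^{|\alpha|+|\beta|}\,\alpha!^{s}\,\beta!^{\sigma}}<\infty\qquad\text{for every } h>0,$$ with the Fréchet topology given by these norms, and let $(\Sigma_s^\sigma)'(\mathbf R^d)$ be its dual with the strong dual topology. A function $f\in\Sigma_s^\sigma(\mathbf R^d)$ is identified with the functional $g\mapsto\int f(x)g(x)\,dx$. Let $a\in\Gamma_{s,\sigma}^{\sigma,s;0}(\mathbf R^{2d})$, i.e. $a\in C^\infty(\mathbf R^{2d})$ is complex valued and there is an $r>0$ such that for every $h>0$ $$\sup_{\alpha,\beta\in\mathbf N^d}\ \sup_{x,\xi\in\mathbf R^d}\frac{|\partial_x^\alpha\partial_\xi^\beta a(x,\xi)|}{h^{|\alpha+\beta|}\,\alpha!^{\sigma}\,\beta!^{s}\,e^{r(|x|^{1/s}+|\xi|^{1/\sigma})}}<\infty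 .$$ Let $\operatorname{Op}_A(a)$ be the pseudo-differential operator with symbol $a$, formally $$\operatorname{Op}_A(a)f(x)=(2\pi)^{-d}\iint a(x-A(x-y),\xi)f(y)e^{i\langle x-y,\xi\rangle}\,dy\,d\xi ,$$ that is, the operator with distribution kernel $K_{a,A}(x,y)=(2\pi)^{-d/2}(\mathscr F_2^{-1}a)(x-A(x-y),x-y)$, where $\mathscr F_2$ is the partial Fourier transform in the second variable; explicitly, $$\langle \operatorname{Op}_A(a)f,g\rangle=\langle K_{a,A},g\otimes f\rangle=(2\pi)^{-d}\iint a(z,\xi)\Big(\int g(z+At)\,f(z+At-t)\,e^{i\langle t,\xi\rangle}\,dt\Big)dz\,d\xi ,\qquad f,g\in\Sigma_s^\sigma(\mathbf R^d).$$ Then the last double integral in $(z,\xi)$ converges absolutely for all $f,g\in\Sigma_s^\sigma(\mathbf R^d)$, $\operatorname{Op}_A(a)$ is a continuous linear map from $\Sigma_s^\sigma(\mathbf R^d)$ to itself, and it extends uniquely to a continuous map from $(\Sigma_s^\sigma)'(\mathbf R^d)$ to itself; this extension is linear. -/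

import Mathlib

open MeasureTheory
open scoped ContDiff Nat

noncomputable section

namespace GelfandShilov

/-- The Euclidean space `ℝ^d`. -/
abbrev Eucl (d : ℕ) : Type := EuclideanSpace ℝ (Fin d)

/-! ### Multi-indices -/

/-- The length `|α| = α₁ + ⋯ + α_d`. -/
def len {d : ℕ} (α : Fin d → ℕ) : ℕ := ∑ i, α i

/-- The factorial `α! = α₁! ⋯ α_d!`, as a real number. -/
def mfact {d : ℕ} (α : Fin d → ℕ) : ℝ := ∏ i, ((α i)! : ℝ)

/-- The monomial `x^α`. -/
def monom {d : ℕ} (α : Fin d → ℕ) (x : Eucl d) : ℝ := ∏ i, x i ^ α i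

/-- The partial derivative `∂_i f`. -/
def pderiv {d : ℕ} (i : Fin d) (f : Eucl d → ℂ) : Eucl d → ℂ :=
  fun x => fderiv ℝ f x (EuclideanSpace.single i 1)

/-- `∂^α f = ∂_1^{α₁} ⋯ ∂_d^{α_d} f`. -/
def mderiv {d : ℕ} (α : Fin d → ℕ) (f : Eucl d → ℂ) : Eucl d → ℂ :=
  (List.finRange d).foldr (fun i g => (pderiv i)^[α i] g) f

theorem pderiv_smooth {d : ℕ} (i : Fin d) {f : Eucl d → ℂ} (hf : ContDiff ℝ ∞ f) :
    ContDiff ℝ ∞ (pderiv i f) := by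
  unfold pderiv
  exact (hf.fderiv_right (m := ∞) (by simp)).clm_apply contDiff_const

theorem pderiv_add {d : ℕ} (i : Fin d) {f g : Eucl d → ℂ} (hf : ContDiff ℝ ∞ f)
    (hg : ContDiff ℝ ∞ g) : pderiv i (f + g) = pderiv i f + pderiv i g := by
  funext x
  have h1 := (hf.differentiable (by simp)) x
  have h2 := (hg.differentiable (by simp)) x
  simp [pderiv, fderiv_add h1 h2]

theorem pderiv_smul {d : ℕ} (i : Fin d) (c : ℂ) {f : Eucl d → ℂ} (hf : ContDiff ℝ ∞ f) :
    pderiv i (c • f) = c • pderiv i f := by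
  funext x
  have h1 := (hf.differentiable (by simp)) x
  simp [pderiv, fderiv_const_smul h1]

theorem iter_smooth {d : ℕ} (i : Fin d) (n : ℕ) {f : Eucl d → ℂ} (hf : ContDiff ℝ ∞ f) :
    ContDiff ℝ ∞ ((pderiv i)^[n] f) := by
  induction n with
  | zero => simpa using hf
  | succ n ih => rw [Function.iterate_succ_apply']; exact pderiv_smooth i ih

theorem iter_add {d : ℕ} (i : Fin d) (n : ℕ) {f g : Eucl d → ℂ} (hf : ContDiff ℝ ∞ f)
    (hg : ContDiff ℝ ∞ g) :
    (pderiv i)^[n] (f + g) = (pderiv i)^[n] f + (pderiv i)^[n] g := by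
  induction n with
  | zero => rfl
  | succ n ih =>
    simp only [Function.iterate_succ_apply', ih]
    exact pderiv_add i (iter_smooth i n hf) (iter_smooth i n hg)

theorem iter_smul {d : ℕ} (i : Fin d) (n : ℕ) (c : ℂ) {f : Eucl d → ℂ}
    (hf : ContDiff ℝ ∞ f) :
    (pderiv i)^[n] (c • f) = c • (pderiv i)^[n] f := by
  induction n with
  | zero => rfl
  | succ n ih =>
    simp only [Function.iterate_succ_apply', ih]
    exact pderiv_smul i c (iter_smooth i n hf)

theorem foldr_smooth {d : ℕ} (α : Fin d → ℕ) (l : List (Fin d)) {f : Eucl d → ℂ}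
    (hf : ContDiff ℝ ∞ f) :
    ContDiff ℝ ∞ (l.foldr (fun i g => (pderiv i)^[α i] g) f) := by
  induction l with
  | nil => exact hf
  | cons i l ih => exact iter_smooth i _ ih

theorem mderiv_add {d : ℕ} (α : Fin d → ℕ) {f g : Eucl d → ℂ} (hf : ContDiff ℝ ∞ f)
    (hg : ContDiff ℝ ∞ g) : mderiv α (f + g) = mderiv α f + mderiv α g := by
  unfold mderiv
  induction List.finRange d with
  | nil => rfl
  | cons i l ih =>
    simp only [List.foldr_cons, ih]
    exact iter_add i _ (foldr_smooth α l hf) (foldr_smooth α l hg)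

theorem mderiv_smul {d : ℕ} (α : Fin d → ℕ) (c : ℂ) {f : Eucl d → ℂ}
    (hf : ContDiff ℝ ∞ f) : mderiv α (c • f) = c • mderiv α f := by
  unfold mderiv
  induction List.finRange d with
  | nil => rfl
  | cons i l ih =>
    simp only [List.foldr_cons, ih]
    exact iter_smul i _ c (foldr_smooth α l hf)

theorem mderiv_zero_index {d : ℕ} (f : Eucl d → ℂ) : mderiv 0 f = f := by
  unfold mderiv
  induction List.finRange d with
  | nil => rfl
  | cons i l ih => simp

theorem mfact_pos {d : ℕ} (α : Fin d → ℕ) : 0 < mfact α := by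
  unfold mfact
  exact Finset.prod_pos fun i _ => by exact_mod_cast Nat.factorial_pos _

/-! ### The space `Σ_s^σ(ℝ^d)` -/

/-- The quotient `|x^α ∂^β f(x)| / (h^{|α|+|β|} α!^s β!^σ)`. -/
def gsQuot {d : ℕ} (s σ h : ℝ) (f : Eucl d → ℂ)
    (p : (Fin d → ℕ) × (Fin d → ℕ) × Eucl d) : ℝ :=
  ‖(monom p.1 p.2.2 : ℂ) * mderiv p.2.1 f p.2.2‖ /
    (h ^ (len p.1 + len p.2.1) * mfact p.1 ^ s * mfact p.2.1 ^ σ)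

/-- The norm of `S_{s;h}^σ(ℝ^d)`: the supremum of the quotients over `α`, `β`, `x`. -/
def gsNorm {d : ℕ} (s σ h : ℝ) (f : Eucl d → ℂ) : ℝ := ⨆ p, gsQuot s σ h f p

theorem gsDen_pos {d : ℕ} (s σ : ℝ) {h : ℝ} (hh : 0 < h) (α β : Fin d → ℕ) :
    0 < h ^ (len α + len β) * mfact α ^ s * mfact β ^ σ := by
  have := mfact_pos α
  have := mfact_pos β
  positivity

theorem gsQuot_nonneg {d : ℕ} (s σ : ℝ) {h : ℝ} (hh : 0 < h) (f : Eucl d → ℂ)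
    (p : (Fin d → ℕ) × (Fin d → ℕ) × Eucl d) : 0 ≤ gsQuot s σ h f p :=
  div_nonneg (norm_nonneg _) (gsDen_pos s σ hh p.1 p.2.1).le

theorem gsQuot_add_le {d : ℕ} (s σ : ℝ) {h : ℝ} (hh : 0 < h) {f g : Eucl d → ℂ}
    (hf : ContDiff ℝ ∞ f) (hg : ContDiff ℝ ∞ g)
    (p : (Fin d → ℕ) × (Fin d → ℕ) × Eucl d) :
    gsQuot s σ h (f + g) p ≤ gsQuot s σ h f p + gsQuot s σ h g p := by
  unfold gsQuot
  rw [mderiv_add _ hf hg, Pi.add_apply, mul_add, ← add_div]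
  have := gsDen_pos s σ hh p.1 p.2.1
  gcongr
  exact norm_add_le _ _

theorem gsQuot_smul {d : ℕ} (s σ h : ℝ) (c : ℂ) {f : Eucl d → ℂ}
    (hf : ContDiff ℝ ∞ f) (p : (Fin d → ℕ) × (Fin d → ℕ) × Eucl d) :
    gsQuot s σ h (c • f) p = ‖c‖ * gsQuot s σ h f p := by
  unfold gsQuot
  rw [mderiv_smul _ c hf, Pi.smul_apply, smul_eq_mul, mul_left_comm, norm_mul, mul_div_assoc]

theorem gsQuot_zero {d : ℕ} (s σ h : ℝ) (p : (Fin d → ℕ) × (Fin d → ℕ) × Eucl d) :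
    gsQuot s σ h (0 : Eucl d → ℂ) p = 0 := by
  have := gsQuot_smul s σ h 0 (contDiff_const (c := (0 : ℂ)) (n := ∞) (𝕜 := ℝ) (E := Eucl d)) p
  simpa [← Pi.zero_def] using this

/-- The functions of `Σ_s^σ(ℝ^d)`: the smooth `f` that lie in `S_{s;h}^σ(ℝ^d)` for every
`h > 0`. -/
def sigmaSubmodule (s σ : ℝ) (d : ℕ) : Submodule ℂ (Eucl d → ℂ) where
  carrier := {f | ContDiff ℝ ∞ f ∧ ∀ h : ℝ, 0 < h → BddAbove (Set.range (gsQuot s σ h f))}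
  zero_mem' := by
    refine ⟨contDiff_const, fun h hh => ⟨0, ?_⟩⟩
    rintro _ ⟨p, rfl⟩
    exact (gsQuot_zero s σ h p).le
  add_mem' := by
    rintro f g ⟨hf, hf'⟩ ⟨hg, hg'⟩
    refine ⟨hf.add hg, fun h hh => ?_⟩
    obtain ⟨C, hC⟩ := hf' h hh
    obtain ⟨D, hD⟩ := hg' h hh
    refine ⟨C + D, ?_⟩
    rintro _ ⟨p, rfl⟩
    exact (gsQuot_add_le s σ hh hf hg p).trans (add_le_add (hC ⟨p, rfl⟩) (hD ⟨p, rfl⟩))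
  smul_mem' := by
    rintro c f ⟨hf, hf'⟩
    refine ⟨hf.const_smul c, fun h hh => ?_⟩
    obtain ⟨C, hC⟩ := hf' h hh
    refine ⟨‖c‖ * C, ?_⟩
    rintro _ ⟨p, rfl⟩
    rw [gsQuot_smul s σ h c hf]
    exact mul_le_mul_of_nonneg_left (hC ⟨p, rfl⟩) (norm_nonneg c)

/-- The Gelfand-Shilov space `Σ_s^σ(ℝ^d)`. (A new type, since its topology is not the one of
pointwise convergence.) -/
def SigmaSpace (s σ : ℝ) (d : ℕ) : Type := sigmaSubmodule s σ d

variable {s σ : ℝ} {d : ℕ}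

instance : AddCommGroup (SigmaSpace s σ d) :=
  inferInstanceAs (AddCommGroup (sigmaSubmodule s σ d))

instance : Module ℂ (SigmaSpace s σ d) :=
  inferInstanceAs (Module ℂ (sigmaSubmodule s σ d))

instance : CoeFun (SigmaSpace s σ d) (fun _ => Eucl d → ℂ) := ⟨fun f => f.1⟩

theorem SigmaSpace.smooth (f : SigmaSpace s σ d) : ContDiff ℝ ∞ (f : Eucl d → ℂ) := f.2.1

theorem SigmaSpace.bdd (f : SigmaSpace s σ d) {h : ℝ} (hh : 0 < h) :
    BddAbove (Set.range (gsQuot s σ h f)) := f.2.2 h hh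

theorem gsQuot_le_gsNorm (f : SigmaSpace s σ d) {h : ℝ} (hh : 0 < h)
    (p : (Fin d → ℕ) × (Fin d → ℕ) × Eucl d) : gsQuot s σ h f p ≤ gsNorm s σ h f :=
  le_ciSup (f.bdd hh) p

/-- The norms of `S_{s;h}^σ(ℝ^d)`, `h > 0`, as a family of seminorms on `Σ_s^σ(ℝ^d)`. -/
def sigmaSeminorm (s σ : ℝ) (d : ℕ) : SeminormFamily ℂ (SigmaSpace s σ d) {h : ℝ // 0 < h} :=
  fun h => Seminorm.of (fun f => gsNorm s σ h f)
    (fun f g => ciSup_le fun p =>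
      (gsQuot_add_le s σ h.2 f.smooth g.smooth p).trans
        (add_le_add (gsQuot_le_gsNorm f h.2 p) (gsQuot_le_gsNorm g h.2 p)))
    (fun c f => by
      change (⨆ p, gsQuot s σ h (c • (f : Eucl d → ℂ)) p) = ‖c‖ * ⨆ p, gsQuot s σ h f p
      rw [Real.mul_iSup_of_nonneg (norm_nonneg c)]
      exact iSup_congr fun p => gsQuot_smul s σ h c f.smooth p)

instance : Nonempty {h : ℝ // 0 < h} := ⟨⟨1, one_pos⟩⟩

/-- The Fréchet topology of `Σ_s^σ(ℝ^d)`, given by the norms of `S_{s;h}^σ(ℝ^d)`, `h > 0`. -/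
instance : TopologicalSpace (SigmaSpace s σ d) :=
  (sigmaSeminorm s σ d).moduleFilterBasis.topology

theorem sigma_withSeminorms : WithSeminorms (sigmaSeminorm s σ d) := ⟨rfl⟩

instance : IsTopologicalAddGroup (SigmaSpace s σ d) :=
  sigma_withSeminorms.topologicalAddGroup

instance : ContinuousSMul ℂ (SigmaSpace s σ d) := sigma_withSeminorms.continuousSMul

/-! ### The dual space `(Σ_s^σ)'(ℝ^d)` and the embedding of functions -/

/-- The space `(Σ_s^σ)'(ℝ^d)` of continuous linear functionals on `Σ_s^σ(ℝ^d)`, with the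
strong dual topology (uniform convergence on bounded sets). -/
abbrev SigmaDual (s σ : ℝ) (d : ℕ) : Type := StrongDual ℂ (SigmaSpace s σ d)

theorem monom_norm_le (f : SigmaSpace s σ d) (α : Fin d → ℕ) (x : Eucl d) :
    |monom α x| * ‖f x‖ ≤ mfact α ^ s * gsNorm s σ 1 f := by
  have h := gsQuot_le_gsNorm f one_pos (α, 0, x)
  have hz : mfact (0 : Fin d → ℕ) = 1 := by simp [mfact]
  have hp : 0 < mfact α ^ s := Real.rpow_pos_of_pos (mfact_pos α) s
  unfold gsQuot at h
  rw [mderiv_zero_index] at h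
  simp only [one_pow, one_mul, hz, Real.one_rpow, mul_one, norm_mul, Complex.norm_real,
    Real.norm_eq_abs] at h
  rw [div_le_iff₀ hp] at h
  linarith

theorem norm_le_gsNorm (f : SigmaSpace s σ d) (x : Eucl d) : ‖f x‖ ≤ gsNorm s σ 1 f := by
  simpa [monom, mfact] using monom_norm_le f 0 x

theorem prod_mul_norm_le (f : SigmaSpace s σ d) :
    ∃ C : ℝ, ∀ x : Eucl d, (∏ i, (1 + x i ^ 2)) * ‖f x‖ ≤ C := by
  refine ⟨∑ t ∈ (Finset.univ : Finset (Fin d)).powerset,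
    mfact (fun i => if i ∈ t then 2 else 0) ^ s * gsNorm s σ 1 f, fun x => ?_⟩
  rw [Finset.prod_one_add, Finset.sum_mul]
  refine Finset.sum_le_sum fun t _ => ?_
  refine le_trans ?_ (monom_norm_le f (fun i => if i ∈ t then 2 else 0) x)
  have : monom (fun i => if i ∈ t then 2 else 0) x = ∏ i ∈ t, x i ^ 2 := by
    simp [monom, pow_ite, Finset.prod_ite_mem]
  rw [this]
  gcongr
  exact le_abs_self _

theorem SigmaSpace.integrable (f : SigmaSpace s σ d) : Integrable (f : Eucl d → ℂ) := by
  obtain ⟨C, hC⟩ := prod_mul_norm_le f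
  have h1 : Integrable (fun y : Fin d → ℝ => ∏ i, (1 + y i ^ 2)⁻¹) :=
    Integrable.fintype_prod (fun _ => integrable_inv_one_add_sq)
  have h2 : Integrable (fun x : Eucl d => ∏ i, (1 + x i ^ 2)⁻¹) :=
    (PiLp.volume_preserving_ofLp (Fin d)).integrable_comp_of_integrable h1
  refine (h2.const_mul C).mono' f.smooth.continuous.aestronglyMeasurable
    (Filter.Eventually.of_forall fun x => ?_)
  have hp : 0 < ∏ i, (1 + x i ^ 2) := Finset.prod_pos fun i _ => by positivity
  rw [Finset.prod_inv_distrib, ← div_eq_mul_inv, le_div_iff₀ hp]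
  linarith [hC x]

theorem SigmaSpace.integrable_mul (f g : SigmaSpace s σ d) :
    Integrable (fun x => f x * g x) :=
  f.integrable.mul_bdd g.smooth.continuous.aestronglyMeasurable
    (Filter.Eventually.of_forall (norm_le_gsNorm g))

/-- The canonical inclusion `Σ_s^σ(ℝ^d) → (Σ_s^σ)'(ℝ^d)`, which takes `f` to the functional
`g ↦ ∫ f(x) g(x) dx`. -/
def toDual (f : SigmaSpace s σ d) : SigmaDual s σ d where
  toFun g := ∫ x, f x * g x
  map_add' g₁ g₂ := by
    rw [← integral_add (f.integrable_mul g₁) (f.integrable_mul g₂)]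
    exact integral_congr_ae (Filter.Eventually.of_forall fun x => mul_add _ _ _)
  map_smul' c g := by
    rw [RingHom.id_apply, smul_eq_mul, ← integral_const_mul]
    exact integral_congr_ae (Filter.Eventually.of_forall fun x => mul_left_comm _ _ _)
  cont := by
    let L : SigmaSpace s σ d →ₗ[ℂ] ℂ :=
      { toFun := fun g => ∫ x, f x * g x
        map_add' := fun g₁ g₂ => by
          rw [← integral_add (f.integrable_mul g₁) (f.integrable_mul g₂)]
          exact integral_congr_ae (Filter.Eventually.of_forall fun x => mul_add _ _ _)
        map_smul' := fun c g => by
          rw [RingHom.id_apply, smul_eq_mul, ← integral_const_mul]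
          exact integral_congr_ae (Filter.Eventually.of_forall fun x => mul_left_comm _ _ _) }
    change Continuous L
    refine sigma_withSeminorms.continuous_normedSpace_rng ℂ L
      ⟨{⟨1, one_pos⟩}, ⟨∫ x, ‖f x‖, integral_nonneg fun x => norm_nonneg _⟩, fun g => ?_⟩
    rw [Finset.sup_singleton]
    change ‖∫ x, f x * g x‖ ≤ (∫ x, ‖f x‖) * gsNorm s σ 1 g
    rw [← integral_mul_const]
    refine (norm_integral_le_integral_norm _).trans ?_
    refine integral_mono (f.integrable_mul g).norm (f.integrable.norm.mul_const _) fun x => ?_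
    change ‖f x * g x‖ ≤ _
    rw [norm_mul]
    exact mul_le_mul_of_nonneg_left (norm_le_gsNorm g x) (norm_nonneg _)

/-! ### Symbols -/

/-- The class `Γ_{s₁,s₂}^{σ₁,σ₂;0}(ℝ^{2d})`: the smooth `a` for which there is an `r > 0` such
that, for every `h > 0`, the supremum over `α`, `β`, `x`, `ξ` of
`|∂_x^α ∂_ξ^β a(x,ξ)| / (h^{|α+β|} α!^{σ₁} β!^{σ₂} exp(r(|x|^{1/s₁} + |ξ|^{1/s₂})))`
is finite. -/
def GammaZero (s₁ s₂ σ₁ σ₂ : ℝ) (d : ℕ) : Set (Eucl d × Eucl d → ℂ) :=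
  {a | ContDiff ℝ ∞ a ∧ ∃ r : ℝ, 0 < r ∧ ∀ h : ℝ, 0 < h → ∃ C : ℝ,
    ∀ (α β : Fin d → ℕ) (x ξ : Eucl d),
      ‖mderiv α (fun x' => mderiv β (fun ξ' => a (x', ξ')) ξ) x‖ ≤
        C * (h ^ (len α + len β) * mfact α ^ σ₁ * mfact β ^ σ₂ *
          Real.exp (r * (‖x‖ ^ (1 / s₁) + ‖ξ‖ ^ (1 / s₂))))}

/-! ### Pseudo-differential operators -/

/-- The inverse partial Fourier transform in the second variable,
`(2π)^{-d/2} ∫ Ψ(x,t) e^{i⟨t,ξ⟩} dt`. -/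
def invFourierSnd (Ψ : Eucl d × Eucl d → ℂ) : Eucl d × Eucl d → ℂ := fun p =>
  (((2 * Real.pi) ^ (-(d : ℝ) / 2) : ℝ) : ℂ) *
    ∫ t : Eucl d, Ψ (p.1, t) * Complex.exp (Complex.I * (inner ℝ t p.2 : ℝ))

/-- The inverse `(z, t) ↦ (z + A t, z + A t - t)` of the linear map
`(x, y) ↦ (x - A(x-y), x - y)`, both of determinant `± 1`. -/
def invShear (A : Matrix (Fin d) (Fin d) ℝ) (p : Eucl d × Eucl d) : Eucl d × Eucl d :=
  (p.1 + A.toEuclideanLin p.2, p.1 + A.toEuclideanLin p.2 - p.2)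

/-- The function `Ψ` on phase space such that the distribution
`K_{a,A}(x,y) = (2π)^{-d/2} (F₂⁻¹ a)(x - A(x-y), x-y)` satisfies
`⟨K_{a,A}, Φ⟩ = (2π)^{-d/2} ⟨a, Ψ⟩`, that is, `Ψ = F₂⁻¹ (Φ ∘ invShear A)`. -/
def kernelTest (A : Matrix (Fin d) (Fin d) ℝ) (Φ : Eucl d × Eucl d → ℂ) :
    Eucl d × Eucl d → ℂ :=
  invFourierSnd (fun p => Φ (invShear A p))

/-- The pairing `⟨K_{a,A}, Φ⟩` of the kernel of `Op_A(a)` with a test function `Φ`. -/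
def kernelPairing (A : Matrix (Fin d) (Fin d) ℝ) (a Φ : Eucl d × Eucl d → ℂ) : ℂ :=
  (((2 * Real.pi) ^ (-(d : ℝ) / 2) : ℝ) : ℂ) * ∫ p, a p * kernelTest A Φ p

/-- The tensor product `(g ⊗ f)(x,y) = g(x) f(y)`. -/
def tensor (g f : Eucl d → ℂ) : Eucl d × Eucl d → ℂ := fun p => g p.1 * f p.2

/-- The functional `g ↦ ⟨Op_A(a) f, g⟩ = ⟨K_{a,A}, g ⊗ f⟩` on `Σ_s^σ(ℝ^d)`: the distribution
`Op_A(a) f`. -/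
def Op (A : Matrix (Fin d) (Fin d) ℝ) (a : Eucl d × Eucl d → ℂ) (f : SigmaSpace s σ d) :
    SigmaSpace s σ d → ℂ :=
  fun g => kernelPairing A a (tensor g f)

end GelfandShilov

end

open GelfandShilov

/-! Write L for the linear map of A and P(b,g)(x) = ∫∫ b(x-L(x-y),η) g(y) e^{i⟨x-y,η⟩} dy dη, so
that Op_A(a) is (2π)^{-d} P(a,·). The y-integral must be taken first. It decays like e^{-|η|^{1/σ}}:
the amplitude y ↦ b(x-L(x-y),η) g(y) obeys Gevrey estimates of order σ with arbitrarily small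
constant, and repeated integration by parts turns these into decay of rate exceeding the growth r of
the symbol (`exists_oscInt_decay`, `exists_phaseInt_bound`).

Continuity on Σ_s^σ rests on two identities in which L no longer appears: ∂_i P(b,g) = P(∂_{x_i}b,g)
+ P(b,∂_i g) and x_i P(b,g) = P(b,y_i g) + i P(∂_{ξ_i}b,g) (`dirDeriv_opInt`, `coord_mul_opInt`).
Hence x^α∂^β P(b,g) consists of 2^{|α|+|β|} terms P(∂_x^{β'}∂_ξ^{α'}b, y^{α''}∂^{β''}g) with
α'+α''=α and β'+β''=β, each of which has the right factorials. The growth e^{rc|x|^{1/s}} left over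
from the symbol is removed by applying the bounds with additional monomials x^γ, since moment bounds
with a small constant are equivalent to exponential decay (`mul_exp_le_of_moments`,
`exists_opInt_bound`).

Derivatives of y^α∂^βf produce factors κ! which must be absorbed by κ!^{s+σ}. This is possible if
s+σ > 1, and trivially if d = 0 (`Admissible`). If s+σ = 1 and d ≥ 1, the space is zero: on a line f
extends to an entire function of order 1/s and small type which decays faster on a half-line, and
Phragmén-Lindelöf forces it to vanish (`entire_eq_zero_of_decay`).

For the dual space, Fubini identifies ∫ P(b,f)g with the phase-space integral of b against a
Wigner-type transform of (g,f). The substitution t ↦ -t then shows that the transpose is again an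
operator of this kind, with symbol b(x,-ξ) and map I-L (`integral_opInt_mul_comm`). The extension is
the adjoint of that operator, and adjoints are continuous for strong dual topologies.

Uniqueness among all continuous maps follows from the density of Σ_s^σ in its strong dual. Sets
bounded in every norm by prescribed constants are compact (`isCompact_sigmaBall`), so each
continuous functional on the strong dual is evaluation at some g (`exists_eval_eq`). If it
annihilates all functions, testing with the conjugate of g gives g = 0, and Hahn-Banach concludes.
-/

noncomputable section

namespace GelfandShilov

/-! ### Multi-index arithmetic -/

section MultiIndex

variable {d : ℕ}

theorem exists_eq_add_single (α : Fin d → ℕ) {i : Fin d} (hi : α i ≠ 0) :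
    ∃ α₁ : Fin d → ℕ, α = α₁ + Pi.single i 1 := by
  refine ⟨α - Pi.single i 1, ?_⟩
  funext j
  rw [Pi.add_apply, Pi.sub_apply]
  by_cases hj : j = i
  · subst hj; rw [Pi.single_eq_same]; omega
  · rw [Pi.single_eq_of_ne hj]; omega

/-- Induction on `len α`. The Leibniz-type estimates below proceed in this way, one derivative or
one coordinate at a time, so that no multinomial sums occur. -/
theorem multiIndex_induction {P : (Fin d → ℕ) → Prop} (h0 : P 0)
    (hs : ∀ α i, P α → P (α + Pi.single i 1)) (α : Fin d → ℕ) : P α := by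
  induction hn : len α generalizing α with
  | zero =>
    have : α = 0 := by
      funext i
      simp only [len, Finset.sum_eq_zero_iff, Finset.mem_univ, true_implies] at hn
      exact hn i
    rwa [this]
  | succ n ih =>
    obtain ⟨i, hi⟩ : ∃ i, α i ≠ 0 := by
      by_contra! h
      simp [len, h] at hn
    obtain ⟨α₁, rfl⟩ := exists_eq_add_single α hi
    refine hs _ _ (ih _ ?_)
    simp only [len, Pi.add_apply, Finset.sum_add_distrib, Finset.sum_pi_single',
      Finset.mem_univ, if_true] at hn ⊢
    omega

@[simp] theorem len_zero : len (0 : Fin d → ℕ) = 0 := by simp [len]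

@[simp] theorem len_add (α β : Fin d → ℕ) : len (α + β) = len α + len β := by
  simp [len, Finset.sum_add_distrib]

@[simp] theorem len_single (i : Fin d) (n : ℕ) : len (Pi.single i n) = n := by
  simp [len]

@[simp] theorem mfact_zero : mfact (0 : Fin d → ℕ) = 1 := by simp [mfact]

@[simp] theorem mfact_single (i : Fin d) (n : ℕ) : mfact (Pi.single i n) = (n ! : ℝ) := by
  unfold mfact
  rw [Finset.prod_eq_single i]
  · simp
  · intro j _ hj; simp [hj]
  · simp

theorem mfact_add_single (α : Fin d → ℕ) (i : Fin d) :
    mfact (α + Pi.single i 1) = (α i + 1) * mfact α := by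
  unfold mfact
  rw [← Finset.mul_prod_erase _ _ (Finset.mem_univ i),
    ← Finset.mul_prod_erase Finset.univ (fun j => ((α j)! : ℝ)) (Finset.mem_univ i), ← mul_assoc]
  congr 1
  · simp [Nat.factorial_succ]
  · refine Finset.prod_congr rfl fun j hj => ?_
    simp [Finset.ne_of_mem_erase hj]

theorem mfact_mul_le (α β : Fin d → ℕ) : mfact α * mfact β ≤ mfact (α + β) := by
  unfold mfact
  rw [← Finset.prod_mul_distrib]
  refine Finset.prod_le_prod (fun i _ => by positivity) fun i _ => ?_
  exact_mod_cast Nat.le_of_dvd (Nat.factorial_pos _) (Nat.factorial_mul_factorial_dvd_factorial_add _ _)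

/-- A binomial coefficient is at most 2^{m+n}. Geometric losses of this kind are harmless: the
seminorms and symbol bounds hold for every h > 0, so a smaller h absorbs them. -/
theorem factorial_add_le (m n : ℕ) : (m + n)! ≤ 2 ^ (m + n) * (m ! * n !) := by
  rw [← Nat.add_choose_mul_factorial_mul_factorial, mul_assoc]
  exact Nat.mul_le_mul_right _ (Nat.choose_le_two_pow _ _)

theorem mfact_add_le (α β : Fin d → ℕ) :
    mfact (α + β) ≤ 2 ^ (len α + len β) * (mfact α * mfact β) := by
  unfold mfact
  rw [← len_add, len, ← Finset.prod_pow_eq_pow_sum, ← Finset.prod_mul_distrib,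
    ← Finset.prod_mul_distrib]
  refine Finset.prod_le_prod (fun i _ => by positivity) fun i _ => ?_
  exact_mod_cast factorial_add_le _ _

theorem mfact_le_factorial_len (α : Fin d → ℕ) : mfact α ≤ ((len α)! : ℝ) := by
  induction α using multiIndex_induction with
  | h0 => simp
  | hs α i ih =>
    rw [mfact_add_single, len_add, len_single, Nat.factorial_succ]
    push_cast
    have : α i ≤ len α := Finset.single_le_sum (f := α) (fun _ _ => Nat.zero_le _) (Finset.mem_univ i)
    have : (α i : ℝ) ≤ len α := by exact_mod_cast this
    have := (mfact_pos α).le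
    gcongr

theorem monom_add (α β : Fin d → ℕ) (x : Eucl d) :
    monom (α + β) x = monom α x * monom β x := by
  simp [monom, pow_add, Finset.prod_mul_distrib]

@[simp] theorem monom_zero (x : Eucl d) : monom 0 x = 1 := by simp [monom]

@[simp] theorem monom_single (i : Fin d) (n : ℕ) (x : Eucl d) :
    monom (Pi.single i n) x = x i ^ n := by
  unfold monom
  rw [Finset.prod_eq_single i]
  · simp
  · intro j _ hj; simp [hj]
  · simp

theorem monom_add_single (α : Fin d → ℕ) (i : Fin d) (x : Eucl d) :
    monom (α + Pi.single i 1) x = monom α x * x i := by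
  rw [monom_add, monom_single, pow_one]

end MultiIndex

/-! ### Iterated directional derivatives -/

section DirDeriv

variable {V : Type*} [NormedAddCommGroup V] [NormedSpace ℝ V] {d : ℕ}

/-- The derivative of `f` in the direction `v`. -/
def dirDeriv (v : V) (f : V → ℂ) : V → ℂ := fun x => fderiv ℝ f x v

/-- The iterated derivative `∂_{e 1}^{α 1} ⋯ ∂_{e d}^{α d} f`. -/
def multiDeriv (e : Fin d → V) (α : Fin d → ℕ) (f : V → ℂ) : V → ℂ :=
  (List.finRange d).foldr (fun i g => (dirDeriv (e i))^[α i] g) f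

theorem dirDeriv_smooth (v : V) {f : V → ℂ} (hf : ContDiff ℝ ∞ f) :
    ContDiff ℝ ∞ (dirDeriv v f) :=
  (hf.fderiv_right (m := ∞) (by simp)).clm_apply contDiff_const

/-- Symmetry of the second derivative, which makes the fixed order of the factors in `multiDeriv`
immaterial. -/
theorem dirDeriv_comm (v w : V) {f : V → ℂ} (hf : ContDiff ℝ ∞ f) :
    dirDeriv v (dirDeriv w f) = dirDeriv w (dirDeriv v f) := by
  have h1 : Differentiable ℝ (fderiv ℝ f) :=
    (hf.fderiv_right (m := ∞) (by simp)).differentiable (by simp)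
  have h2 : Differentiable ℝ f := hf.differentiable (by simp)
  funext x
  have key : ∀ v w : V, dirDeriv v (dirDeriv w f) x = fderiv ℝ (fderiv ℝ f) x v w := by
    intro v w
    unfold dirDeriv
    rw [fderiv_clm_apply (h1 x) (differentiableAt_const w)]
    simp
  rw [key, key]
  exact second_derivative_symmetric (fun y => (h2 y).hasFDerivAt) (h1 x).hasFDerivAt v w

theorem dirDeriv_add (v : V) {f g : V → ℂ} (hf : ContDiff ℝ ∞ f) (hg : ContDiff ℝ ∞ g) :
    dirDeriv v (f + g) = dirDeriv v f + dirDeriv v g := by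
  funext x
  simp [dirDeriv, fderiv_add (hf.differentiable (by simp) x) (hg.differentiable (by simp) x)]

theorem dirDeriv_smul (v : V) (c : ℂ) {f : V → ℂ} (hf : ContDiff ℝ ∞ f) :
    dirDeriv v (c • f) = c • dirDeriv v f := by
  funext x
  simp [dirDeriv, fderiv_const_smul (hf.differentiable (by simp) x)]

theorem dirDeriv_iterate_smooth (v : V) (n : ℕ) {f : V → ℂ} (hf : ContDiff ℝ ∞ f) :
    ContDiff ℝ ∞ ((dirDeriv v)^[n] f) := by
  induction n with
  | zero => exact hf
  | succ n ih => rw [Function.iterate_succ_apply']; exact dirDeriv_smooth v ih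

theorem dirDeriv_iterate_comm (v w : V) (n : ℕ) {f : V → ℂ} (hf : ContDiff ℝ ∞ f) :
    dirDeriv v ((dirDeriv w)^[n] f) = (dirDeriv w)^[n] (dirDeriv v f) := by
  induction n with
  | zero => rfl
  | succ n ih =>
    rw [Function.iterate_succ_apply', Function.iterate_succ_apply',
      dirDeriv_comm v w (dirDeriv_iterate_smooth w n hf), ih]

theorem multiDeriv_list_smooth (e : Fin d → V) (α : Fin d → ℕ) (l : List (Fin d)) {f : V → ℂ}
    (hf : ContDiff ℝ ∞ f) :
    ContDiff ℝ ∞ (l.foldr (fun i g => (dirDeriv (e i))^[α i] g) f) := by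
  induction l with
  | nil => exact hf
  | cons i l ih => exact dirDeriv_iterate_smooth _ _ ih

theorem multiDeriv_smooth (e : Fin d → V) (α : Fin d → ℕ) {f : V → ℂ} (hf : ContDiff ℝ ∞ f) :
    ContDiff ℝ ∞ (multiDeriv e α f) :=
  multiDeriv_list_smooth e α _ hf

@[simp] theorem multiDeriv_zero (e : Fin d → V) (f : V → ℂ) : multiDeriv e 0 f = f := by
  unfold multiDeriv
  induction List.finRange d with
  | nil => rfl
  | cons i l ih => simp

theorem dirDeriv_multiDeriv_comm (v : V) (e : Fin d → V) (α : Fin d → ℕ) {f : V → ℂ}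
    (hf : ContDiff ℝ ∞ f) :
    dirDeriv v (multiDeriv e α f) = multiDeriv e α (dirDeriv v f) := by
  unfold multiDeriv
  induction List.finRange d with
  | nil => rfl
  | cons i l ih =>
    rw [List.foldr_cons, List.foldr_cons,
      dirDeriv_iterate_comm _ _ _ (multiDeriv_list_smooth e α l hf), ih]

theorem multiDeriv_add_single (e : Fin d → V) (α : Fin d → ℕ) (i : Fin d) {f : V → ℂ}
    (hf : ContDiff ℝ ∞ f) :
    multiDeriv e (α + Pi.single i 1) f = dirDeriv (e i) (multiDeriv e α f) := by
  -- Without repetitions in the list, raising the entry i adds exactly one derivative, and that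
  -- derivative commutes to the front.
  have key : ∀ l : List (Fin d), l.Nodup →
      l.foldr (fun j g => (dirDeriv (e j))^[(α + Pi.single i 1 : Fin d → ℕ) j] g) f =
        if i ∈ l then dirDeriv (e i) (l.foldr (fun j g => (dirDeriv (e j))^[α j] g) f)
        else l.foldr (fun j g => (dirDeriv (e j))^[α j] g) f := by
    intro l hl
    induction l with
    | nil => simp
    | cons j l ih =>
      obtain ⟨hj, hl'⟩ := List.nodup_cons.1 hl
      rw [List.foldr_cons, List.foldr_cons, ih hl']
      by_cases hij : i = j
      · subst hij
        simp only [hj, if_false, List.mem_cons, true_or, if_true, Pi.add_apply, Pi.single_eq_same]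
        rw [Function.iterate_succ_apply']
      · have hji : j ≠ i := fun h => hij h.symm
        by_cases hil : i ∈ l
        · simp only [hil, if_true, List.mem_cons, or_true, Pi.add_apply,
            Pi.single_eq_of_ne hji, add_zero]
          rw [dirDeriv_iterate_comm _ _ _ (multiDeriv_list_smooth e α l hf)]
        · simp only [hil, if_false, List.mem_cons, hij, or_self, Pi.add_apply,
            Pi.single_eq_of_ne hji, add_zero]
  have := key (List.finRange d) (List.nodup_finRange d)
  simpa [multiDeriv] using this

theorem multiDeriv_add_single' (e : Fin d → V) (α : Fin d → ℕ) (i : Fin d) {f : V → ℂ}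
    (hf : ContDiff ℝ ∞ f) :
    multiDeriv e (α + Pi.single i 1) f = multiDeriv e α (dirDeriv (e i) f) := by
  rw [multiDeriv_add_single e α i hf, dirDeriv_multiDeriv_comm _ _ _ hf]

theorem multiDeriv_single (e : Fin d → V) (i : Fin d) {f : V → ℂ} (hf : ContDiff ℝ ∞ f) :
    multiDeriv e (Pi.single i 1) f = dirDeriv (e i) f := by
  simpa using multiDeriv_add_single e 0 i hf

theorem multiDeriv_add_index (e : Fin d → V) (α β : Fin d → ℕ) {f : V → ℂ}
    (hf : ContDiff ℝ ∞ f) :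
    multiDeriv e (α + β) f = multiDeriv e α (multiDeriv e β f) := by
  induction α using multiIndex_induction with
  | h0 => simp
  | hs α i ih =>
    rw [add_right_comm, multiDeriv_add_single e _ i hf, ih,
      multiDeriv_add_single e _ i (multiDeriv_smooth e β hf)]

theorem multiDeriv_comm (e e' : Fin d → V) (α β : Fin d → ℕ) {f : V → ℂ}
    (hf : ContDiff ℝ ∞ f) :
    multiDeriv e α (multiDeriv e' β f) = multiDeriv e' β (multiDeriv e α f) := by
  induction α using multiIndex_induction with
  | h0 => simp
  | hs α i ih =>
    rw [multiDeriv_add_single e _ i (multiDeriv_smooth e' β hf), ih,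
      dirDeriv_multiDeriv_comm _ _ _ (multiDeriv_smooth e α hf), multiDeriv_add_single e _ i hf]

theorem multiDeriv_add (e : Fin d → V) (α : Fin d → ℕ) {f g : V → ℂ} (hf : ContDiff ℝ ∞ f)
    (hg : ContDiff ℝ ∞ g) : multiDeriv e α (f + g) = multiDeriv e α f + multiDeriv e α g := by
  induction α using multiIndex_induction with
  | h0 => simp
  | hs α i ih =>
    have hfg : ContDiff ℝ ∞ (f + g) := hf.add hg
    rw [multiDeriv_add_single e _ i hfg, ih, multiDeriv_add_single e _ i hf,
      multiDeriv_add_single e _ i hg,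
      dirDeriv_add _ (multiDeriv_smooth e α hf) (multiDeriv_smooth e α hg)]

theorem multiDeriv_smul (e : Fin d → V) (α : Fin d → ℕ) (c : ℂ) {f : V → ℂ}
    (hf : ContDiff ℝ ∞ f) : multiDeriv e α (c • f) = c • multiDeriv e α f := by
  induction α using multiIndex_induction with
  | h0 => simp
  | hs α i ih =>
    have hcf : ContDiff ℝ ∞ (c • f) := hf.const_smul c
    rw [multiDeriv_add_single e _ i hcf, ih, multiDeriv_add_single e _ i hf,
      dirDeriv_smul _ _ (multiDeriv_smooth e α hf)]

/-- Iterated derivatives commute with composition with an affine map. -/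
theorem multiDeriv_comp_affine {V' : Type*} [NormedAddCommGroup V'] [NormedSpace ℝ V']
    (e : Fin d → V) (α : Fin d → ℕ) {f : V' → ℂ} (hf : ContDiff ℝ ∞ f) (ℓ : V →L[ℝ] V') (c : V') :
    multiDeriv e α (fun x => f (ℓ x + c)) = fun x => multiDeriv (fun i => ℓ (e i)) α f (ℓ x + c) := by
  have hsm : ContDiff ℝ ∞ (fun x => f (ℓ x + c)) := hf.comp (ℓ.contDiff.add contDiff_const)
  induction α using multiIndex_induction with
  | h0 => simp
  | hs α i ih =>
    rw [multiDeriv_add_single e _ i hsm, ih, multiDeriv_add_single _ _ i hf]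
    funext x
    unfold dirDeriv
    have hg := (multiDeriv_smooth (fun i => ℓ (e i)) α hf).differentiable (by simp)
    have h2 : HasFDerivAt (fun x => ℓ x + c) ℓ x := ℓ.hasFDerivAt.add_const c
    have := ((hg (ℓ x + c)).hasFDerivAt).comp x h2
    rw [HasFDerivAt.fderiv (f := fun x => multiDeriv (fun i => ℓ (e i)) α f (ℓ x + c)) this]
    rfl

end DirDeriv

/-- The standard basis of `ℝ^d`. -/
abbrev stdVec {d : ℕ} (i : Fin d) : Eucl d := EuclideanSpace.single i 1

/-- Derivatives along arbitrary families of vectors are needed on phase space and after affine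
substitutions; the standard basis gives back the partial derivatives definitionally. -/
theorem mderiv_eq_multiDeriv {d : ℕ} (α : Fin d → ℕ) (f : Eucl d → ℂ) :
    mderiv α f = multiDeriv stdVec α f := rfl

/-! ### Moments, factorials and exponentials -/

section Moments

/-- Powers with exponent 1/s turn m!^s into m!. Dividing by (2κ)^m m!, where κ = k^{1/s}, and
summing over m gives an exponential series on the left and a geometric series on the right; the
power s then restores X and K. -/
theorem mul_exp_le_of_moments {u X K k s : ℝ} (hu : 0 ≤ u) (hX : 0 ≤ X) (hK : 0 ≤ K)
    (hk : 0 < k) (hs : 0 < s) (h : ∀ m : ℕ, u ^ m * X ≤ K * k ^ m * (m ! : ℝ) ^ s) :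
    X * Real.exp (s / (2 * k ^ (1 / s)) * u ^ (1 / s)) ≤ 2 ^ s * K := by
  set τ := u ^ (1 / s) with hτ
  set κ := k ^ (1 / s) with hκ
  set Y := X ^ (1 / s) with hY
  set L := K ^ (1 / s) with hL
  have hs' : (0 : ℝ) ≤ 1 / s := by positivity
  have hκ0 : 0 < κ := Real.rpow_pos_of_pos hk _
  have hτ0 : 0 ≤ τ := Real.rpow_nonneg hu _
  have hY0 : 0 ≤ Y := Real.rpow_nonneg hX _
  have hL0 : 0 ≤ L := Real.rpow_nonneg hK _
  have back : ∀ {a : ℝ}, 0 ≤ a → (a ^ (1 / s)) ^ s = a := fun {a} ha => by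
    rw [← Real.rpow_mul ha, one_div_mul_cancel hs.ne', Real.rpow_one]
  have hm : ∀ m : ℕ, τ ^ m * Y ≤ L * κ ^ m * (m ! : ℝ) := by
    intro m
    have h1 := Real.rpow_le_rpow (by positivity) (h m) hs'
    rw [Real.mul_rpow (by positivity) hX, Real.mul_rpow (by positivity) (by positivity),
      Real.mul_rpow hK (by positivity), ← Real.rpow_mul (by positivity) s,
      mul_one_div_cancel hs.ne', Real.rpow_one] at h1
    have e : ∀ {a : ℝ}, 0 ≤ a → (a ^ m) ^ (1 / s) = (a ^ (1 / s)) ^ m := fun {a} ha => by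
      rw [← Real.rpow_natCast, ← Real.rpow_natCast, ← Real.rpow_mul ha, ← Real.rpow_mul ha,
        mul_comm]
    rwa [e hu, e hk.le] at h1
  have hsum : Y * Real.exp (τ / (2 * κ)) ≤ 2 * L := by
    have h1 : HasSum (fun m : ℕ => Y * ((τ / (2 * κ)) ^ m / (m ! : ℝ)))
        (Y * Real.exp (τ / (2 * κ))) := by
      have := NormedSpace.exp_series_hasSum_exp' (𝕂 := ℝ) (τ / (2 * κ))
      rw [← Real.exp_eq_exp_ℝ] at this
      simpa [div_eq_inv_mul] using this.mul_left Y
    have h2 : HasSum (fun m : ℕ => L * (1 / 2 : ℝ) ^ m) (L * 2) := hasSum_geometric_two.mul_left L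
    have := hasSum_le (fun m => ?_) h1 h2
    · linarith
    · have hf : (0 : ℝ) < (m ! : ℝ) := by positivity
      rw [div_pow, mul_pow, one_div, inv_pow]
      rw [show Y * (τ ^ m / (2 ^ m * κ ^ m) / (m ! : ℝ)) =
        (τ ^ m * Y) / (κ ^ m * (m ! : ℝ)) * (2 ^ m)⁻¹ by field_simp]
      refine mul_le_mul_of_nonneg_right ?_ (by positivity)
      rw [div_le_iff₀ (by positivity)]
      linarith [hm m]
  have h3 := Real.rpow_le_rpow (by positivity) hsum hs.le
  rw [Real.mul_rpow hY0 (Real.exp_pos _).le, Real.mul_rpow (by norm_num) hL0, back hX, back hK,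
    ← Real.exp_mul] at h3
  convert h3 using 3
  field_simp

/-- The sequence (t^{1/ε})^n / n! tends to zero, hence is bounded; the bound is raised to the power
ε. -/
theorem exists_pow_le_factorial_rpow (t : ℝ) (ht : 0 ≤ t) {ε : ℝ} (hε : 0 < ε) :
    ∃ C : ℝ, 0 < C ∧ ∀ n : ℕ, t ^ n ≤ C * (n ! : ℝ) ^ ε := by
  obtain ⟨M, hM⟩ := (FloorSemiring.tendsto_pow_div_factorial_atTop (t ^ (1 / ε))).bddAbove_range
  have hM' : ∀ n : ℕ, (t ^ (1 / ε)) ^ n / (n ! : ℝ) ≤ max M 1 := fun n =>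
    (hM ⟨n, rfl⟩).trans (le_max_left _ _)
  have hM0 : 0 < max M 1 := lt_max_of_lt_right one_pos
  refine ⟨max M 1 ^ ε, by positivity, fun n => ?_⟩
  have h1 := hM' n
  rw [div_le_iff₀ (by positivity)] at h1
  have h2 := Real.rpow_le_rpow (by positivity) h1 hε.le
  rw [Real.mul_rpow hM0.le (by positivity), ← Real.rpow_natCast, ← Real.rpow_mul ht,
    ← Real.rpow_mul ht] at h2
  rwa [show 1 / ε * n * ε = n by field_simp, Real.rpow_natCast] at h2

theorem exists_pow_le_mfact_rpow {d : ℕ} (t : ℝ) (ht : 0 ≤ t) {ε : ℝ} (hε : 0 < ε) :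
    ∃ C : ℝ, 0 < C ∧ ∀ κ : Fin d → ℕ, t ^ len κ ≤ C * mfact κ ^ ε := by
  obtain ⟨C, hC, h⟩ := exists_pow_le_factorial_rpow t ht hε
  refine ⟨C ^ d, by positivity, fun κ => ?_⟩
  unfold mfact len
  rw [← Finset.prod_pow_eq_pow_sum, ← Real.finsetProd_rpow _ _ (fun i _ => by positivity)]
  calc ∏ i, t ^ κ i ≤ ∏ i, C * ((κ i)! : ℝ) ^ ε :=
        Finset.prod_le_prod (fun i _ => by positivity) fun i _ => h _
    _ = _ := by rw [Finset.prod_mul_distrib]; simp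

theorem norm_le_sum_abs {d : ℕ} (x : Eucl d) : ‖x‖ ≤ ∑ j, |x j| := by
  rw [EuclideanSpace.norm_eq]
  refine Real.sqrt_le_left (Finset.sum_nonneg fun _ _ => abs_nonneg _) |>.2 ?_ |>.trans le_rfl
  simpa using Finset.sum_sq_le_sq_sum_of_nonneg (s := Finset.univ) (f := fun j => |x j|)
    (fun _ _ => abs_nonneg _)

theorem eq_zero_or_exists_norm_le {d : ℕ} (x : Eucl d) : x = 0 ∨ ∃ j, ‖x‖ ≤ d * |x j| := by
  rcases isEmpty_or_nonempty (Fin d) with hd | hd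
  · left; ext i; exact hd.elim i
  · right
    obtain ⟨j, -, hj⟩ := Finset.exists_max_image Finset.univ (fun j => |x j|) Finset.univ_nonempty
    refine ⟨j, (norm_le_sum_abs x).trans ?_⟩
    calc ∑ i, |x i| ≤ ∑ _i : Fin d, |x j| := Finset.sum_le_sum fun i hi => hj i hi
      _ = d * |x j| := by simp

/-- Moment bounds in all coordinates imply exponential decay. -/
theorem exists_norm_exp_decay (d : ℕ) {s : ℝ} (hs : 0 < s) {R : ℝ} (hR : 0 < R) :
    ∃ k : ℝ, 0 < k ∧ k ≤ 1 ∧ ∀ (x : Eucl d) (X K : ℝ), 0 ≤ X → X ≤ K →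
      (∀ (j : Fin d) (m : ℕ), |x j| ^ m * X ≤ K * k ^ m * (m ! : ℝ) ^ s) →
      X * Real.exp (R * ‖x‖ ^ (1 / s)) ≤ 2 ^ s * K := by
  -- This makes the rate s/(2k^{1/s}) of `mul_exp_le_of_moments` at least R(d+1)^{1/s} for k ≤ k₀.
  -- The factor relates ‖x‖ to its largest coordinate, and d + 1 instead of d keeps the quotient
  -- positive for d = 0.
  set k₀ : ℝ := (s / (2 * R * (d + 1 : ℝ) ^ (1 / s))) ^ s with hk₀
  have hk₀' : 0 < k₀ := by positivity
  refine ⟨min k₀ 1, lt_min hk₀' one_pos, min_le_right _ _, fun x X K hX hXK h => ?_⟩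
  set k := min k₀ 1
  have hk : 0 < k := lt_min hk₀' one_pos
  have hkk : k ^ (1 / s) ≤ s / (2 * R * (d + 1 : ℝ) ^ (1 / s)) := by
    calc k ^ (1 / s) ≤ k₀ ^ (1 / s) :=
          Real.rpow_le_rpow hk.le (min_le_left _ _) (by positivity)
      _ = _ := by
          rw [hk₀, ← Real.rpow_mul (by positivity), mul_one_div_cancel hs.ne', Real.rpow_one]
  -- At the origin, and so always for d = 0, no coordinate is needed and X ≤ K suffices.
  rcases eq_zero_or_exists_norm_le x with rfl | ⟨j, hj⟩
  · rw [norm_zero, Real.zero_rpow (by positivity), mul_zero, Real.exp_zero, mul_one]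
    have : (1 : ℝ) ≤ 2 ^ s := Real.one_le_rpow (by norm_num) hs.le
    nlinarith
  · refine le_trans ?_ (mul_exp_le_of_moments (abs_nonneg (x j)) hX (hX.trans hXK) hk hs (h j))
    refine mul_le_mul_of_nonneg_left (Real.exp_le_exp.2 ?_) hX
    have h1 : ‖x‖ ^ (1 / s) ≤ (d + 1 : ℝ) ^ (1 / s) * |x j| ^ (1 / s) := by
      rw [← Real.mul_rpow (by positivity) (abs_nonneg _)]
      refine Real.rpow_le_rpow (norm_nonneg _) (hj.trans ?_) (by positivity)
      nlinarith [abs_nonneg (x j)]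
    have h2 : R * (d + 1 : ℝ) ^ (1 / s) ≤ s / (2 * k ^ (1 / s)) := by
      have hkp : 0 < k ^ (1 / s) := Real.rpow_pos_of_pos hk _
      rw [le_div_iff₀ (by positivity)] at hkk ⊢
      linarith
    calc R * ‖x‖ ^ (1 / s) ≤ R * ((d + 1 : ℝ) ^ (1 / s) * |x j| ^ (1 / s)) := by gcongr
      _ = (R * (d + 1 : ℝ) ^ (1 / s)) * |x j| ^ (1 / s) := by ring
      _ ≤ _ := by gcongr

end Moments

/-! ### Monomials times derivatives -/

section MonomDeriv

variable {d : ℕ}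

theorem monom_smooth (α : Fin d → ℕ) :
    ContDiff ℝ ∞ (fun y : Eucl d => (monom α y : ℂ)) := by
  have : ContDiff ℝ ∞ (fun y : Eucl d => monom α y) := by
    unfold monom
    exact contDiff_prod fun i _ => ((EuclideanSpace.proj i : Eucl d →L[ℝ] ℝ).contDiff).pow _
  exact Complex.ofRealCLM.contDiff.comp this

theorem dirDeriv_mul {V : Type*} [NormedAddCommGroup V] [NormedSpace ℝ V] (v : V) {f g : V → ℂ}
    (hf : ContDiff ℝ ∞ f) (hg : ContDiff ℝ ∞ g) :
    dirDeriv v (fun x => f x * g x) = fun x => dirDeriv v f x * g x + f x * dirDeriv v g x := by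
  funext x
  have := ((hf.differentiable (by simp) x).hasFDerivAt.mul
    (hg.differentiable (by simp) x).hasFDerivAt).fderiv
  unfold dirDeriv
  rw [show (fun x => f x * g x) = f * g from rfl, this]
  simp
  ring

theorem dirDeriv_coord (i j : Fin d) :
    dirDeriv (stdVec i) (fun y : Eucl d => (y j : ℂ)) = fun _ => if i = j then 1 else 0 := by
  funext x
  have : HasFDerivAt (fun y : Eucl d => (y j : ℂ))
      (Complex.ofRealCLM.comp (EuclideanSpace.proj j : Eucl d →L[ℝ] ℝ)) x :=
    (Complex.ofRealCLM.comp (EuclideanSpace.proj j : Eucl d →L[ℝ] ℝ)).hasFDerivAt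
  unfold dirDeriv
  rw [this.fderiv]
  by_cases h : i = j
  · simp [h, stdVec]
  · simp [h, stdVec, Ne.symm h]

theorem coord_smooth (j : Fin d) : ContDiff ℝ ∞ (fun y : Eucl d => (y j : ℂ)) :=
  (Complex.ofRealCLM.comp (EuclideanSpace.proj j : Eucl d →L[ℝ] ℝ)).contDiff

theorem dirDeriv_monom_of_eq_zero (α : Fin d → ℕ) (i : Fin d) (hα : α i = 0) :
    dirDeriv (stdVec i) (fun y : Eucl d => (monom α y : ℂ)) = 0 := by
  induction α using multiIndex_induction with
  | h0 => funext x; simp [dirDeriv]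
  | hs α j ih =>
    have hij : i ≠ j := by rintro rfl; simp at hα
    have hα' : α i = 0 := by simpa [hij] using hα
    simp only [monom_add_single, Complex.ofReal_mul]
    rw [dirDeriv_mul _ (monom_smooth α) (coord_smooth j), ih hα', dirDeriv_coord]
    simp [hij]
    rfl

theorem dirDeriv_monom_add_single (α : Fin d → ℕ) (i : Fin d) :
    dirDeriv (stdVec i) (fun y : Eucl d => (monom (α + Pi.single i 1) y : ℂ)) =
      fun y => (α i + 1 : ℂ) * monom α y := by
  induction α using multiIndex_induction with
  | h0 =>
    simp only [zero_add, monom_single, pow_one]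
    rw [dirDeriv_coord]
    simp
  | hs α j ih =>
    have : α + Pi.single j 1 + Pi.single i 1 = (α + Pi.single i 1) + Pi.single j 1 :=
      add_right_comm _ _ _
    rw [this]
    simp only [monom_add_single (α + Pi.single i 1) j, monom_add_single α j, Complex.ofReal_mul]
    rw [dirDeriv_mul _ (monom_smooth _) (coord_smooth j), ih, dirDeriv_coord]
    funext x
    by_cases hij : i = j
    · subst hij
      simp [monom_add_single]
      ring
    · simp [hij]
      ring

/-- The derivatives of `x^α F` are controlled by the terms of the Leibniz formula. -/
theorem norm_mderiv_monom_mul_le (δ : Fin d → ℕ) (y : Eucl d) :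
    ∀ (α : Fin d → ℕ) (F : Eucl d → ℂ) (K : ℝ), ContDiff ℝ ∞ F →
      (∀ κ α' δ' : Fin d → ℕ, α' + κ = α → δ' + κ = δ →
        mfact α / mfact α' * |monom α' y| * ‖mderiv δ' F y‖ ≤ K) →
      ‖mderiv δ (fun y => (monom α y : ℂ) * F y) y‖ ≤ 2 ^ len δ * K := by
  simp only [mderiv_eq_multiDeriv]
  induction δ using multiIndex_induction with
  | h0 =>
    intro α F K hF h
    have := h 0 α 0 (by simp) (by simp)
    rw [div_self (mfact_pos α).ne'] at this
    simpa using this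
  | hs δ i ih =>
    intro α F K hF h
    have hm := (monom_smooth α).mul hF
    rw [multiDeriv_add_single' _ _ _ hm, dirDeriv_mul _ (monom_smooth α) hF, len_add, len_single,
      pow_succ, mul_assoc, two_mul, mul_add]
    have h2 : ‖multiDeriv stdVec δ (fun y => (monom α y : ℂ) * dirDeriv (stdVec i) F y) y‖ ≤
        2 ^ len δ * K := by
      refine ih α _ K (dirDeriv_smooth _ hF) fun κ α' δ' h1 h2 => ?_
      rw [← multiDeriv_add_single' _ _ _ hF]
      exact h κ α' _ h1 (by rw [add_right_comm, h2])
    have h1 : ‖multiDeriv stdVec δ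
        (fun y => dirDeriv (stdVec i) (fun y => (monom α y : ℂ)) y * F y) y‖ ≤ 2 ^ len δ * K := by
      by_cases hα : α i = 0
      · rw [dirDeriv_monom_of_eq_zero α i hα]
        have hK : 0 ≤ K := (h 0 α (δ + Pi.single i 1) (by simp) (by simp)).trans' (by
          have := mfact_pos α; positivity)
        have : multiDeriv stdVec δ (fun y : Eucl d => (0 : Eucl d → ℂ) y * F y) = 0 := by
          have h0 := multiDeriv_smul stdVec δ 0 hF
          rw [zero_smul, zero_smul] at h0
          rw [show (fun y : Eucl d => (0 : Eucl d → ℂ) y * F y) = 0 from funext fun z => zero_mul _, h0]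
        rw [this]
        simp only [Pi.zero_apply, norm_zero]
        positivity
      · obtain ⟨α₁, rfl⟩ := exists_eq_add_single α hα
        rw [dirDeriv_monom_add_single]
        have e : (fun y => (α₁ i + 1 : ℂ) * (monom α₁ y : ℂ) * F y) =
            (fun y => (monom α₁ y : ℂ) * ((α₁ i + 1 : ℂ) • F) y) := by
          funext y; simp; ring
        rw [e]
        have hcF : ContDiff ℝ ∞ ((α₁ i + 1 : ℂ) • F) := hF.const_smul (α₁ i + 1 : ℂ)
        refine ih α₁ _ K hcF fun κ α' δ' h1 h2 => ?_
        -- The factor α₁ i + 1 of the differentiated monomial is what turns α₁!/α'! into α!/α'!.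
        have := h (κ + Pi.single i 1) α' δ' (by rw [← add_assoc, h1]) (by rw [← add_assoc, h2])
        rw [mfact_add_single] at this
        rw [multiDeriv_smul _ _ _ hF, Pi.smul_apply, norm_smul]
        have hn : ‖(α₁ i + 1 : ℂ)‖ = α₁ i + 1 := by
          rw [show (α₁ i + 1 : ℂ) = ((α₁ i + 1 : ℝ) : ℂ) by push_cast; rfl, Complex.norm_real,
            Real.norm_of_nonneg (by positivity)]
        rw [hn]
        calc _ = _ := by ring
          _ ≤ K := this
    have hs1 : ContDiff ℝ ∞ (fun y => dirDeriv (stdVec i) (fun y => (monom α y : ℂ)) y * F y) :=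
      (dirDeriv_smooth _ (monom_smooth α)).mul hF
    have hs2 : ContDiff ℝ ∞ (fun y => (monom α y : ℂ) * dirDeriv (stdVec i) F y) :=
      (monom_smooth α).mul (dirDeriv_smooth _ hF)
    have := multiDeriv_add stdVec δ hs1 hs2
    rw [show (fun x => dirDeriv (stdVec i) (fun y => (monom α y : ℂ)) x * F x +
      (monom α x : ℂ) * dirDeriv (stdVec i) F x) =
      (fun y => dirDeriv (stdVec i) (fun y => (monom α y : ℂ)) y * F y) +
      (fun y => (monom α y : ℂ) * dirDeriv (stdVec i) F y) from rfl, this]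
    exact (norm_add_le _ _).trans (add_le_add h1 h2)

end MonomDeriv

/-! ### Estimates in `Σ_s^σ` -/

section SigmaEstimates

variable {s σ : ℝ} {d : ℕ}

/-- Factorials are dominated, up to geometric factors, by their powers of exponent `s + σ`. -/
def Admissible (s σ : ℝ) (d : ℕ) : Prop :=
  ∀ t : ℝ, 0 < t → ∃ C : ℝ, 0 < C ∧ ∀ κ : Fin d → ℕ,
    t ^ len κ * mfact κ ≤ C * mfact κ ^ (s + σ)

/-- The surplus κ!^{s+σ-1} outgrows every geometric sequence. -/
theorem admissible_of_one_lt (h : 1 < s + σ) : Admissible s σ d := by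
  intro t ht
  obtain ⟨C, hC, hb⟩ := exists_pow_le_mfact_rpow (d := d) t ht.le (sub_pos.2 h)
  refine ⟨C, hC, fun κ => ?_⟩
  have hκ := mfact_pos κ
  calc t ^ len κ * mfact κ ≤ C * mfact κ ^ (s + σ - 1) * mfact κ := by gcongr; exact hb κ
    _ = C * mfact κ ^ (s + σ) := by
      rw [mul_assoc, ← Real.rpow_add_one hκ.ne', sub_add_cancel]

/-- In dimension zero the only multi-index is 0. -/
theorem admissible_zero : Admissible s σ 0 := fun t _ => ⟨1, one_pos, fun κ => by
  rw [show κ = 0 from Subsingleton.elim _ _, len_zero, mfact_zero]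
  simp⟩

theorem gsNorm_nonneg {h : ℝ} (hh : 0 < h) (f : Eucl d → ℂ) : 0 ≤ gsNorm s σ h f :=
  Real.iSup_nonneg fun p => gsQuot_nonneg s σ hh f p

theorem monom_mderiv_le (f : SigmaSpace s σ d) {h : ℝ} (hh : 0 < h) (α β : Fin d → ℕ)
    (y : Eucl d) :
    |monom α y| * ‖mderiv β f y‖ ≤
      gsNorm s σ h f * (h ^ (len α + len β) * mfact α ^ s * mfact β ^ σ) := by
  have := gsQuot_le_gsNorm f hh (α, β, y)
  unfold gsQuot at this
  rwa [div_le_iff₀ (gsDen_pos s σ hh α β), norm_mul, Complex.norm_real, Real.norm_eq_abs] at this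

theorem mem_sigmaSubmodule_of_bound {f : Eucl d → ℂ} (hf : ContDiff ℝ ∞ f)
    (hb : ∀ h : ℝ, 0 < h → ∃ K : ℝ, ∀ (α β : Fin d → ℕ) (y : Eucl d),
      |monom α y| * ‖mderiv β f y‖ ≤ K * (h ^ (len α + len β) * mfact α ^ s * mfact β ^ σ)) :
    f ∈ sigmaSubmodule s σ d := by
  refine ⟨hf, fun h hh => ?_⟩
  obtain ⟨K, hK⟩ := hb h hh
  refine ⟨K, ?_⟩
  rintro _ ⟨⟨α, β, y⟩, rfl⟩
  unfold gsQuot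
  rw [div_le_iff₀ (gsDen_pos s σ hh α β), norm_mul, Complex.norm_real, Real.norm_eq_abs]
  exact hK α β y

theorem gsNorm_le_of_bound {f : Eucl d → ℂ} {h K : ℝ} (hh : 0 < h)
    (hb : ∀ (α β : Fin d → ℕ) (y : Eucl d),
      |monom α y| * ‖mderiv β f y‖ ≤ K * (h ^ (len α + len β) * mfact α ^ s * mfact β ^ σ)) :
    gsNorm s σ h f ≤ K := by
  refine ciSup_le ?_
  rintro ⟨α, β, y⟩
  unfold gsQuot
  rw [div_le_iff₀ (gsDen_pos s σ hh α β), norm_mul, Complex.norm_real, Real.norm_eq_abs]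
  exact hb α β y

theorem rpow_mfact_add_le {ρ : ℝ} (hρ : 0 ≤ ρ) (α β : Fin d → ℕ) :
    mfact (α + β) ^ ρ ≤ (2 ^ ρ) ^ (len α + len β) * (mfact α ^ ρ * mfact β ^ ρ) := by
  have h1 := mfact_pos α
  have h2 := mfact_pos β
  have := Real.rpow_le_rpow (mfact_pos _).le (mfact_add_le α β) hρ
  rwa [Real.mul_rpow (by positivity) (by positivity), Real.mul_rpow h1.le h2.le,
    ← Real.rpow_natCast, ← Real.rpow_mul (by norm_num), mul_comm (_ : ℝ) ρ,
    Real.rpow_mul (by norm_num), Real.rpow_natCast] at this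

theorem rpow_mfact_mul_le {ρ : ℝ} (hρ : 0 ≤ ρ) (α β : Fin d → ℕ) :
    mfact α ^ ρ * mfact β ^ ρ ≤ mfact (α + β) ^ ρ := by
  have h1 := mfact_pos α
  have h2 := mfact_pos β
  rw [← Real.mul_rpow h1.le h2.le]
  exact Real.rpow_le_rpow (by positivity) (mfact_mul_le α β) hρ

theorem rpow_mfact_pos (ρ : ℝ) (α : Fin d → ℕ) : 0 < mfact α ^ ρ :=
  Real.rpow_pos_of_pos (mfact_pos α) ρ

/-- The functions `x^α ∂^β f`, `f ∈ Σ_s^σ`, are bounded in `Σ_s^σ`, uniformly with respect to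
`α` and `β`. -/
theorem exists_monom_mderiv_monom_mderiv_le (hs : 0 ≤ s) (hσ : 0 ≤ σ) (hA : Admissible s σ d)
    {h₁ : ℝ} (hh₁ : 0 < h₁) :
    ∃ h : ℝ, 0 < h ∧ ∃ C : ℝ, 0 < C ∧ ∀ (f : SigmaSpace s σ d) (γ α δ β : Fin d → ℕ) (y : Eucl d),
      |monom γ y| * ‖mderiv δ (fun y => (monom α y : ℂ) * mderiv β f y) y‖ ≤
        C * gsNorm s σ h f * (h₁ ^ (len γ + len α + len δ + len β) *
          (mfact γ ^ s * mfact α ^ s) * (mfact δ ^ σ * mfact β ^ σ)) := by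
  -- The 2 pays for the 2^{|δ|} Leibniz terms and for α!/α'! ≤ 2^{|α|}κ!; the powers 2^s and 2^σ pay
  -- for splitting (γ+α')!^s and (δ'+β)!^σ.
  set c : ℝ := 2 * 2 ^ s * 2 ^ σ with hc
  have h2s : (1 : ℝ) ≤ 2 ^ s := Real.one_le_rpow (by norm_num) hs
  have h2σ : (1 : ℝ) ≤ 2 ^ σ := Real.one_le_rpow (by norm_num) hσ
  have hc0 : 0 < c := by positivity
  set h : ℝ := h₁ / c with hh
  have hh0 : 0 < h := div_pos hh₁ hc0
  -- Differentiating y^α by κ lowers both the monomial and the order of the remaining derivative, so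
  -- h^{2|κ|} is missing in the bound of f and κ! appears. Both are covered by the factorials κ!^s
  -- and κ!^σ that α!^s and δ!^σ have to spare.
  obtain ⟨C, hC, hCb⟩ := hA ((h ^ 2)⁻¹) (by positivity)
  refine ⟨h, hh0, C, hC, fun f γ α δ β y => ?_⟩
  set N := gsNorm s σ h f
  have hN : 0 ≤ N := gsNorm_nonneg hh0 _
  have hsm : ContDiff ℝ ∞ (mderiv β f) := by
    rw [mderiv_eq_multiDeriv]; exact multiDeriv_smooth _ _ f.smooth
  set tot := len γ + len α + len δ + len β with htot
  set M : ℝ := C * N * (2 ^ len α * (2 ^ s * 2 ^ σ) ^ tot * h ^ tot *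
          (mfact γ ^ s * mfact α ^ s) * (mfact δ ^ σ * mfact β ^ σ)) with hM
  have pγ := rpow_mfact_pos s γ
  have pα := rpow_mfact_pos s α
  have pδ := rpow_mfact_pos σ δ
  have pβ := rpow_mfact_pos σ β
  have main : |monom γ y| * ‖mderiv δ (fun y => (monom α y : ℂ) * mderiv β f y) y‖ ≤
      2 ^ len δ * M := by
    rcases eq_or_lt_of_le (abs_nonneg (monom γ y)) with h0 | h0
    · rw [← h0, zero_mul]; positivity
    rw [← le_div_iff₀' h0, mul_div_assoc]
    refine norm_mderiv_monom_mul_le δ y α _ _ hsm fun κ α' δ' hα hδ => ?_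
    rw [le_div_iff₀' h0]
    have e1 : mderiv δ' (mderiv β f) = mderiv (δ' + β) f := by
      simp only [mderiv_eq_multiDeriv]
      rw [multiDeriv_add_index _ _ _ f.smooth]
    have b1 := monom_mderiv_le f hh0 (γ + α') (δ' + β) y
    rw [monom_add, abs_mul] at b1
    rw [e1]
    have pα' := mfact_pos α'
    have pκ := mfact_pos κ
    have r1 : mfact α / mfact α' ≤ 2 ^ len α * mfact κ := by
      rw [div_le_iff₀ pα', ← hα, len_add]
      calc _ ≤ _ := mfact_add_le α' κ
        _ = _ := by ring
    have r2 := rpow_mfact_add_le hs γ α'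
    have r3 := rpow_mfact_add_le hσ δ' β
    have q1 := rpow_mfact_pos s α'
    have q2 := rpow_mfact_pos σ δ'
    have q3 := rpow_mfact_pos s κ
    have q4 := rpow_mfact_pos σ κ
    have r4 : mfact α' ^ s * mfact κ ^ s ≤ mfact α ^ s := hα ▸ rpow_mfact_mul_le hs α' κ
    have r5 : mfact δ' ^ σ * mfact κ ^ σ ≤ mfact δ ^ σ := hδ ▸ rpow_mfact_mul_le hσ δ' κ
    have r6 := hCb κ
    rw [Real.rpow_add pκ] at r6
    have lα : len α = len α' + len κ := by rw [← hα, len_add]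
    have lδ : len δ = len δ' + len κ := by rw [← hδ, len_add]
    have hpow : h ^ (len (γ + α') + len (δ' + β)) = h ^ tot * (h ^ 2)⁻¹ ^ len κ := by
      rw [inv_pow, ← pow_mul, ← div_eq_mul_inv, eq_div_iff (by positivity), ← pow_add]
      congr 1
      simp only [len_add, htot, lα, lδ]
      ring
    have g1 : (2 ^ s : ℝ) ^ (len γ + len α') ≤ (2 ^ s) ^ tot :=
      pow_le_pow_right₀ h2s (by omega)
    have g2 : (2 ^ σ : ℝ) ^ (len δ' + len β) ≤ (2 ^ σ) ^ tot :=
      pow_le_pow_right₀ h2σ (by omega)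
    calc |monom γ y| * (mfact α / mfact α' * |monom α' y| * ‖mderiv (δ' + β) f y‖)
        = mfact α / mfact α' * (|monom γ y| * |monom α' y| * ‖mderiv (δ' + β) f y‖) := by ring
      _ ≤ (2 ^ len α * mfact κ) * (N * (h ^ (len (γ + α') + len (δ' + β)) *
            mfact (γ + α') ^ s * mfact (δ' + β) ^ σ)) := by gcongr
      _ ≤ (2 ^ len α * mfact κ) * (N * ((h ^ tot * (h ^ 2)⁻¹ ^ len κ) *
            ((2 ^ s) ^ tot * (mfact γ ^ s * mfact α' ^ s)) *
            ((2 ^ σ) ^ tot * (mfact δ' ^ σ * mfact β ^ σ)))) := by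
          rw [hpow]
          have := (rpow_mfact_pos σ (δ' + β)).le
          gcongr
          · exact r2.trans (by gcongr)
          · exact r3.trans (by gcongr)
      _ = (2 ^ len α * N * h ^ tot * (2 ^ s) ^ tot * (2 ^ σ) ^ tot * (mfact γ ^ s * mfact β ^ σ)) *
            (((h ^ 2)⁻¹ ^ len κ * mfact κ) * (mfact α' ^ s * mfact δ' ^ σ)) := by ring
      _ ≤ (2 ^ len α * N * h ^ tot * (2 ^ s) ^ tot * (2 ^ σ) ^ tot * (mfact γ ^ s * mfact β ^ σ)) *
            ((C * (mfact κ ^ s * mfact κ ^ σ)) * (mfact α' ^ s * mfact δ' ^ σ)) := by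
          have := rpow_mfact_pos s γ
          gcongr
      _ = (2 ^ len α * N * h ^ tot * (2 ^ s) ^ tot * (2 ^ σ) ^ tot * (mfact γ ^ s * mfact β ^ σ)) * C
            * ((mfact α' ^ s * mfact κ ^ s) * (mfact δ' ^ σ * mfact κ ^ σ)) := by ring
      _ ≤ (2 ^ len α * N * h ^ tot * (2 ^ s) ^ tot * (2 ^ σ) ^ tot * (mfact γ ^ s * mfact β ^ σ)) * C
            * (mfact α ^ s * mfact δ ^ σ) := by gcongr
      _ = M := by rw [hM, mul_pow]; ring
  refine main.trans ?_
  have e2 : h₁ = 2 * (2 ^ s * 2 ^ σ) * h := by rw [hh, hc]; field_simp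
  have l2 : (2 : ℝ) ^ (len δ + len α) ≤ 2 ^ tot := pow_le_pow_right₀ (by norm_num) (by omega)
  calc 2 ^ len δ * M = (2 : ℝ) ^ (len δ + len α) * (C * N * ((2 ^ s * 2 ^ σ) ^ tot * h ^ tot *
          (mfact γ ^ s * mfact α ^ s) * (mfact δ ^ σ * mfact β ^ σ))) := by
        rw [hM, pow_add]; ring
    _ ≤ 2 ^ tot * (C * N * ((2 ^ s * 2 ^ σ) ^ tot * h ^ tot *
          (mfact γ ^ s * mfact α ^ s) * (mfact δ ^ σ * mfact β ^ σ))) := by gcongr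
    _ = _ := by rw [e2, mul_pow (2 * _), mul_pow 2]; ring

/-- The exponentially weighted form of `exists_monom_mderiv_monom_mderiv_le`. -/
theorem exists_mderiv_monom_mderiv_exp_le (hs : 0 < s) (hσ : 0 < σ) (hA : Admissible s σ d)
    {R h₁ : ℝ} (hR : 0 < R) (hh₁ : 0 < h₁) :
    ∃ h : ℝ, 0 < h ∧ ∃ C : ℝ, 0 < C ∧ ∀ (f : SigmaSpace s σ d) (α δ β : Fin d → ℕ) (y : Eucl d),
      ‖mderiv δ (fun y => (monom α y : ℂ) * mderiv β f y) y‖ * Real.exp (R * ‖y‖ ^ (1 / s)) ≤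
        C * gsNorm s σ h f * (h₁ ^ (len α + len δ + len β) *
          mfact α ^ s * (mfact δ ^ σ * mfact β ^ σ)) := by
  obtain ⟨k, hk, -, hdec⟩ := exists_norm_exp_decay d hs hR
  -- Of the powers of the minimum, those belonging to γ are estimated by k and feed the moment
  -- criterion; the others are estimated by h₁.
  obtain ⟨h, hh, C, hC, hb⟩ := exists_monom_mderiv_monom_mderiv_le hs.le hσ.le hA
    (lt_min hh₁ hk)
  refine ⟨h, hh, 2 ^ s * C, by positivity, fun f α δ β y => ?_⟩
  have hN := gsNorm_nonneg (s := s) (σ := σ) hh (f : Eucl d → ℂ)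
  have p1 := rpow_mfact_pos s α
  have p2 := rpow_mfact_pos σ δ
  have p3 := rpow_mfact_pos σ β
  have hm0 : 0 < min h₁ k := lt_min hh₁ hk
  have key : ∀ γ : Fin d → ℕ, |monom γ y| *
      ‖mderiv δ (fun y => (monom α y : ℂ) * mderiv β f y) y‖ ≤
      C * gsNorm s σ h f * (h₁ ^ (len α + len δ + len β) *
          mfact α ^ s * (mfact δ ^ σ * mfact β ^ σ)) * k ^ len γ * mfact γ ^ s := by
    intro γ
    have p4 := rpow_mfact_pos s γ
    refine (hb f γ α δ β y).trans ?_
    rw [add_assoc (len γ), add_assoc (len γ), pow_add]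
    calc _ ≤ C * gsNorm s σ h f * (k ^ len γ * h₁ ^ (len α + len δ + len β) *
          (mfact γ ^ s * mfact α ^ s) * (mfact δ ^ σ * mfact β ^ σ)) := by
          gcongr
          · exact min_le_right _ _
          · exact min_le_left _ _
      _ = _ := by ring
  have := hdec y _ (C * gsNorm s σ h f * (h₁ ^ (len α + len δ + len β) *
          mfact α ^ s * (mfact δ ^ σ * mfact β ^ σ))) (norm_nonneg _) (by simpa using key 0)
    (fun j m => by simpa [abs_pow] using key (Pi.single j m))
  linarith

theorem monom_mul_mderiv_mem (hs : 0 < s) (hσ : 0 < σ) (hA : Admissible s σ d)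
    (f : SigmaSpace s σ d) (α β : Fin d → ℕ) :
    (fun y => (monom α y : ℂ) * mderiv β f y) ∈ sigmaSubmodule s σ d := by
  refine mem_sigmaSubmodule_of_bound ((monom_smooth α).mul (multiDeriv_smooth _ _ f.smooth))
    fun h₁ hh₁ => ?_
  obtain ⟨h, hh, C, hC, hb⟩ := exists_monom_mderiv_monom_mderiv_le hs.le hσ.le hA hh₁
  refine ⟨C * gsNorm s σ h f * (h₁ ^ (len α + len β) * mfact α ^ s * mfact β ^ σ),
    fun γ δ y => (hb f γ α δ β y).trans (le_of_eq ?_)⟩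
  ring

end SigmaEstimates

/-! ### Symbols -/

section Symbols

variable {s σ r : ℝ} {d : ℕ}

/-- The standard basis of the first factor of phase space. -/
abbrev posVec (i : Fin d) : Eucl d × Eucl d := (stdVec i, 0)

/-- The standard basis of the second factor of phase space. -/
abbrev freqVec (i : Fin d) : Eucl d × Eucl d := (0, stdVec i)

theorem mderiv_slice_fst {b : Eucl d × Eucl d → ℂ} (hb : ContDiff ℝ ∞ b) (α : Fin d → ℕ)
    (x ξ : Eucl d) : mderiv α (fun x' => b (x', ξ)) x = multiDeriv posVec α b (x, ξ) := by
  have := multiDeriv_comp_affine stdVec α hb (ContinuousLinearMap.inl ℝ (Eucl d) (Eucl d)) (0, ξ)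
  simpa [mderiv_eq_multiDeriv] using congrFun this x

theorem mderiv_slice_snd {b : Eucl d × Eucl d → ℂ} (hb : ContDiff ℝ ∞ b) (α : Fin d → ℕ)
    (x ξ : Eucl d) : mderiv α (fun ξ' => b (x, ξ')) ξ = multiDeriv freqVec α b (x, ξ) := by
  have := multiDeriv_comp_affine stdVec α hb (ContinuousLinearMap.inr ℝ (Eucl d) (Eucl d)) (x, 0)
  simpa [mderiv_eq_multiDeriv] using congrFun this ξ

/-- The derivative `∂_x^α ∂_ξ^β b`. -/
def symDeriv (α β : Fin d → ℕ) (b : Eucl d × Eucl d → ℂ) : Eucl d × Eucl d → ℂ :=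
  multiDeriv posVec α (multiDeriv freqVec β b)

/-- The symbols of `Γ_{s,σ}^{σ,s;0}` with growth governed by `r`. -/
def IsSymbol (s σ r : ℝ) (b : Eucl d × Eucl d → ℂ) : Prop :=
  ContDiff ℝ ∞ b ∧ ∀ h : ℝ, 0 < h → ∃ C : ℝ, 0 < C ∧ ∀ (α β : Fin d → ℕ) (p : Eucl d × Eucl d),
    ‖symDeriv α β b p‖ ≤ C * (h ^ (len α + len β) * mfact α ^ σ * mfact β ^ s *
      Real.exp (r * (‖p.1‖ ^ (1 / s) + ‖p.2‖ ^ (1 / σ))))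

theorem symDeriv_smooth (α β : Fin d → ℕ) {b : Eucl d × Eucl d → ℂ} (hb : ContDiff ℝ ∞ b) :
    ContDiff ℝ ∞ (symDeriv α β b) :=
  multiDeriv_smooth _ _ (multiDeriv_smooth _ _ hb)

@[simp] theorem symDeriv_zero (b : Eucl d × Eucl d → ℂ) : symDeriv 0 0 b = b := by
  simp [symDeriv]

theorem symDeriv_symDeriv (α β α' β' : Fin d → ℕ) {b : Eucl d × Eucl d → ℂ}
    (hb : ContDiff ℝ ∞ b) :
    symDeriv α β (symDeriv α' β' b) = symDeriv (α + α') (β + β') b := by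
  unfold symDeriv
  rw [multiDeriv_comm freqVec posVec _ _ (multiDeriv_smooth _ _ hb),
    ← multiDeriv_add_index _ _ _ hb, ← multiDeriv_add_index _ _ _ (multiDeriv_smooth _ _ hb)]

theorem dirDeriv_posVec (i : Fin d) {b : Eucl d × Eucl d → ℂ} (hb : ContDiff ℝ ∞ b) :
    dirDeriv (posVec i) b = symDeriv (Pi.single i 1) 0 b := by
  rw [symDeriv, multiDeriv_zero, multiDeriv_single _ _ hb]

theorem dirDeriv_freqVec (i : Fin d) {b : Eucl d × Eucl d → ℂ} (hb : ContDiff ℝ ∞ b) :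
    dirDeriv (freqVec i) b = symDeriv 0 (Pi.single i 1) b := by
  rw [symDeriv, multiDeriv_zero, multiDeriv_single _ _ hb]

theorem exists_isSymbol_of_mem_GammaZero {a : Eucl d × Eucl d → ℂ} (ha : a ∈ GammaZero s σ σ s d) :
    ∃ r : ℝ, 0 < r ∧ IsSymbol s σ r a := by
  obtain ⟨hsm, r, hr, h⟩ := ha
  refine ⟨r, hr, hsm, fun k hk => ?_⟩
  obtain ⟨C, hC⟩ := h k hk
  refine ⟨max C 1, lt_max_of_lt_right one_pos, fun α β p => ?_⟩
  have h1 := hC α β p.1 p.2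
  have e : (fun x' => mderiv β (fun ξ' => a (x', ξ')) p.2) =
      fun x' => multiDeriv freqVec β a (x', p.2) := by
    funext x'
    exact mderiv_slice_snd hsm β x' p.2
  rw [e, mderiv_slice_fst (multiDeriv_smooth _ _ hsm)] at h1
  refine h1.trans ?_
  have p1 := rpow_mfact_pos σ α
  have p2 := rpow_mfact_pos s β
  gcongr
  exact le_max_left _ _

theorem IsSymbol.exists_symDeriv_add_le (hs : 0 ≤ s) (hσ : 0 ≤ σ) {b : Eucl d × Eucl d → ℂ}
    (hb : IsSymbol s σ r b) {h₁ : ℝ} (hh₁ : 0 < h₁) :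
    ∃ C : ℝ, 0 < C ∧ ∀ (α β α' β' : Fin d → ℕ) (p : Eucl d × Eucl d),
      ‖symDeriv (α + α') (β + β') b p‖ ≤ C * (h₁ ^ (len α + len α' + len β + len β') *
        (mfact α ^ σ * mfact α' ^ σ) * (mfact β ^ s * mfact β' ^ s) *
        Real.exp (r * (‖p.1‖ ^ (1 / s) + ‖p.2‖ ^ (1 / σ)))) := by
  have h2s : (1 : ℝ) ≤ 2 ^ s := Real.one_le_rpow (by norm_num) hs
  have h2σ : (1 : ℝ) ≤ 2 ^ σ := Real.one_le_rpow (by norm_num) hσ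
  -- The denominator compensates for splitting (α+α')!^σ and (β+β')!^s.
  have hh0 : 0 < h₁ / (2 ^ s * 2 ^ σ) := by positivity
  obtain ⟨C, hC, h⟩ := hb.2 _ hh0
  refine ⟨C, hC, fun α β α' β' p => (h _ _ p).trans ?_⟩
  set tot := len α + len α' + len β + len β' with htot
  have p1 := rpow_mfact_pos σ α
  have p2 := rpow_mfact_pos σ α'
  have p3 := rpow_mfact_pos s β
  have p4 := rpow_mfact_pos s β'
  have g1 : (2 ^ s : ℝ) ^ (len β + len β') ≤ (2 ^ s) ^ tot := pow_le_pow_right₀ h2s (by omega)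
  have g2 : (2 ^ σ : ℝ) ^ (len α + len α') ≤ (2 ^ σ) ^ tot := pow_le_pow_right₀ h2σ (by omega)
  have e : len (α + α') + len (β + β') = tot := by simp only [len_add, htot]; ring
  rw [e]
  gcongr C * (?_ * _)
  calc (h₁ / (2 ^ s * 2 ^ σ)) ^ tot * mfact (α + α') ^ σ * mfact (β + β') ^ s
      ≤ (h₁ / (2 ^ s * 2 ^ σ)) ^ tot * ((2 ^ σ) ^ tot * (mfact α ^ σ * mfact α' ^ σ)) *
          ((2 ^ s) ^ tot * (mfact β ^ s * mfact β' ^ s)) := by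
        have := (rpow_mfact_pos s (β + β')).le
        gcongr
        · exact (rpow_mfact_add_le hσ α α').trans (by gcongr)
        · exact (rpow_mfact_add_le hs β β').trans (by gcongr)
    _ = (h₁ / (2 ^ s * 2 ^ σ) * (2 ^ σ * 2 ^ s)) ^ tot * (mfact α ^ σ * mfact α' ^ σ) *
          (mfact β ^ s * mfact β' ^ s) := by rw [mul_pow, mul_pow]; ring
    _ = _ := by rw [mul_comm (2 ^ σ : ℝ), div_mul_cancel₀ _ (by positivity)]

/-- The rate r survives differentiation, because the growth bound holds for all derivatives with the
same r. Inductions on the symbol can therefore keep r fixed. -/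
theorem IsSymbol.symDeriv (hs : 0 ≤ s) (hσ : 0 ≤ σ) {b : Eucl d × Eucl d → ℂ}
    (hb : IsSymbol s σ r b) (α' β' : Fin d → ℕ) : IsSymbol s σ r (symDeriv α' β' b) := by
  refine ⟨symDeriv_smooth _ _ hb.1, fun h hh => ?_⟩
  obtain ⟨C, hC, hC'⟩ := hb.exists_symDeriv_add_le hs hσ hh
  have p2 := rpow_mfact_pos σ α'
  have p4 := rpow_mfact_pos s β'
  refine ⟨C * (h ^ (len α' + len β') * mfact α' ^ σ * mfact β' ^ s), by positivity,
    fun α β p => ?_⟩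
  rw [symDeriv_symDeriv _ _ _ _ hb.1]
  refine (hC' α β α' β' p).trans (le_of_eq ?_)
  ring

/-- The reflection of a symbol in the frequency variable. -/
theorem IsSymbol.reflect {b : Eucl d × Eucl d → ℂ} (hb : IsSymbol s σ r b) :
    IsSymbol s σ r (fun p => b (p.1, -p.2)) := by
  set ℓ : Eucl d × Eucl d →L[ℝ] Eucl d × Eucl d :=
    (ContinuousLinearMap.fst ℝ _ _).prod (-ContinuousLinearMap.snd ℝ _ _) with hℓ
  have hfun : (fun p => b (p.1, -p.2)) = fun p => b (ℓ p + 0) := by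
    funext p; simp [hℓ]
  have hneg : ∀ (β : Fin d → ℕ) (f : Eucl d × Eucl d → ℂ), ContDiff ℝ ∞ f →
      multiDeriv (fun i => -freqVec i) β f = (-1 : ℂ) ^ len β • multiDeriv freqVec β f := by
    intro β f hf
    induction β using multiIndex_induction with
    | h0 => simp
    | hs β i ih =>
      rw [multiDeriv_add_single _ _ _ hf, ih, multiDeriv_add_single _ _ _ hf,
        dirDeriv_smul _ _ (multiDeriv_smooth _ _ hf), len_add, len_single, pow_succ, mul_smul]
      congr 1
      funext p
      change fderiv ℝ (multiDeriv freqVec β f) p (-freqVec i) = (-1 : ℂ) • _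
      rw [map_neg, neg_one_smul]
      rfl
  have hd : ∀ α β p, ‖GelfandShilov.symDeriv α β (fun p => b (p.1, -p.2)) p‖ =
      ‖GelfandShilov.symDeriv α β b (p.1, -p.2)‖ := by
    intro α β p
    rw [hfun]
    unfold GelfandShilov.symDeriv
    rw [multiDeriv_comp_affine _ _ hb.1 ℓ 0]
    have e2 : (fun i : Fin d => ℓ (freqVec i)) = fun i => -freqVec i := by
      funext i; simp [hℓ]
    rw [e2, hneg β b hb.1]
    have hsm : ContDiff ℝ ∞ ((-1 : ℂ) ^ len β • multiDeriv freqVec β b) :=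
      (multiDeriv_smooth freqVec β hb.1).const_smul ((-1 : ℂ) ^ len β)
    rw [multiDeriv_comp_affine _ _ hsm ℓ 0]
    have e1 : (fun i : Fin d => ℓ (posVec i)) = posVec := by
      funext i; simp [hℓ]
    rw [e1, multiDeriv_smul _ _ _ (multiDeriv_smooth _ _ hb.1)]
    simp [hℓ]
  refine ⟨hfun ▸ hb.1.comp (ℓ.contDiff.add contDiff_const), fun h hh => ?_⟩
  obtain ⟨C, hC, hC'⟩ := hb.2 h hh
  refine ⟨C, hC, fun α β p => ?_⟩
  rw [hd]
  simpa using hC' α β (p.1, -p.2)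

end Symbols

/-! ### Oscillatory integrals -/

section Oscillatory

variable {d : ℕ}

/-- The character `t ↦ exp(i⟨t, ξ⟩)`. -/
def expInner (ξ t : Eucl d) : ℂ := Complex.exp (Complex.I * (inner ℝ t ξ : ℝ))

theorem norm_expInner (ξ t : Eucl d) : ‖expInner ξ t‖ = 1 := by
  rw [expInner, mul_comm, Complex.norm_exp_ofReal_mul_I]

theorem contDiff_expInner {V : Type*} [NormedAddCommGroup V] [NormedSpace ℝ V]
    {f g : V → Eucl d} (hf : ContDiff ℝ ∞ f) (hg : ContDiff ℝ ∞ g) :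
    ContDiff ℝ ∞ (fun x => expInner (f x) (g x)) := by
  unfold expInner
  have h : ContDiff ℝ ∞ (fun x => (inner ℝ (g x) (f x) : ℝ)) := hg.inner ℝ hf
  exact (contDiff_const.mul (Complex.ofRealCLM.contDiff.comp h)).cexp

theorem expInner_smooth (ξ : Eucl d) : ContDiff ℝ ∞ (expInner ξ) :=
  contDiff_expInner contDiff_const contDiff_id

theorem dirDeriv_expInner (ξ v : Eucl d) :
    dirDeriv v (expInner ξ) = fun t => (Complex.I * (inner ℝ v ξ : ℝ)) * expInner ξ t := by
  funext t
  have h1 : HasFDerivAt (fun t : Eucl d => (inner ℝ ξ t : ℝ)) (innerSL ℝ ξ) t :=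
    (innerSL ℝ ξ).hasFDerivAt
  have h2 : HasFDerivAt (fun t : Eucl d => ((inner ℝ ξ t : ℝ) : ℂ))
      (Complex.ofRealCLM.comp (innerSL ℝ ξ)) t := Complex.ofRealCLM.hasFDerivAt.comp t h1
  have h3 := (h2.const_mul Complex.I).cexp
  unfold dirDeriv expInner
  simp_rw [real_inner_comm ξ]
  rw [h3.fderiv]
  simp
  ring

/-- The integral `∫ u(p + At) v(q + Bt) exp(i⟨t, ξ⟩) dt`. -/
def oscInt (u v : Eucl d → ℂ) (A B : Eucl d →L[ℝ] Eucl d) (p q ξ : Eucl d) : ℂ :=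
  ∫ t, u (A t + p) * v (B t + q) * expInner ξ t

theorem dirDeriv_eq_sum {f : Eucl d → ℂ} (v : Eucl d) :
    dirDeriv v f = fun x => ∑ k, (v k : ℂ) * dirDeriv (stdVec k) f x := by
  funext x
  unfold dirDeriv
  have hv : v = ∑ k, v k • stdVec k := by
    have := (EuclideanSpace.basisFun (Fin d) ℝ).sum_repr v
    simpa using this.symm
  conv_lhs => rw [hv]
  simp [map_sum]

theorem dirDeriv_comp_affine {V V' : Type*} [NormedAddCommGroup V] [NormedSpace ℝ V]
    [NormedAddCommGroup V'] [NormedSpace ℝ V'] {f : V' → ℂ} (hf : ContDiff ℝ ∞ f)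
    (ℓ : V →L[ℝ] V') (c : V') (v : V) (x : V) :
    dirDeriv v (fun x => f (ℓ x + c)) x = dirDeriv (ℓ v) f (ℓ x + c) := by
  have h2 : HasFDerivAt (fun x => ℓ x + c) ℓ x := ℓ.hasFDerivAt.add_const c
  have := ((hf.differentiable (by simp) (ℓ x + c)).hasFDerivAt).comp x h2
  unfold dirDeriv
  rw [HasFDerivAt.fderiv (f := fun x => f (ℓ x + c)) this]
  rfl

/-- The sum of the absolute values of the entries of a linear map. -/
def entrySum (A : Eucl d →L[ℝ] Eucl d) : ℝ := ∑ j, ∑ k, |A (stdVec j) k|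

theorem sum_abs_le_entrySum (A : Eucl d →L[ℝ] Eucl d) (j : Fin d) :
    ∑ k, |A (stdVec j) k| ≤ entrySum A :=
  Finset.single_le_sum (f := fun j => ∑ k, |A (stdVec j) k|)
    (fun _ _ => Finset.sum_nonneg fun _ _ => abs_nonneg _) (Finset.mem_univ j)

theorem integrable_mul_expInner {F : Eucl d → ℂ} (hF : Integrable F) (ξ : Eucl d) :
    Integrable (fun t => F t * expInner ξ t) :=
  hF.mul_bdd (c := 1) (expInner_smooth ξ).continuous.aestronglyMeasurable
    (Filter.Eventually.of_forall fun t => (norm_expInner ξ t).le)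

theorem integral_dirDeriv_mul_expInner {F : Eucl d → ℂ} (hF : ContDiff ℝ ∞ F) (hi : Integrable F)
    (v ξ : Eucl d) (hi' : Integrable (dirDeriv v F)) :
    ∫ t, dirDeriv v F t * expInner ξ t =
      -((Complex.I * (inner ℝ v ξ : ℝ)) * ∫ t, F t * expInner ξ t) := by
  have e : ∀ t, F t * fderiv ℝ (expInner ξ) t v =
      (Complex.I * (inner ℝ v ξ : ℝ)) * (F t * expInner ξ t) := fun t => by
    have := congrFun (dirDeriv_expInner ξ v) t
    unfold dirDeriv at this
    rw [this]; ring
  have := integral_mul_fderiv_eq_neg_fderiv_mul_of_integrable (μ := volume) (f := F)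
    (g := expInner ξ) (v := v) (integrable_mul_expInner hi' ξ) (by
      simp_rw [e]
      exact (integrable_mul_expInner hi ξ).const_mul _)
    (integrable_mul_expInner hi ξ) (fun x _ => hF.differentiable (by simp) x)
    (fun x _ => (expInner_smooth ξ).differentiable (by simp) x)
  simp_rw [e] at this
  rw [integral_const_mul] at this
  rw [this, neg_neg]
  rfl

/-- One integration by parts in t. Two affine arguments are allowed because the result is used both
for the inner integral of the operator, with maps L and I, and for the Wigner-type transform, with
maps L and L-I. -/
theorem oscInt_step {u v : Eucl d → ℂ} (hu : ContDiff ℝ ∞ u) (hv : ContDiff ℝ ∞ v)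
    (A B : Eucl d →L[ℝ] Eucl d) (p q ξ : Eucl d)
    (hint : ∀ α β : Fin d → ℕ, Integrable (fun t => mderiv α u (A t + p) * mderiv β v (B t + q)))
    (j : Fin d) :
    Complex.I * (ξ j : ℝ) * oscInt u v A B p q ξ =
      -((∑ k, (A (stdVec j) k : ℂ) * oscInt (dirDeriv (stdVec k) u) v A B p q ξ) +
        ∑ k, (B (stdVec j) k : ℂ) * oscInt u (dirDeriv (stdVec k) v) A B p q ξ) := by
  have hsu : ContDiff ℝ ∞ (fun t => u (A t + p)) := hu.comp (A.contDiff.add contDiff_const)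
  have hsv : ContDiff ℝ ∞ (fun t => v (B t + q)) := hv.comp (B.contDiff.add contDiff_const)
  have i1 : ∀ k, Integrable (fun t => dirDeriv (stdVec k) u (A t + p) * v (B t + q)) := fun k => by
    simpa [mderiv_eq_multiDeriv, multiDeriv_single _ _ hu] using hint (Pi.single k 1) 0
  have i2 : ∀ k, Integrable (fun t => u (A t + p) * dirDeriv (stdVec k) v (B t + q)) := fun k => by
    simpa [mderiv_eq_multiDeriv, multiDeriv_single _ _ hv] using hint 0 (Pi.single k 1)
  have i0 : Integrable (fun t => u (A t + p) * v (B t + q)) := by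
    simpa [mderiv_eq_multiDeriv] using hint 0 0
  have e : dirDeriv (stdVec j) (fun t => u (A t + p) * v (B t + q)) = fun t =>
      (∑ k, (A (stdVec j) k : ℂ) * (dirDeriv (stdVec k) u (A t + p) * v (B t + q))) +
        ∑ k, (B (stdVec j) k : ℂ) * (u (A t + p) * dirDeriv (stdVec k) v (B t + q)) := by
    rw [dirDeriv_mul _ hsu hsv]
    funext t
    rw [dirDeriv_comp_affine hu, dirDeriv_comp_affine hv, dirDeriv_eq_sum (A _),
      dirDeriv_eq_sum (B _)]
    simp only [Finset.sum_mul, Finset.mul_sum]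
    congr 1
    · exact Finset.sum_congr rfl fun k _ => by ring
    · exact Finset.sum_congr rfl fun k _ => by ring
  have hinner : (inner ℝ (stdVec j) ξ : ℝ) = ξ j := by
    simp [stdVec, EuclideanSpace.inner_single_left]
  have hI : Integrable (dirDeriv (stdVec j) (fun t => u (A t + p) * v (B t + q))) := by
    rw [e]
    exact (integrable_finsetSum _ fun k _ => (i1 k).const_mul _).add
      (integrable_finsetSum _ fun k _ => (i2 k).const_mul _)
  have := integral_dirDeriv_mul_expInner (hsu.mul hsv) i0 (stdVec j) ξ hI
  rw [hinner] at this
  change _ = -(Complex.I * (ξ j : ℝ) * oscInt u v A B p q ξ) at this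
  rw [eq_comm, neg_eq_iff_eq_neg] at this
  rw [this, e]
  congr 1
  unfold oscInt
  simp only [add_mul, Finset.sum_mul, mul_assoc]
  have j1 : ∀ k, Integrable (fun t => (A (stdVec j) k : ℂ) *
      (dirDeriv (stdVec k) u (A t + p) * (v (B t + q) * expInner ξ t))) := fun k => by
    simpa only [mul_assoc] using (integrable_mul_expInner (i1 k) ξ).const_mul _
  have j2 : ∀ k, Integrable (fun t => (B (stdVec j) k : ℂ) *
      (u (A t + p) * (dirDeriv (stdVec k) v (B t + q) * expInner ξ t))) := fun k => by
    simpa only [mul_assoc] using (integrable_mul_expInner (i2 k) ξ).const_mul _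
  rw [integral_add (integrable_finsetSum _ fun k _ => j1 k)
    (integrable_finsetSum _ fun k _ => j2 k), integral_finsetSum _ fun k _ => j1 k,
    integral_finsetSum _ fun k _ => j2 k]
  simp only [integral_const_mul]

/-- Each integration by parts distributes a derivative over the two factors with coefficients from
one column of A and of B, whose absolute sum is at most `entrySum A + entrySum B`. A common bound K
for all terms of order n replaces the expansion. -/
theorem pow_mul_norm_oscInt_le (A B : Eucl d →L[ℝ] Eucl d) (p q ξ : Eucl d) (j : Fin d) (n : ℕ) :
    ∀ (u v : Eucl d → ℂ) (K : ℝ), ContDiff ℝ ∞ u → ContDiff ℝ ∞ v →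
    (∀ α β : Fin d → ℕ, Integrable (fun t => mderiv α u (A t + p) * mderiv β v (B t + q))) →
    (∀ α β : Fin d → ℕ, len α + len β = n →
      ‖oscInt (mderiv α u) (mderiv β v) A B p q ξ‖ ≤ K) →
    |ξ j| ^ n * ‖oscInt u v A B p q ξ‖ ≤ (entrySum A + entrySum B) ^ n * K := by
  induction n with
  | zero =>
    intro u v K hu hv hint h
    simpa [mderiv_eq_multiDeriv] using h 0 0 (by simp)
  | succ n ih =>
    intro u v K hu hv hint h
    have step := congrArg norm (oscInt_step hu hv A B p q ξ hint j)
    rw [norm_mul, norm_mul, Complex.norm_I, one_mul, Complex.norm_real, Real.norm_eq_abs,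
      norm_neg] at step
    have h1 : ∀ k, |ξ j| ^ n * ‖oscInt (dirDeriv (stdVec k) u) v A B p q ξ‖ ≤
        (entrySum A + entrySum B) ^ n * K := fun k => by
      refine ih _ _ K (dirDeriv_smooth _ hu) hv (fun α β => ?_) fun α β hαβ => ?_
      · have := hint (α + Pi.single k 1) β
        simpa only [mderiv_eq_multiDeriv, multiDeriv_add_single' _ _ _ hu] using this
      · have := h (α + Pi.single k 1) β (by simp; omega)
        simpa only [mderiv_eq_multiDeriv, multiDeriv_add_single' _ _ _ hu] using this
    have h2 : ∀ k, |ξ j| ^ n * ‖oscInt u (dirDeriv (stdVec k) v) A B p q ξ‖ ≤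
        (entrySum A + entrySum B) ^ n * K := fun k => by
      refine ih _ _ K hu (dirDeriv_smooth _ hv) (fun α β => ?_) fun α β hαβ => ?_
      · have := hint α (β + Pi.single k 1)
        simpa only [mderiv_eq_multiDeriv, multiDeriv_add_single' _ _ _ hv] using this
      · have := h α (β + Pi.single k 1) (by simp; omega)
        simpa only [mderiv_eq_multiDeriv, multiDeriv_add_single' _ _ _ hv] using this
    set M := (entrySum A + entrySum B) ^ n * K with hM
    have hM0 : 0 ≤ M := by
      have : 0 ≤ |ξ j| ^ n * ‖oscInt (dirDeriv (stdVec j) u) v A B p q ξ‖ := by positivity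
      exact this.trans (h1 j)
    rw [pow_succ, mul_assoc, step]
    calc |ξ j| ^ n * _ ≤ |ξ j| ^ n *
          ((∑ k, |A (stdVec j) k| * ‖oscInt (dirDeriv (stdVec k) u) v A B p q ξ‖) +
          ∑ k, |B (stdVec j) k| * ‖oscInt u (dirDeriv (stdVec k) v) A B p q ξ‖) := by
          refine mul_le_mul_of_nonneg_left ((norm_add_le _ _).trans (add_le_add ?_ ?_))
            (by positivity)
          all_goals
            refine (norm_sum_le _ _).trans (Finset.sum_le_sum fun k _ => ?_)
            rw [norm_mul, Complex.norm_real, Real.norm_eq_abs]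
      _ = (∑ k, |A (stdVec j) k| * (|ξ j| ^ n * ‖oscInt (dirDeriv (stdVec k) u) v A B p q ξ‖)) +
          ∑ k, |B (stdVec j) k| * (|ξ j| ^ n * ‖oscInt u (dirDeriv (stdVec k) v) A B p q ξ‖) := by
          rw [mul_add, Finset.mul_sum, Finset.mul_sum]
          congr 1 <;> exact Finset.sum_congr rfl fun k _ => by ring
      _ ≤ (∑ k, |A (stdVec j) k| * M) + ∑ k, |B (stdVec j) k| * M := by
          gcongr with k _ k _
          · exact h1 k
          · exact h2 k
      _ ≤ (entrySum A + entrySum B) * M := by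
          rw [← Finset.sum_mul, ← Finset.sum_mul, ← add_mul]
          have := sum_abs_le_entrySum A j
          have := sum_abs_le_entrySum B j
          gcongr
      _ = _ := by rw [hM]; ring

/-- Gevrey estimates of the amplitude imply exponential decay of the oscillatory integral. -/
theorem exists_oscInt_decay (A B : Eucl d →L[ℝ] Eucl d) {σ R : ℝ} (hσ : 0 < σ) (hR : 0 < R) :
    ∃ k : ℝ, 0 < k ∧ ∀ (u v : Eucl d → ℂ) (p q ξ : Eucl d) (K : ℝ), 0 ≤ K →
      ContDiff ℝ ∞ u → ContDiff ℝ ∞ v →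
      (∀ α β : Fin d → ℕ, Integrable (fun t => mderiv α u (A t + p) * mderiv β v (B t + q))) →
      (∀ α β : Fin d → ℕ, ‖oscInt (mderiv α u) (mderiv β v) A B p q ξ‖ ≤
        K * k ^ (len α + len β) * (mfact α ^ σ * mfact β ^ σ)) →
      ‖oscInt u v A B p q ξ‖ * Real.exp (R * ‖ξ‖ ^ (1 / σ)) ≤ 2 ^ σ * K := by
  obtain ⟨k, hk, -, hdec⟩ := exists_norm_exp_decay d hσ hR
  set c := entrySum A + entrySum B
  have hc : 0 ≤ c := add_nonneg
    (Finset.sum_nonneg fun _ _ => Finset.sum_nonneg fun _ _ => abs_nonneg _)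
    (Finset.sum_nonneg fun _ _ => Finset.sum_nonneg fun _ _ => abs_nonneg _)
  -- Each integration by parts costs a factor c, which this choice compensates; the added 1 covers c
  -- = 0.
  refine ⟨k / (c + 1), by positivity, fun u v p q ξ K hK hu hv hint h => ?_⟩
  refine hdec ξ _ K (norm_nonneg _) ?_ fun j n => ?_
  · simpa [mderiv_eq_multiDeriv] using h 0 0
  · refine (pow_mul_norm_oscInt_le A B p q ξ j n u v
      (K * (k / (c + 1)) ^ n * (n ! : ℝ) ^ σ) hu hv hint fun α β hn => ?_).trans ?_
    · refine (h α β).trans ?_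
      rw [hn]
      -- With n = |α| + |β|, one has α!β! ≤ (α+β)! ≤ n!, as the one-dimensional moment bound
      -- requires.
      refine mul_le_mul_of_nonneg_left ((rpow_mfact_mul_le hσ.le α β).trans ?_) (by positivity)
      refine Real.rpow_le_rpow (mfact_pos _).le ?_ hσ.le
      rw [← hn, ← len_add]
      exact mfact_le_factorial_len _
    · have : (c * (k / (c + 1))) ^ n ≤ k ^ n := by
        refine pow_le_pow_left₀ (by positivity) ?_ n
        rw [mul_div_assoc', div_le_iff₀ (by positivity)]
        nlinarith
      calc c ^ n * (K * (k / (c + 1)) ^ n * (n ! : ℝ) ^ σ)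
          = K * (c * (k / (c + 1))) ^ n * (n ! : ℝ) ^ σ := by rw [mul_pow]; ring
        _ ≤ K * k ^ n * (n ! : ℝ) ^ σ := by gcongr

end Oscillatory

/-! ### Integrable exponential weights -/

section Weights

variable {d : ℕ} {s : ℝ}

theorem integrable_exp_neg_norm_rpow (d : ℕ) (hs : 0 < s) :
    Integrable (fun y : Eucl d => Real.exp (-‖y‖ ^ (1 / s))) := by
  have hs' : 0 < 1 / s := by positivity
  -- In the variable τ = ‖y‖^{1/s}, the power τ^{-s(d+1)} is ‖y‖^{-(d+1)}, which is integrable at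
  -- infinity in dimension d.
  have ho := isLittleO_exp_neg_mul_rpow_atTop one_pos (-(s * (d + 1)))
  obtain ⟨M, hM⟩ := Filter.eventually_atTop.1 (ho.bound one_pos)
  set M' := max M 1
  have hM' : 1 ≤ M' := le_max_right _ _
  have key : ∀ y : Eucl d, Real.exp (-‖y‖ ^ (1 / s)) ≤
      (1 + M' ^ s) ^ (d + 1 : ℝ) * 2 ^ (d + 1 : ℝ) * (1 + ‖y‖) ^ (-(d + 1 : ℝ)) := by
    intro y
    have hy := norm_nonneg y
    have hMs : 1 ≤ M' ^ s := Real.one_le_rpow hM' hs.le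
    have h1 : (1 : ℝ) ≤ (1 + M' ^ s) ^ (d + 1 : ℝ) := Real.one_le_rpow (by linarith) (by positivity)
    have h2 : (1 : ℝ) ≤ 2 ^ (d + 1 : ℝ) := Real.one_le_rpow (by norm_num) (by positivity)
    rw [Real.rpow_neg (by positivity), ← div_eq_mul_inv, le_div_iff₀ (by positivity)]
    by_cases hc : M' ≤ ‖y‖ ^ (1 / s)
    · have hy1 : 1 ≤ ‖y‖ := by
        by_contra hlt
        have := Real.rpow_lt_one hy (not_le.1 hlt) hs'
        linarith
      have h3 := hM (‖y‖ ^ (1 / s)) ((le_max_left _ _).trans hc)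
      rw [one_mul, Real.norm_of_nonneg (Real.exp_pos _).le, Real.norm_of_nonneg (by positivity),
        ← Real.rpow_mul hy] at h3
      have e : 1 / s * -(s * (d + 1 : ℝ)) = -(d + 1 : ℝ) := by field_simp
      rw [e, Real.rpow_neg hy, ← one_div, le_div_iff₀ (by positivity), neg_one_mul] at h3
      calc Real.exp (-‖y‖ ^ (1 / s)) * (1 + ‖y‖) ^ (d + 1 : ℝ)
          ≤ Real.exp (-‖y‖ ^ (1 / s)) * (2 * ‖y‖) ^ (d + 1 : ℝ) := by
            gcongr; linarith
        _ = 2 ^ (d + 1 : ℝ) * (Real.exp (-‖y‖ ^ (1 / s)) * ‖y‖ ^ (d + 1 : ℝ)) := by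
            rw [Real.mul_rpow (by norm_num) hy]; ring
        _ ≤ 2 ^ (d + 1 : ℝ) * 1 := by gcongr
        _ ≤ _ := by nlinarith
    · have hle : ‖y‖ ≤ M' ^ s := by
        have := Real.rpow_le_rpow (by positivity) (not_le.1 hc).le hs.le
        rwa [← Real.rpow_mul hy, one_div_mul_cancel hs.ne', Real.rpow_one] at this
      have h4 : Real.exp (-‖y‖ ^ (1 / s)) ≤ 1 := by
        rw [Real.exp_le_one_iff]
        have := Real.rpow_nonneg hy (1 / s)
        linarith
      calc Real.exp (-‖y‖ ^ (1 / s)) * (1 + ‖y‖) ^ (d + 1 : ℝ)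
          ≤ 1 * (1 + M' ^ s) ^ (d + 1 : ℝ) := by gcongr
        _ ≤ _ := by nlinarith
  have hint : Integrable (fun y : Eucl d => (1 + ‖y‖) ^ (-(d + 1 : ℝ))) :=
    integrable_one_add_norm (by simp)
  refine (hint.const_mul ((1 + M' ^ s) ^ (d + 1 : ℝ) * 2 ^ (d + 1 : ℝ))).mono' ?_ (Filter.Eventually.of_forall fun y => ?_)
  · refine Continuous.aestronglyMeasurable (Real.continuous_exp.comp (Continuous.neg ?_))
    exact continuous_norm.rpow_const fun _ => Or.inr hs'.le
  · rw [Real.norm_of_nonneg (Real.exp_pos _).le]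
    exact key y

/-- Replacing ‖x‖ + ‖y‖ by twice the maximum treats concave and convex powers alike. -/
theorem rpow_norm_le_of_le {M : ℝ} (hM : 0 ≤ M) {ρ : ℝ} (hρ : 0 ≤ ρ) {x y z : Eucl d}
    (h : ‖z‖ ≤ M * (‖x‖ + ‖y‖)) : ‖z‖ ^ ρ ≤ (2 * M) ^ ρ * (‖x‖ ^ ρ + ‖y‖ ^ ρ) := by
  have hx := norm_nonneg x
  have hy := norm_nonneg y
  have hmax : ‖z‖ ≤ 2 * M * max ‖x‖ ‖y‖ := by
    have h1 := le_max_left ‖x‖ ‖y‖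
    have h2 := le_max_right ‖x‖ ‖y‖
    nlinarith
  calc ‖z‖ ^ ρ ≤ (2 * M * max ‖x‖ ‖y‖) ^ ρ := Real.rpow_le_rpow (norm_nonneg _) hmax hρ
    _ = (2 * M) ^ ρ * (max ‖x‖ ‖y‖) ^ ρ := Real.mul_rpow (by positivity) (by positivity)
    _ ≤ _ := by
      gcongr
      have p1 := Real.rpow_nonneg hx ρ
      have p2 := Real.rpow_nonneg hy ρ
      rcases max_choice ‖x‖ ‖y‖ with h | h <;> rw [h] <;> linarith

end Weights

/-! ### The inner integral of a pseudo-differential operator -/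

section PhaseInt

variable {s σ r : ℝ} {d : ℕ}

/-- The integral `∫ b(x - L(x-y), η) g(y) exp(i⟨x-y, η⟩) dy`. -/
def phaseInt (L : Eucl d →L[ℝ] Eucl d) (b : Eucl d × Eucl d → ℂ) (g : Eucl d → ℂ)
    (x η : Eucl d) : ℂ :=
  ∫ y, b (x - L (x - y), η) * g y * expInner η (x - y)

theorem expInner_add (η x y : Eucl d) : expInner η (x + y) = expInner η x * expInner η y := by
  unfold expInner
  rw [← Complex.exp_add, inner_add_left]
  push_cast
  ring_nf

theorem expInner_neg (η y : Eucl d) : expInner η (-y) = expInner (-η) y := by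
  simp [expInner]

theorem expInner_sub (η x y : Eucl d) : expInner η (x - y) = expInner η x * expInner (-η) y := by
  rw [sub_eq_add_neg, expInner_add, expInner_neg]

/-- Here x-L(x-y) = Ly + (x-Lx), and the part of the character depending on x leaves the integral as
a unimodular factor. The frequency is -η because y enters the phase with a minus sign. -/
theorem phaseInt_eq_oscInt (L : Eucl d →L[ℝ] Eucl d) (b : Eucl d × Eucl d → ℂ) (g : Eucl d → ℂ)
    (x η : Eucl d) :
    phaseInt L b g x η = expInner η x *
      oscInt (fun z => b (z, η)) g L (ContinuousLinearMap.id ℝ _) (x - L x) 0 (-η) := by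
  unfold phaseInt oscInt
  rw [← integral_const_mul]
  congr 1
  funext y
  rw [expInner_sub, show x - L (x - y) = L y + (x - L x) by rw [map_sub]; abel]
  simp
  ring

/-- The constant of the estimate `‖x - L(x-y)‖^{1/s} ≤ C (‖x‖^{1/s} + ‖y‖^{1/s})`. -/
def shearConst (L : Eucl d →L[ℝ] Eucl d) (s : ℝ) : ℝ := (2 * (1 + ‖L‖)) ^ (1 / s)

theorem shearConst_pos (L : Eucl d →L[ℝ] Eucl d) (s : ℝ) : 0 < shearConst L s := by
  unfold shearConst; positivity

theorem shear_rpow_le (hs : 0 < s) (L : Eucl d →L[ℝ] Eucl d) (x y : Eucl d) :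
    ‖x - L (x - y)‖ ^ (1 / s) ≤ shearConst L s * (‖x‖ ^ (1 / s) + ‖y‖ ^ (1 / s)) := by
  refine rpow_norm_le_of_le (by positivity) (by positivity) ?_
  have h1 := norm_sub_le x (L (x - y))
  have h2 := L.le_opNorm (x - y)
  have h3 := norm_sub_le x y
  have h4 := norm_nonneg L
  nlinarith [norm_nonneg y]

/-- Of the decay of g, the rate r·c cancels the growth of the symbol in y, where c = `shearConst L
s`, and the rate 1 is left as an integrable weight. The growth in x and η remains. -/
theorem norm_amplitude_le (hs : 0 < s) (hr : 0 ≤ r) (L : Eucl d →L[ℝ] Eucl d)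
    {b : Eucl d × Eucl d → ℂ} {g : Eucl d → ℂ} {Kb Kg : ℝ} (hKb : 0 ≤ Kb)
    (hb : ∀ p, ‖b p‖ ≤ Kb * Real.exp (r * (‖p.1‖ ^ (1 / s) + ‖p.2‖ ^ (1 / σ))))
    (hg : ∀ y, ‖g y‖ * Real.exp ((r * shearConst L s + 1) * ‖y‖ ^ (1 / s)) ≤ Kg) (x y η : Eucl d) :
    ‖b (x - L (x - y), η) * g y‖ ≤ Kb * Kg * Real.exp (r * shearConst L s * ‖x‖ ^ (1 / s)) *
      Real.exp (r * ‖η‖ ^ (1 / σ)) * Real.exp (-‖y‖ ^ (1 / s)) := by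
  set c := shearConst L s
  have h1 : ‖b (x - L (x - y), η)‖ ≤ Kb * (Real.exp (r * c * ‖x‖ ^ (1 / s)) *
      Real.exp (r * ‖η‖ ^ (1 / σ)) * Real.exp (r * c * ‖y‖ ^ (1 / s))) := by
    refine (hb _).trans (mul_le_mul_of_nonneg_left ?_ hKb)
    rw [← Real.exp_add, ← Real.exp_add]
    refine Real.exp_le_exp.2 ?_
    have := mul_le_mul_of_nonneg_left (shear_rpow_le hs L x y) hr
    change r * (‖x - L (x - y)‖ ^ (1 / s) + ‖η‖ ^ (1 / σ)) ≤ _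
    linarith
  have h2 := hg y
  rw [add_mul, one_mul, Real.exp_add] at h2
  rw [norm_mul]
  calc ‖b (x - L (x - y), η)‖ * ‖g y‖ ≤ Kb * (Real.exp (r * c * ‖x‖ ^ (1 / s)) *
      Real.exp (r * ‖η‖ ^ (1 / σ)) * Real.exp (r * c * ‖y‖ ^ (1 / s))) * ‖g y‖ := by gcongr
    _ = Kb * Real.exp (r * c * ‖x‖ ^ (1 / s)) * Real.exp (r * ‖η‖ ^ (1 / σ)) *
        Real.exp (-‖y‖ ^ (1 / s)) * (‖g y‖ * (Real.exp (r * c * ‖y‖ ^ (1 / s)) *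
          Real.exp (‖y‖ ^ (1 / s)))) := by
        rw [Real.exp_neg]; field_simp
    _ ≤ Kb * Real.exp (r * c * ‖x‖ ^ (1 / s)) * Real.exp (r * ‖η‖ ^ (1 / σ)) *
        Real.exp (-‖y‖ ^ (1 / s)) * Kg := by gcongr
    _ = _ := by ring

theorem IsSymbol.exists_norm_le {b : Eucl d × Eucl d → ℂ} (hb : IsSymbol s σ r b) :
    ∃ K : ℝ, 0 < K ∧ ∀ p, ‖b p‖ ≤ K * Real.exp (r * (‖p.1‖ ^ (1 / s) + ‖p.2‖ ^ (1 / σ))) := by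
  obtain ⟨C, hC, h⟩ := hb.2 1 one_pos
  exact ⟨C, hC, fun p => by simpa using h 0 0 p⟩

theorem exists_norm_mul_exp_le (hs : 0 < s) (hσ : 0 < σ) (hA : Admissible s σ d) {g : Eucl d → ℂ}
    (hg : g ∈ sigmaSubmodule s σ d) {R : ℝ} (hR : 0 < R) :
    ∃ K : ℝ, 0 ≤ K ∧ ∀ y, ‖g y‖ * Real.exp (R * ‖y‖ ^ (1 / s)) ≤ K := by
  obtain ⟨h, hh, C, hC, hb⟩ := exists_mderiv_monom_mderiv_exp_le (d := d) hs hσ hA hR one_pos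
  refine ⟨C * gsNorm s σ h g, mul_nonneg hC.le (gsNorm_nonneg hh _), fun y => ?_⟩
  simpa [mderiv_zero_index] using hb ⟨g, hg⟩ 0 0 0 y

theorem integrable_amplitude (hs : 0 < s) (hσ : 0 < σ) (hr : 0 ≤ r) (hA : Admissible s σ d)
    (L : Eucl d →L[ℝ] Eucl d) {b : Eucl d × Eucl d → ℂ} (hb : IsSymbol s σ r b) {g : Eucl d → ℂ}
    (hg : g ∈ sigmaSubmodule s σ d) (x η : Eucl d) :
    Integrable (fun y => b (x - L (x - y), η) * g y) := by
  obtain ⟨Kb, hKb, hb'⟩ := hb.exists_norm_le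
  have hc := shearConst_pos L s
  obtain ⟨Kg, hKg, hg'⟩ := exists_norm_mul_exp_le hs hσ hA hg
    (R := r * shearConst L s + 1) (by positivity)
  refine ((integrable_exp_neg_norm_rpow d hs).const_mul (Kb * Kg *
    Real.exp (r * shearConst L s * ‖x‖ ^ (1 / s)) * Real.exp (r * ‖η‖ ^ (1 / σ)))).mono' ?_
    (Filter.Eventually.of_forall fun y => norm_amplitude_le hs hr L hKb.le hb' hg' x y η)
  have h1 : Continuous (fun y => (x - L (x - y), η)) := by fun_prop
  exact ((hb.1.continuous.comp h1).mul hg.1.continuous).aestronglyMeasurable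

theorem norm_integral_amplitude_le (hs : 0 < s) (hr : 0 ≤ r) (L : Eucl d →L[ℝ] Eucl d)
    {b : Eucl d × Eucl d → ℂ} {g : Eucl d → ℂ} {Kb Kg : ℝ} (hKb : 0 ≤ Kb)
    (hb : ∀ p, ‖b p‖ ≤ Kb * Real.exp (r * (‖p.1‖ ^ (1 / s) + ‖p.2‖ ^ (1 / σ))))
    (hg : ∀ y, ‖g y‖ * Real.exp ((r * shearConst L s + 1) * ‖y‖ ^ (1 / s)) ≤ Kg)
    (x η ξ : Eucl d) :
    ‖∫ y, b (x - L (x - y), η) * g y * expInner ξ y‖ ≤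
      Kb * Kg * Real.exp (r * shearConst L s * ‖x‖ ^ (1 / s)) *
      Real.exp (r * ‖η‖ ^ (1 / σ)) * ∫ y : Eucl d, Real.exp (-‖y‖ ^ (1 / s)) := by
  rw [← integral_const_mul]
  refine norm_integral_le_of_norm_le ((integrable_exp_neg_norm_rpow d hs).const_mul _)
    (Filter.Eventually.of_forall fun y => ?_)
  rw [norm_mul, norm_expInner, mul_one]
  exact norm_amplitude_le hs hr L hKb hb hg x y η

/-- The derivatives of a symbol and of a function of `Σ_s^σ` give inner integrals with uniform
exponential decay in the frequency. -/
theorem exists_phaseInt_bound (hs : 0 < s) (hσ : 0 < σ) (hr : 0 < r) (hA : Admissible s σ d)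
    (L : Eucl d →L[ℝ] Eucl d) {b : Eucl d × Eucl d → ℂ} (hb : IsSymbol s σ r b) {h₁ : ℝ}
    (hh₁ : 0 < h₁) :
    ∃ h : ℝ, 0 < h ∧ ∃ C : ℝ, 0 < C ∧ ∀ (f : SigmaSpace s σ d) (β' α' α'' β'' : Fin d → ℕ)
      (x η : Eucl d),
      ‖phaseInt L (symDeriv β' α' b) (fun y => (monom α'' y : ℂ) * mderiv β'' f y) x η‖ ≤
        C * gsNorm s σ h f * (h₁ ^ (len β' + len α' + len α'' + len β'') *
          (mfact α' ^ s * mfact α'' ^ s) * (mfact β' ^ σ * mfact β'' ^ σ)) *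
          Real.exp (r * shearConst L s * ‖x‖ ^ (1 / s)) * Real.exp (-‖η‖ ^ (1 / σ)) := by
  set c := shearConst L s
  have hc : 0 < c := shearConst_pos L s
  -- Decay of rate r + 1 in the frequency beats the growth e^{r‖η‖^{1/σ}} of the symbol and leaves
  -- e^{-‖η‖^{1/σ}}.
  obtain ⟨k, hk, hdec⟩ := exists_oscInt_decay L (ContinuousLinearMap.id ℝ _) hσ
    (show 0 < r + 1 by positivity)
  -- Powers of h₂ are bounded by k for the derivatives δ', δ created by integration by parts and by
  -- h₁ for the given multi-indices.
  set h₂ := min h₁ k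
  have hh₂ : 0 < h₂ := lt_min hh₁ hk
  obtain ⟨h, hh, Cf, hCf, hf⟩ := exists_mderiv_monom_mderiv_exp_le (d := d) hs hσ hA
    (show 0 < r * c + 1 by positivity) hh₂
  obtain ⟨Cb, hCb, hb'⟩ := hb.exists_symDeriv_add_le hs.le hσ.le hh₂
  set I₀ := ∫ y : Eucl d, Real.exp (-‖y‖ ^ (1 / s))
  have hI₀ : 0 ≤ I₀ := integral_nonneg fun y => (Real.exp_pos _).le
  -- Using I₀ + 1 makes the constant positive from I₀ ≥ 0 alone.
  refine ⟨h, hh, 2 ^ σ * (Cb * Cf * (I₀ + 1)), by positivity, fun f β' α' α'' β'' x η => ?_⟩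
  set N := gsNorm s σ h f
  have hN : 0 ≤ N := gsNorm_nonneg hh _
  set g : Eucl d → ℂ := fun y => (monom α'' y : ℂ) * mderiv β'' f y with hg
  have hgmem : g ∈ sigmaSubmodule s σ d := monom_mul_mderiv_mem hs hσ hA f α'' β''
  have p1 := rpow_mfact_pos s α'
  have p2 := rpow_mfact_pos s α''
  have p3 := rpow_mfact_pos σ β'
  have p4 := rpow_mfact_pos σ β''
  set tot := len β' + len α' + len α'' + len β'' with htot
  set K : ℝ := Cb * Cf * (I₀ + 1) * N * (h₁ ^ tot *
          (mfact α' ^ s * mfact α'' ^ s) * (mfact β' ^ σ * mfact β'' ^ σ)) *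
          Real.exp (r * c * ‖x‖ ^ (1 / s)) * Real.exp (r * ‖η‖ ^ (1 / σ)) with hK
  have hK0 : 0 ≤ K := by positivity
  have hbs := symDeriv_smooth β' α' hb.1
  have hu : ContDiff ℝ ∞ (fun z => symDeriv β' α' b (z, η)) :=
    hbs.comp (contDiff_id.prodMk contDiff_const)
  have hder : ∀ δ' : Fin d → ℕ, mderiv δ' (fun z => symDeriv β' α' b (z, η)) =
      fun z => symDeriv (δ' + β') (0 + α') b (z, η) := fun δ' => by
    funext z
    rw [mderiv_slice_fst hbs, ← symDeriv_symDeriv _ _ _ _ hb.1]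
    unfold symDeriv
    simp
  have harg : ∀ y, L y + (x - L x) = x - L (x - y) := fun y => by rw [map_sub]; abel
  have hmem : ∀ δ : Fin d → ℕ, mderiv δ g ∈ sigmaSubmodule s σ d := fun δ => by
    simpa using monom_mul_mderiv_mem hs hσ hA ⟨g, hgmem⟩ 0 δ
  have key := hdec (fun z => symDeriv β' α' b (z, η)) g (x - L x) 0 (-η) K hK0 hu hgmem.1
    (fun δ' δ => by
      rw [hder]
      simp only [harg, ContinuousLinearMap.id_apply, add_zero]
      exact integrable_amplitude hs hσ hr.le hA L (hb.symDeriv hs.le hσ.le _ _) (hmem δ) x η)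
    (fun δ' δ => by
      rw [hder]
      unfold oscInt
      simp only [harg, ContinuousLinearMap.id_apply, add_zero]
      have q1 := rpow_mfact_pos σ δ'
      have q2 := rpow_mfact_pos σ δ
      refine (norm_integral_amplitude_le hs hr.le L
        (Kb := Cb * (h₂ ^ (len δ' + len β' + len 0 + len α') *
          (mfact δ' ^ σ * mfact β' ^ σ) * (mfact (0 : Fin d → ℕ) ^ s * mfact α' ^ s)))
        (by have := rpow_mfact_pos s (0 : Fin d → ℕ); positivity)
        (fun p => (hb' δ' 0 β' α' p).trans (le_of_eq (by ring))) (fun y => hf f α'' δ β'' y)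
        x η (-η)).trans ?_
      simp only [len_zero, mfact_zero, Real.one_rpow, one_mul, add_zero]
      have hpow : h₂ ^ (len δ' + len β' + len α') * h₂ ^ (len α'' + len δ + len β'') ≤
          h₁ ^ tot * k ^ (len δ' + len δ) := by
        rw [← pow_add, show len δ' + len β' + len α' + (len α'' + len δ + len β'') =
          tot + (len δ' + len δ) by rw [htot]; ring, pow_add]
        gcongr
        · exact min_le_left _ _
        · exact min_le_right _ _
      calc _ = (Cb * Cf * I₀ * N * ((mfact α' ^ s * mfact α'' ^ s) * (mfact β' ^ σ * mfact β'' ^ σ))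
            * Real.exp (r * c * ‖x‖ ^ (1 / s)) * Real.exp (r * ‖η‖ ^ (1 / σ)) *
            (mfact δ' ^ σ * mfact δ ^ σ)) *
            (h₂ ^ (len δ' + len β' + len α') * h₂ ^ (len α'' + len δ + len β'')) := by ring
        _ ≤ (Cb * Cf * (I₀ + 1) * N *
            ((mfact α' ^ s * mfact α'' ^ s) * (mfact β' ^ σ * mfact β'' ^ σ))
            * Real.exp (r * c * ‖x‖ ^ (1 / s)) * Real.exp (r * ‖η‖ ^ (1 / σ)) *
            (mfact δ' ^ σ * mfact δ ^ σ)) * (h₁ ^ tot * k ^ (len δ' + len δ)) := by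
            gcongr
            linarith
        _ = _ := by rw [hK]; ring)
  rw [phaseInt_eq_oscInt, norm_mul, norm_expInner, one_mul]
  rw [norm_neg] at key
  rw [← le_div_iff₀ (Real.exp_pos _)] at key
  refine key.trans (le_of_eq ?_)
  rw [hK, add_mul, one_mul, Real.exp_add, Real.exp_neg]
  field_simp

theorem exists_norm_phaseInt_le (hs : 0 < s) (hσ : 0 < σ) (hr : 0 < r) (hA : Admissible s σ d)
    (L : Eucl d →L[ℝ] Eucl d) {b : Eucl d × Eucl d → ℂ} (hb : IsSymbol s σ r b) {g : Eucl d → ℂ}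
    (hg : g ∈ sigmaSubmodule s σ d) :
    ∃ C : ℝ, 0 ≤ C ∧ ∀ x η : Eucl d, ‖phaseInt L b g x η‖ ≤
      C * Real.exp (r * shearConst L s * ‖x‖ ^ (1 / s)) * Real.exp (-‖η‖ ^ (1 / σ)) := by
  obtain ⟨h, hh, C, hC, hbound⟩ := exists_phaseInt_bound hs hσ hr hA L hb one_pos
  refine ⟨C * gsNorm s σ h g, mul_nonneg hC.le (gsNorm_nonneg hh _), fun x η => ?_⟩
  simpa [mderiv_zero_index] using hbound ⟨g, hg⟩ 0 0 0 0 x η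

end PhaseInt

/-! ### Linear maps and their values on the standard basis -/

section Basis

variable {d : ℕ}

theorem eucl_eq_sum (v : Eucl d) : v = ∑ k, v k • stdVec k := by
  have := (EuclideanSpace.basisFun (Fin d) ℝ).sum_repr v
  simpa using this.symm

theorem clm_eq_sum (T : Eucl d →L[ℝ] ℂ) :
    T = ∑ i, (EuclideanSpace.proj i : Eucl d →L[ℝ] ℝ).smulRight (T (stdVec i)) := by
  ext v
  conv_lhs => rw [eucl_eq_sum v]
  simp [map_sum]

theorem norm_clm_le (T : Eucl d →L[ℝ] ℂ) : ‖T‖ ≤ ∑ i, ‖T (stdVec i)‖ := by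
  refine T.opNorm_le_bound (Finset.sum_nonneg fun _ _ => norm_nonneg _) fun v => ?_
  conv_lhs => rw [eucl_eq_sum v]
  rw [map_sum, Finset.sum_mul]
  refine (norm_sum_le _ _).trans (Finset.sum_le_sum fun i _ => ?_)
  rw [map_smul, norm_smul, mul_comm]
  gcongr
  exact PiLp.norm_apply_le v i

theorem norm_clm_prod_le (T : Eucl d × Eucl d →L[ℝ] ℂ) :
    ‖T‖ ≤ (∑ i, ‖T (posVec i)‖) + ∑ i, ‖T (freqVec i)‖ := by
  refine T.opNorm_le_bound (add_nonneg (Finset.sum_nonneg fun _ _ => norm_nonneg _)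
    (Finset.sum_nonneg fun _ _ => norm_nonneg _)) fun v => ?_
  have e : T v = T.comp (ContinuousLinearMap.inl ℝ _ _) v.1 +
      T.comp (ContinuousLinearMap.inr ℝ _ _) v.2 := by
    simp [← map_add]
  have h1 := (T.comp (ContinuousLinearMap.inl ℝ _ _)).le_of_opNorm_le (norm_clm_le _) v.1
  have h2 := (T.comp (ContinuousLinearMap.inr ℝ _ _)).le_of_opNorm_le (norm_clm_le _) v.2
  simp only [ContinuousLinearMap.comp_apply, ContinuousLinearMap.inl_apply,
    ContinuousLinearMap.inr_apply] at h1 h2 e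
  rw [e, add_mul]
  refine (norm_add_le _ _).trans (add_le_add (h1.trans ?_) (h2.trans ?_))
  · exact mul_le_mul_of_nonneg_left (norm_fst_le v) (Finset.sum_nonneg fun _ _ => norm_nonneg _)
  · exact mul_le_mul_of_nonneg_left (norm_snd_le v) (Finset.sum_nonneg fun _ _ => norm_nonneg _)

theorem contDiff_succ_of_dirDeriv {n : ℕ} {f : Eucl d → ℂ} (hf : Differentiable ℝ f)
    (h : ∀ i, ContDiff ℝ n (dirDeriv (stdVec i) f)) : ContDiff ℝ (n + 1 : ℕ) f := by
  rw [Nat.cast_add, Nat.cast_one, contDiff_succ_iff_fderiv]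
  refine ⟨hf, by simp, ?_⟩
  have : fderiv ℝ f = fun x => ∑ i, (EuclideanSpace.proj i : Eucl d →L[ℝ] ℝ).smulRight
      (dirDeriv (stdVec i) f x) := by
    funext x
    exact clm_eq_sum _
  rw [this]
  refine ContDiff.sum fun i _ => ?_
  exact (ContinuousLinearMap.smulRightL ℝ (Eucl d) ℂ
    (EuclideanSpace.proj i : Eucl d →L[ℝ] ℝ)).contDiff.comp (h i)

end Basis

/-! ### Differentiation of the inner integral -/

section PhaseDeriv

variable {s σ r : ℝ} {d : ℕ}

theorem coord_mul_mem (hs : 0 < s) (hσ : 0 < σ) (hA : Admissible s σ d) {g : Eucl d → ℂ}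
    (hg : g ∈ sigmaSubmodule s σ d) (i : Fin d) :
    (fun y => (y i : ℂ) * g y) ∈ sigmaSubmodule s σ d := by
  simpa [mderiv_zero_index] using monom_mul_mderiv_mem hs hσ hA ⟨g, hg⟩ (Pi.single i 1) 0

theorem dirDeriv_mem (hs : 0 < s) (hσ : 0 < σ) (hA : Admissible s σ d) {g : Eucl d → ℂ}
    (hg : g ∈ sigmaSubmodule s σ d) (i : Fin d) :
    dirDeriv (stdVec i) g ∈ sigmaSubmodule s σ d := by
  simpa [mderiv_eq_multiDeriv, multiDeriv_single _ _ hg.1] using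
    monom_mul_mderiv_mem hs hσ hA ⟨g, hg⟩ 0 (Pi.single i 1)

theorem IsSymbol.dirDeriv_pos (hs : 0 < s) (hσ : 0 < σ) {b : Eucl d × Eucl d → ℂ}
    (hb : IsSymbol s σ r b) (i : Fin d) : IsSymbol s σ r (dirDeriv (posVec i) b) := by
  rw [dirDeriv_posVec _ hb.1]
  exact hb.symDeriv hs.le hσ.le _ _

theorem IsSymbol.dirDeriv_freq (hs : 0 < s) (hσ : 0 < σ) {b : Eucl d × Eucl d → ℂ}
    (hb : IsSymbol s σ r b) (i : Fin d) : IsSymbol s σ r (dirDeriv (freqVec i) b) := by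
  rw [dirDeriv_freqVec _ hb.1]
  exact hb.symDeriv hs.le hσ.le _ _

/-- The integrand of `phaseInt`. -/
def phaseFun (L : Eucl d →L[ℝ] Eucl d) (b : Eucl d × Eucl d → ℂ) (g : Eucl d → ℂ)
    (q : (Eucl d × Eucl d) × Eucl d) : ℂ :=
  b (q.1.1 - L (q.1.1 - q.2), q.1.2) * g q.2 * expInner q.1.2 (q.1.1 - q.2)

theorem phaseFun_smooth (L : Eucl d →L[ℝ] Eucl d) {b : Eucl d × Eucl d → ℂ}
    (hb : ContDiff ℝ ∞ b) {g : Eucl d → ℂ} (hg : ContDiff ℝ ∞ g) :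
    ContDiff ℝ ∞ (phaseFun L b g) := by
  have f1 : ContDiff ℝ ∞ (fun q : (Eucl d × Eucl d) × Eucl d => q.1.1) :=
    contDiff_fst.comp contDiff_fst
  have f2 : ContDiff ℝ ∞ (fun q : (Eucl d × Eucl d) × Eucl d => q.1.2) :=
    contDiff_snd.comp contDiff_fst
  have f3 : ContDiff ℝ ∞ (fun q : (Eucl d × Eucl d) × Eucl d => q.1.1 - q.2) :=
    f1.sub contDiff_snd
  have h1 : ContDiff ℝ ∞ (fun q : (Eucl d × Eucl d) × Eucl d =>
      b (q.1.1 - L (q.1.1 - q.2), q.1.2)) :=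
    hb.comp ((f1.sub (L.contDiff.comp f3)).prodMk f2)
  have h2 : ContDiff ℝ ∞ (fun q : (Eucl d × Eucl d) × Eucl d => expInner q.1.2 (q.1.1 - q.2)) :=
    contDiff_expInner f2 f3
  have h3 : ContDiff ℝ ∞ (fun q : (Eucl d × Eucl d) × Eucl d => g q.2) := hg.comp contDiff_snd
  unfold phaseFun
  exact (h1.mul h3).mul h2

theorem integrable_phaseFun (hs : 0 < s) (hσ : 0 < σ) (hr : 0 ≤ r) (hA : Admissible s σ d)
    (L : Eucl d →L[ℝ] Eucl d) {b : Eucl d × Eucl d → ℂ} (hb : IsSymbol s σ r b) {g : Eucl d → ℂ}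
    (hg : g ∈ sigmaSubmodule s σ d) (p : Eucl d × Eucl d) :
    Integrable (fun y => phaseFun L b g (p, y)) := by
  refine (integrable_amplitude hs hσ hr hA L hb hg p.1 p.2).mul_bdd (c := 1) ?_
    (Filter.Eventually.of_forall fun y => (norm_expInner _ _).le)
  exact ((expInner_smooth p.2).continuous.comp (by fun_prop)).aestronglyMeasurable

theorem exists_phaseFun_bound (hs : 0 < s) (hσ : 0 < σ) (hr : 0 ≤ r) (hA : Admissible s σ d)
    (L : Eucl d →L[ℝ] Eucl d) {b : Eucl d × Eucl d → ℂ} (hb : IsSymbol s σ r b) {g : Eucl d → ℂ}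
    (hg : g ∈ sigmaSubmodule s σ d) (M : ℝ) :
    ∃ C : ℝ, 0 ≤ C ∧ ∀ p : Eucl d × Eucl d, ‖p‖ ≤ M → ∀ y,
      ‖phaseFun L b g (p, y)‖ ≤ C * Real.exp (-‖y‖ ^ (1 / s)) := by
  obtain ⟨Kb, hKb, hb'⟩ := hb.exists_norm_le
  have hc := shearConst_pos L s
  obtain ⟨Kg, hKg, hg'⟩ := exists_norm_mul_exp_le hs hσ hA hg
    (R := r * shearConst L s + 1) (by positivity)
  refine ⟨Kb * Kg * Real.exp (r * shearConst L s * M ^ (1 / s)) * Real.exp (r * M ^ (1 / σ)),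
    by positivity, fun p hp y => ?_⟩
  rw [phaseFun, norm_mul, norm_expInner, mul_one]
  refine (norm_amplitude_le hs hr L hKb.le hb' hg' p.1 y p.2).trans ?_
  gcongr
  · exact (norm_fst_le p).trans hp
  · exact (norm_snd_le p).trans hp

theorem phaseFun_slice (L : Eucl d →L[ℝ] Eucl d) (b : Eucl d × Eucl d → ℂ) (g : Eucl d → ℂ)
    (y : Eucl d) : (fun p => phaseFun L b g (p, y)) = fun p =>
      b (((ContinuousLinearMap.id ℝ (Eucl d) - L).prodMap (ContinuousLinearMap.id ℝ _)) p + (L y, 0))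
        * (g y * expInner p.2 (p.1 - y)) := by
  funext p
  simp only [phaseFun, map_sub]
  rw [mul_assoc]
  congr 2
  ext <;> simp
  ring

theorem dirDeriv_const_mul {V : Type*} [NormedAddCommGroup V] [NormedSpace ℝ V] (v : V) (c : ℂ)
    {f : V → ℂ} (hf : ContDiff ℝ ∞ f) :
    dirDeriv v (fun x => c * f x) = fun x => c * dirDeriv v f x :=
  dirDeriv_smul v c hf

theorem dirDeriv_expInner₂ (y : Eucl d) (v p : Eucl d × Eucl d) :
    dirDeriv v (fun p : Eucl d × Eucl d => expInner p.2 (p.1 - y)) p =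
      Complex.I * ((inner ℝ v.1 p.2 + inner ℝ (p.1 - y) v.2 : ℝ) : ℂ) * expInner p.2 (p.1 - y) := by
  have h1 : HasFDerivAt (fun p : Eucl d × Eucl d => p.1 - y)
      (ContinuousLinearMap.fst ℝ (Eucl d) (Eucl d)) p :=
    (ContinuousLinearMap.fst ℝ (Eucl d) (Eucl d)).hasFDerivAt.sub_const y
  have h2 := h1.inner ℝ (ContinuousLinearMap.snd ℝ (Eucl d) (Eucl d)).hasFDerivAt
  have h3 := ((Complex.ofRealCLM.hasFDerivAt.comp p h2).const_mul Complex.I).cexp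
  unfold dirDeriv
  rw [show fderiv ℝ (fun p : Eucl d × Eucl d => expInner p.2 (p.1 - y)) p = _ from h3.fderiv]
  simp [expInner]
  ring

theorem dirDeriv_phaseFun (L : Eucl d →L[ℝ] Eucl d) {b : Eucl d × Eucl d → ℂ}
    (hb : ContDiff ℝ ∞ b) (g : Eucl d → ℂ) (y : Eucl d) (v p : Eucl d × Eucl d) :
    dirDeriv v (fun p => phaseFun L b g (p, y)) p =
      phaseFun L (dirDeriv (v.1 - L v.1, v.2) b) g (p, y) +
      Complex.I * ((inner ℝ v.1 p.2 + inner ℝ (p.1 - y) v.2 : ℝ) : ℂ) * phaseFun L b g (p, y) := by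
  have h2 : ContDiff ℝ ∞ (fun p : Eucl d × Eucl d => expInner p.2 (p.1 - y)) :=
    contDiff_expInner contDiff_snd (contDiff_fst.sub contDiff_const)
  have h3 : ContDiff ℝ ∞ (fun p : Eucl d × Eucl d => g y * expInner p.2 (p.1 - y)) :=
    contDiff_const.mul h2
  have e1 := congrFun (phaseFun_slice L (dirDeriv (v.1 - L v.1, v.2) b) g y) p
  have e2 := congrFun (phaseFun_slice L b g y) p
  have e3 := phaseFun_slice L b g y
  generalize hℓ : (ContinuousLinearMap.id ℝ (Eucl d) - L).prodMap
    (ContinuousLinearMap.id ℝ (Eucl d)) = ℓ at e1 e2 e3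
  have h1 : ContDiff ℝ ∞ (fun p => b (ℓ p + (L y, 0))) := hb.comp (ℓ.contDiff.add contDiff_const)
  have hv : ℓ v = (v.1 - L v.1, v.2) := by rw [← hℓ]; rfl
  rw [e3, dirDeriv_mul _ h1 h3, dirDeriv_const_mul _ _ h2]
  beta_reduce at e1 e2 ⊢
  rw [e1, e2, dirDeriv_comp_affine hb, hv, dirDeriv_expInner₂]
  ring

theorem dirDeriv_prod_eq_sum (b : Eucl d × Eucl d → ℂ) (w : Eucl d) :
    dirDeriv (w, (0 : Eucl d)) b = fun p => ∑ k, (w k : ℂ) * dirDeriv (posVec k) b p := by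
  funext p
  unfold dirDeriv
  have hv : ((w, 0) : Eucl d × Eucl d) = ∑ k, w k • posVec k := by
    conv_lhs => rw [eucl_eq_sum w]
    ext <;> simp [Prod.fst_sum, Prod.snd_sum]
  rw [hv, map_sum]
  refine Finset.sum_congr rfl fun k _ => ?_
  rw [map_smul, Complex.real_smul]

theorem dirDeriv_pos_phaseFun (L : Eucl d →L[ℝ] Eucl d) {b : Eucl d × Eucl d → ℂ}
    (hb : ContDiff ℝ ∞ b) (g : Eucl d → ℂ) (y : Eucl d) (i : Fin d) (p : Eucl d × Eucl d) :
    dirDeriv (posVec i) (fun p => phaseFun L b g (p, y)) p =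
      (∑ k, ((stdVec i - L (stdVec i)) k : ℂ) * phaseFun L (dirDeriv (posVec k) b) g (p, y)) +
      Complex.I * (p.2 i : ℂ) * phaseFun L b g (p, y) := by
  rw [dirDeriv_phaseFun L hb]
  congr 1
  · change phaseFun L (dirDeriv (stdVec i - L (stdVec i), (0 : Eucl d)) b) g (p, y) = _
    rw [dirDeriv_prod_eq_sum]
    simp only [phaseFun, Finset.sum_mul]
    exact Finset.sum_congr rfl fun k _ => by ring
  · simp [EuclideanSpace.inner_single_left]

theorem dirDeriv_freq_phaseFun (L : Eucl d →L[ℝ] Eucl d) {b : Eucl d × Eucl d → ℂ}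
    (hb : ContDiff ℝ ∞ b) (g : Eucl d → ℂ) (y : Eucl d) (i : Fin d) (p : Eucl d × Eucl d) :
    dirDeriv (freqVec i) (fun p => phaseFun L b g (p, y)) p =
      phaseFun L (dirDeriv (freqVec i) b) g (p, y) +
      (Complex.I * (p.1 i : ℂ) * phaseFun L b g (p, y) -
        Complex.I * phaseFun L b (fun y => (y i : ℂ) * g y) (p, y)) := by
  rw [dirDeriv_phaseFun L hb]
  congr 1
  · simp
  · simp [EuclideanSpace.inner_single_right, phaseFun]
    ring

theorem hasFDerivAt_phaseInt (hs : 0 < s) (hσ : 0 < σ) (hr : 0 ≤ r) (hA : Admissible s σ d)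
    (L : Eucl d →L[ℝ] Eucl d) {b : Eucl d × Eucl d → ℂ} (hb : IsSymbol s σ r b) {g : Eucl d → ℂ}
    (hg : g ∈ sigmaSubmodule s σ d) (p₀ : Eucl d × Eucl d) :
    Integrable (fun y => fderiv ℝ (fun p => phaseFun L b g (p, y)) p₀) ∧
    HasFDerivAt (fun p => phaseInt L b g p.1 p.2)
      (∫ y, fderiv ℝ (fun p => phaseFun L b g (p, y)) p₀) p₀ := by
  have hsm := phaseFun_smooth L hb.1 hg.1
  set M := ‖p₀‖ + 1 with hM
  have hM0 : 0 ≤ M := by positivity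
  -- The partial derivatives of the integrand are combinations of integrands of the same type, with
  -- b replaced by a first derivative or g(y) by y_i g(y), and with coefficients bounded near p₀.
  -- All are dominated by one integrable weight on the unit ball around p₀.
  choose C₁ hC₁ h₁ using fun k => exists_phaseFun_bound hs hσ hr hA L (hb.dirDeriv_pos hs hσ k) hg M
  choose C₂ hC₂ h₂ using fun k => exists_phaseFun_bound hs hσ hr hA L (hb.dirDeriv_freq hs hσ k) hg M
  obtain ⟨C₃, hC₃, h₃⟩ := exists_phaseFun_bound hs hσ hr hA L hb hg M
  choose C₄ hC₄ h₄ using fun i => exists_phaseFun_bound hs hσ hr hA L hb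
    (coord_mul_mem hs hσ hA hg i) M
  set C := (∑ i, ((∑ k, |(stdVec i - L (stdVec i)) k| * C₁ k) + M * C₃)) +
    ∑ i, (C₂ i + (M * C₃ + C₄ i)) with hC
  have hbound : ∀ y, ∀ p ∈ Metric.ball p₀ 1,
      ‖fderiv ℝ (fun p => phaseFun L b g (p, y)) p‖ ≤ C * Real.exp (-‖y‖ ^ (1 / s)) := by
    intro y p hp
    have hpM : ‖p‖ ≤ M := by
      have := norm_le_norm_add_norm_sub' p p₀
      rw [mem_ball_iff_norm] at hp
      linarith
    have hx : ∀ i, |p.1 i| ≤ M := fun i =>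
      ((PiLp.norm_apply_le p.1 i).trans (norm_fst_le p)).trans hpM
    have hη : ∀ i, |p.2 i| ≤ M := fun i =>
      ((PiLp.norm_apply_le p.2 i).trans (norm_snd_le p)).trans hpM
    refine (norm_clm_prod_le _).trans ?_
    rw [hC, add_mul, Finset.sum_mul, Finset.sum_mul]
    refine add_le_add (Finset.sum_le_sum fun i _ => ?_) (Finset.sum_le_sum fun i _ => ?_)
    · have := dirDeriv_pos_phaseFun L hb.1 g y i p
      unfold dirDeriv at this
      rw [this, add_mul, Finset.sum_mul]
      refine (norm_add_le _ _).trans (add_le_add ((norm_sum_le _ _).trans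
        (Finset.sum_le_sum fun k _ => ?_)) ?_)
      · rw [norm_mul, Complex.norm_real, Real.norm_eq_abs, mul_assoc]
        exact mul_le_mul_of_nonneg_left (h₁ k p hpM y) (abs_nonneg _)
      · rw [norm_mul, norm_mul, Complex.norm_I, one_mul, Complex.norm_real, Real.norm_eq_abs,
          mul_assoc]
        exact mul_le_mul (hη i) (h₃ p hpM y) (norm_nonneg _) hM0
    · have := dirDeriv_freq_phaseFun L hb.1 g y i p
      unfold dirDeriv at this
      rw [this, add_mul, add_mul]
      refine (norm_add_le _ _).trans (add_le_add (h₂ i p hpM y) ((norm_sub_le _ _).trans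
        (add_le_add ?_ ?_)))
      · rw [norm_mul, norm_mul, Complex.norm_I, one_mul, Complex.norm_real, Real.norm_eq_abs,
          mul_assoc]
        exact mul_le_mul (hx i) (h₃ p hpM y) (norm_nonneg _) hM0
      · rw [norm_mul, Complex.norm_I, one_mul]
        exact h₄ i p hpM y
  have hslice : ∀ y, ContDiff ℝ ∞ (fun p => phaseFun L b g (p, y)) := fun y =>
    hsm.comp (contDiff_id.prodMk contDiff_const)
  have hcont : Continuous (fun y => fderiv ℝ (fun p => phaseFun L b g (p, y)) p₀) := by
    have e : (fun y => fderiv ℝ (fun p => phaseFun L b g (p, y)) p₀) = fun y =>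
        (fderiv ℝ (phaseFun L b g) (p₀, y)).comp (ContinuousLinearMap.inl ℝ _ _) := by
      funext y
      have h1 : HasFDerivAt (fun p : Eucl d × Eucl d => (p, y))
          (ContinuousLinearMap.inl ℝ (Eucl d × Eucl d) (Eucl d)) p₀ := hasFDerivAt_prodMk_left p₀ y
      exact ((hsm.differentiable (by simp) (p₀, y)).hasFDerivAt.comp p₀ h1).fderiv
    rw [e]
    have h2 : Continuous (fderiv ℝ (phaseFun L b g)) := hsm.continuous_fderiv (by simp)
    exact (h2.comp (Continuous.prodMk_right p₀)).clm_comp continuous_const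
  have hE := (integrable_exp_neg_norm_rpow d hs).const_mul C
  refine ⟨hE.mono' hcont.aestronglyMeasurable (Filter.Eventually.of_forall fun y =>
    hbound y p₀ (Metric.mem_ball_self one_pos)), ?_⟩
  refine hasFDerivAt_integral_of_dominated_of_fderiv_le
    (F := fun p y => phaseFun L b g (p, y))
    (F' := fun p y => fderiv ℝ (fun p => phaseFun L b g (p, y)) p)
    (Metric.ball_mem_nhds p₀ one_pos)
    (Filter.Eventually.of_forall fun p =>
      (integrable_phaseFun hs hσ hr hA L hb hg p).aestronglyMeasurable)
    (integrable_phaseFun hs hσ hr hA L hb hg p₀) hcont.aestronglyMeasurable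
    (Filter.Eventually.of_forall hbound) hE
    (Filter.Eventually.of_forall fun y p _ => ((hslice y).differentiable (by simp) p).hasFDerivAt)

theorem phaseInt_eq_integral (L : Eucl d →L[ℝ] Eucl d) (b : Eucl d × Eucl d → ℂ)
    (g : Eucl d → ℂ) (p : Eucl d × Eucl d) :
    phaseInt L b g p.1 p.2 = ∫ y, phaseFun L b g (p, y) := rfl

/-- Integration by parts in the inner integral. -/
theorem freq_mul_phaseInt (hs : 0 < s) (hσ : 0 < σ) (hr : 0 ≤ r) (hA : Admissible s σ d)
    (L : Eucl d →L[ℝ] Eucl d) {b : Eucl d × Eucl d → ℂ} (hb : IsSymbol s σ r b) {g : Eucl d → ℂ}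
    (hg : g ∈ sigmaSubmodule s σ d) (x η : Eucl d) (i : Fin d) :
    Complex.I * (η i : ℂ) * phaseInt L b g x η =
      (∑ k, ((L (stdVec i)) k : ℂ) * phaseInt L (dirDeriv (posVec k) b) g x η) +
        phaseInt L b (dirDeriv (stdVec i) g) x η := by
  have hu : ContDiff ℝ ∞ (fun z => b (z, η)) := hb.1.comp (contDiff_id.prodMk contDiff_const)
  have harg : ∀ y, L y + (x - L x) = x - L (x - y) := fun y => by rw [map_sub]; abel
  have hmem : ∀ δ : Fin d → ℕ, mderiv δ g ∈ sigmaSubmodule s σ d := fun δ => by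
    simpa using monom_mul_mderiv_mem hs hσ hA ⟨g, hg⟩ 0 δ
  have hder : ∀ δ' : Fin d → ℕ, mderiv δ' (fun z => b (z, η)) =
      fun z => symDeriv δ' 0 b (z, η) := fun δ' => by
    funext z
    rw [mderiv_slice_fst hb.1]
    simp [symDeriv]
  have hpos : ∀ k, dirDeriv (stdVec k) (fun z => b (z, η)) =
      fun z => dirDeriv (posVec k) b (z, η) := fun k => by
    have := hder (Pi.single k 1)
    rwa [mderiv_eq_multiDeriv, multiDeriv_single _ _ hu, ← dirDeriv_posVec _ hb.1] at this
  have := oscInt_step hu hg.1 L (ContinuousLinearMap.id ℝ _) (x - L x) 0 (-η) (fun α β => by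
    rw [hder]
    simp only [harg, ContinuousLinearMap.id_apply, add_zero]
    exact integrable_amplitude hs hσ hr hA L (hb.symDeriv hs.le hσ.le _ _) (hmem β) x η) i
  simp only [hpos] at this
  have hid : ∑ k, ((ContinuousLinearMap.id ℝ (Eucl d) (stdVec i)) k : ℂ) *
      oscInt (fun z => b (z, η)) (dirDeriv (stdVec k) g) L (ContinuousLinearMap.id ℝ _) (x - L x) 0
        (-η) = oscInt (fun z => b (z, η)) (dirDeriv (stdVec i) g) L (ContinuousLinearMap.id ℝ _)
          (x - L x) 0 (-η) := by
    rw [Finset.sum_eq_single i]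
    · simp
    · intro k _ hk; simp [hk]
    · simp
  rw [hid] at this
  simp only [phaseInt_eq_oscInt L]
  have hneg : (((-η) i : ℝ) : ℂ) = -(η i : ℂ) := by simp
  rw [hneg] at this
  have h2 : ∀ k, ((L (stdVec i)) k : ℂ) * (expInner η x *
      oscInt (fun z => dirDeriv (posVec k) b (z, η)) g L (ContinuousLinearMap.id ℝ (Eucl d)) (x - L x) 0 (-η)) =
      expInner η x * (((L (stdVec i)) k : ℂ) *
        oscInt (fun z => dirDeriv (posVec k) b (z, η)) g L (ContinuousLinearMap.id ℝ (Eucl d)) (x - L x) 0 (-η)) :=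
    fun k => by ring
  simp only [h2]
  rw [← Finset.mul_sum]
  linear_combination (-expInner η x) * this

theorem differentiable_phaseInt (hs : 0 < s) (hσ : 0 < σ) (hr : 0 ≤ r) (hA : Admissible s σ d)
    (L : Eucl d →L[ℝ] Eucl d) {b : Eucl d × Eucl d → ℂ} (hb : IsSymbol s σ r b) {g : Eucl d → ℂ}
    (hg : g ∈ sigmaSubmodule s σ d) :
    Differentiable ℝ (fun p : Eucl d × Eucl d => phaseInt L b g p.1 p.2) :=
  fun p => (hasFDerivAt_phaseInt hs hσ hr hA L hb hg p).2.differentiableAt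

theorem dirDeriv_phaseInt (hs : 0 < s) (hσ : 0 < σ) (hr : 0 ≤ r) (hA : Admissible s σ d)
    (L : Eucl d →L[ℝ] Eucl d) {b : Eucl d × Eucl d → ℂ} (hb : IsSymbol s σ r b) {g : Eucl d → ℂ}
    (hg : g ∈ sigmaSubmodule s σ d) (v p : Eucl d × Eucl d) :
    dirDeriv v (fun p : Eucl d × Eucl d => phaseInt L b g p.1 p.2) p =
      ∫ y, dirDeriv v (fun p => phaseFun L b g (p, y)) p := by
  obtain ⟨h1, h2⟩ := hasFDerivAt_phaseInt hs hσ hr hA L hb hg p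
  unfold dirDeriv
  rw [h2.fderiv, ContinuousLinearMap.integral_apply h1]

/-- Differentiation under the integral gives the derivative of b along e_i - Le_i and a factor iη_i
from the phase. By `freq_mul_phaseInt` that factor equals the derivative of b along Le_i plus the
derivative of g, so L cancels. -/
theorem dirDeriv_pos_phaseInt (hs : 0 < s) (hσ : 0 < σ) (hr : 0 ≤ r) (hA : Admissible s σ d)
    (L : Eucl d →L[ℝ] Eucl d) {b : Eucl d × Eucl d → ℂ} (hb : IsSymbol s σ r b) {g : Eucl d → ℂ}
    (hg : g ∈ sigmaSubmodule s σ d) (i : Fin d) (p : Eucl d × Eucl d) :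
    dirDeriv (posVec i) (fun p : Eucl d × Eucl d => phaseInt L b g p.1 p.2) p =
      phaseInt L (dirDeriv (posVec i) b) g p.1 p.2 +
        phaseInt L b (dirDeriv (stdVec i) g) p.1 p.2 := by
  have hi : ∀ k, Integrable (fun y => phaseFun L (dirDeriv (posVec k) b) g (p, y)) := fun k =>
    integrable_phaseFun hs hσ hr hA L (hb.dirDeriv_pos hs hσ k) hg p
  have hi0 := integrable_phaseFun hs hσ hr hA L hb hg p
  rw [dirDeriv_phaseInt hs hσ hr hA L hb hg]
  simp only [dirDeriv_pos_phaseFun L hb.1]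
  rw [integral_add (integrable_finsetSum _ fun k _ => (hi k).const_mul _) (hi0.const_mul _),
    integral_finsetSum _ fun k _ => (hi k).const_mul _]
  simp only [integral_const_mul, ← phaseInt_eq_integral]
  rw [freq_mul_phaseInt hs hσ hr hA L hb hg, ← add_assoc, ← Finset.sum_add_distrib]
  congr 1
  rw [Finset.sum_eq_single i]
  · simp; ring
  · intro k _ hk; simp [hk]
  · simp

/-- The phase contributes i(x_i - y_i), whose second part is moved onto g. -/
theorem dirDeriv_freq_phaseInt (hs : 0 < s) (hσ : 0 < σ) (hr : 0 ≤ r) (hA : Admissible s σ d)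
    (L : Eucl d →L[ℝ] Eucl d) {b : Eucl d × Eucl d → ℂ} (hb : IsSymbol s σ r b) {g : Eucl d → ℂ}
    (hg : g ∈ sigmaSubmodule s σ d) (i : Fin d) (p : Eucl d × Eucl d) :
    dirDeriv (freqVec i) (fun p : Eucl d × Eucl d => phaseInt L b g p.1 p.2) p =
      phaseInt L (dirDeriv (freqVec i) b) g p.1 p.2 +
        (Complex.I * (p.1 i : ℂ) * phaseInt L b g p.1 p.2 -
          Complex.I * phaseInt L b (fun y => (y i : ℂ) * g y) p.1 p.2) := by
  have hi1 := integrable_phaseFun hs hσ hr hA L (hb.dirDeriv_freq hs hσ i) hg p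
  have hi0 := integrable_phaseFun hs hσ hr hA L hb hg p
  have hi2 := integrable_phaseFun hs hσ hr hA L hb (coord_mul_mem hs hσ hA hg i) p
  rw [dirDeriv_phaseInt hs hσ hr hA L hb hg]
  simp only [dirDeriv_freq_phaseFun L hb.1]
  have hi3 : Integrable (fun y => Complex.I * (p.1 i : ℂ) * phaseFun L b g (p, y) -
      Complex.I * phaseFun L b (fun y => (y i : ℂ) * g y) (p, y)) :=
    (hi0.const_mul _).sub (hi2.const_mul _)
  rw [integral_add hi1 hi3,
    integral_sub (hi0.const_mul _) (hi2.const_mul _)]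
  simp only [integral_const_mul, ← phaseInt_eq_integral]

end PhaseDeriv

/-! ### The operator on functions -/

section OpInt

variable {s σ r : ℝ} {d : ℕ}

/-- The iterated integral `∫ (∫ b(x - L(x-y), η) g(y) exp(i⟨x-y, η⟩) dy) dη`. -/
def opInt (L : Eucl d →L[ℝ] Eucl d) (b : Eucl d × Eucl d → ℂ) (g : Eucl d → ℂ) (x : Eucl d) : ℂ :=
  ∫ η, phaseInt L b g x η

theorem continuous_phaseInt (hs : 0 < s) (hσ : 0 < σ) (hr : 0 ≤ r) (hA : Admissible s σ d)
    (L : Eucl d →L[ℝ] Eucl d) {b : Eucl d × Eucl d → ℂ} (hb : IsSymbol s σ r b) {g : Eucl d → ℂ}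
    (hg : g ∈ sigmaSubmodule s σ d) (x : Eucl d) : Continuous (phaseInt L b g x) :=
  (differentiable_phaseInt hs hσ hr hA L hb hg).continuous.comp (Continuous.prodMk_right x)

theorem integrable_phaseInt (hs : 0 < s) (hσ : 0 < σ) (hr : 0 < r) (hA : Admissible s σ d)
    (L : Eucl d →L[ℝ] Eucl d) {b : Eucl d × Eucl d → ℂ} (hb : IsSymbol s σ r b) {g : Eucl d → ℂ}
    (hg : g ∈ sigmaSubmodule s σ d) (x : Eucl d) : Integrable (phaseInt L b g x) := by
  obtain ⟨C, -, hC⟩ := exists_norm_phaseInt_le hs hσ hr hA L hb hg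
  exact ((integrable_exp_neg_norm_rpow d hσ).const_mul _).mono'
    (continuous_phaseInt hs hσ hr.le hA L hb hg x).aestronglyMeasurable
    (Filter.Eventually.of_forall fun η => hC x η)

theorem hasFDerivAt_phaseInt_fst (hs : 0 < s) (hσ : 0 < σ) (hr : 0 ≤ r) (hA : Admissible s σ d)
    (L : Eucl d →L[ℝ] Eucl d) {b : Eucl d × Eucl d → ℂ} (hb : IsSymbol s σ r b) {g : Eucl d → ℂ}
    (hg : g ∈ sigmaSubmodule s σ d) (x η : Eucl d) :
    HasFDerivAt (fun x => phaseInt L b g x η)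
      (∑ i, (EuclideanSpace.proj i : Eucl d →L[ℝ] ℝ).smulRight
        (phaseInt L (dirDeriv (posVec i) b) g x η + phaseInt L b (dirDeriv (stdVec i) g) x η)) x := by
  have h1 := (differentiable_phaseInt hs hσ hr hA L hb hg (x, η)).hasFDerivAt
  have h2 : HasFDerivAt (fun x => phaseInt L b g x η) ((fderiv ℝ
      (fun p : Eucl d × Eucl d => phaseInt L b g p.1 p.2) (x, η)).comp
        (ContinuousLinearMap.inl ℝ _ _)) x :=
    HasFDerivAt.comp (f := fun x => (x, η)) x h1 (hasFDerivAt_prodMk_left x η)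
  have e : ∀ i, phaseInt L (dirDeriv (posVec i) b) g x η + phaseInt L b (dirDeriv (stdVec i) g) x η
      = ((fderiv ℝ (fun p : Eucl d × Eucl d => phaseInt L b g p.1 p.2) (x, η)).comp
        (ContinuousLinearMap.inl ℝ _ _)) (stdVec i) := fun i =>
    (dirDeriv_pos_phaseInt hs hσ hr hA L hb hg i (x, η)).symm
  simp only [e]
  rw [← clm_eq_sum]
  exact h2

theorem differentiable_opInt_and_dirDeriv (hs : 0 < s) (hσ : 0 < σ) (hr : 0 < r) (hA : Admissible s σ d)
    (L : Eucl d →L[ℝ] Eucl d) {b : Eucl d × Eucl d → ℂ} (hb : IsSymbol s σ r b) {g : Eucl d → ℂ}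
    (hg : g ∈ sigmaSubmodule s σ d) :
    Differentiable ℝ (opInt L b g) ∧ ∀ i, dirDeriv (stdVec i) (opInt L b g) =
      opInt L (dirDeriv (posVec i) b) g + opInt L b (dirDeriv (stdVec i) g) := by
  have hbi : ∀ i, IsSymbol s σ r (dirDeriv (posVec i) b) := fun i => hb.dirDeriv_pos hs hσ i
  have hgi : ∀ i, dirDeriv (stdVec i) g ∈ sigmaSubmodule s σ d := fun i =>
    dirDeriv_mem hs hσ hA hg i
  set v : Eucl d → Eucl d → Fin d → ℂ := fun x η i =>
    phaseInt L (dirDeriv (posVec i) b) g x η + phaseInt L b (dirDeriv (stdVec i) g) x η with hv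
  set F' : Eucl d → Eucl d → Eucl d →L[ℝ] ℂ := fun x η =>
    ∑ i, (EuclideanSpace.proj i : Eucl d →L[ℝ] ℝ).smulRight (v x η i) with hF'
  have hvi : ∀ x i, Integrable (fun η => v x η i) := fun x i =>
    (integrable_phaseInt hs hσ hr hA L (hbi i) hg x).add
      (integrable_phaseInt hs hσ hr hA L hb (hgi i) x)
  have hvc : ∀ x i, Continuous (fun η => v x η i) := fun x i =>
    (continuous_phaseInt hs hσ hr.le hA L (hbi i) hg x).add
      (continuous_phaseInt hs hσ hr.le hA L hb (hgi i) x)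
  have hF'i : ∀ x η i, F' x η (stdVec i) = v x η i := fun x η i => by
    rw [hF']
    simp only [sum_apply, ContinuousLinearMap.smulRight_apply]
    rw [Finset.sum_eq_single i]
    · simp
    · intro k _ hk; simp [hk]
    · simp
  have hcont : ∀ x, Continuous (F' x) := fun x => by
    rw [hF']
    refine continuous_finsetSum _ fun i _ => ?_
    exact (ContinuousLinearMap.smulRightL ℝ (Eucl d) ℂ
      (EuclideanSpace.proj i : Eucl d →L[ℝ] ℝ)).continuous.comp (hvc x i)
  choose C₁ hC₁ h₁ using fun i => exists_norm_phaseInt_le hs hσ hr hA L (hbi i) hg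
  choose C₂ hC₂ h₂ using fun i => exists_norm_phaseInt_le hs hσ hr hA L hb (hgi i)
  have hbound : ∀ (M : ℝ) (x η : Eucl d), ‖x‖ ≤ M → ‖F' x η‖ ≤
      (∑ i, (C₁ i + C₂ i)) * Real.exp (r * shearConst L s * M ^ (1 / s)) *
        Real.exp (-‖η‖ ^ (1 / σ)) := by
    intro M x η hx
    refine (norm_clm_le _).trans ?_
    rw [Finset.sum_mul, Finset.sum_mul]
    refine Finset.sum_le_sum fun i _ => ?_
    rw [hF'i, hv]
    have hc := shearConst_pos L s
    have hexp : Real.exp (r * shearConst L s * ‖x‖ ^ (1 / s)) ≤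
        Real.exp (r * shearConst L s * M ^ (1 / s)) := by gcongr
    refine (norm_add_le _ _).trans ?_
    calc _ ≤ C₁ i * Real.exp (r * shearConst L s * ‖x‖ ^ (1 / s)) * Real.exp (-‖η‖ ^ (1 / σ)) +
          C₂ i * Real.exp (r * shearConst L s * ‖x‖ ^ (1 / s)) * Real.exp (-‖η‖ ^ (1 / σ)) :=
          add_le_add (h₁ i x η) (h₂ i x η)
      _ = (C₁ i + C₂ i) * Real.exp (r * shearConst L s * ‖x‖ ^ (1 / s)) *
          Real.exp (-‖η‖ ^ (1 / σ)) := by ring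
      _ ≤ _ := by
          have := add_nonneg (hC₁ i) (hC₂ i)
          gcongr
  have hderiv : ∀ x, HasFDerivAt (opInt L b g) (∫ η, F' x η) x ∧ Integrable (F' x) := fun x => by
    have hE := (integrable_exp_neg_norm_rpow d hσ).const_mul
      ((∑ i, (C₁ i + C₂ i)) * Real.exp (r * shearConst L s * (‖x‖ + 1) ^ (1 / s)))
    refine ⟨hasFDerivAt_integral_of_dominated_of_fderiv_le
      (F := fun x η => phaseInt L b g x η) (F' := F') (Metric.ball_mem_nhds x one_pos)
      (Filter.Eventually.of_forall fun x' =>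
        (continuous_phaseInt hs hσ hr.le hA L hb hg x').aestronglyMeasurable)
      (integrable_phaseInt hs hσ hr hA L hb hg x) (hcont x).aestronglyMeasurable
      (Filter.Eventually.of_forall fun η x' hx' => hbound (‖x‖ + 1) x' η ?_) hE
      (Filter.Eventually.of_forall fun η x' _ =>
        hasFDerivAt_phaseInt_fst hs hσ hr.le hA L hb hg x' η), hE.mono'
        (hcont x).aestronglyMeasurable (Filter.Eventually.of_forall fun η =>
          hbound (‖x‖ + 1) x η (by linarith))⟩
    have := norm_le_norm_add_norm_sub' x' x
    rw [mem_ball_iff_norm] at hx'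
    linarith
  refine ⟨fun x => (hderiv x).1.differentiableAt, fun i => ?_⟩
  funext x
  unfold dirDeriv
  rw [(hderiv x).1.fderiv, ContinuousLinearMap.integral_apply (hderiv x).2]
  simp only [hF'i]
  exact integral_add (integrable_phaseInt hs hσ hr hA L (hbi i) hg x)
      (integrable_phaseInt hs hσ hr hA L hb (hgi i) x)

theorem dirDeriv_opInt (hs : 0 < s) (hσ : 0 < σ) (hr : 0 < r) (hA : Admissible s σ d)
    (L : Eucl d →L[ℝ] Eucl d) {b : Eucl d × Eucl d → ℂ} (hb : IsSymbol s σ r b) {g : Eucl d → ℂ}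
    (hg : g ∈ sigmaSubmodule s σ d) (i : Fin d) : dirDeriv (stdVec i) (opInt L b g) =
      opInt L (dirDeriv (posVec i) b) g + opInt L b (dirDeriv (stdVec i) g) :=
  (differentiable_opInt_and_dirDeriv hs hσ hr hA L hb hg).2 i

/-- By `dirDeriv_opInt` the first derivatives are sums of functions of the same form, so the
induction runs over all symbols and all functions at once. -/
theorem opInt_smooth (hs : 0 < s) (hσ : 0 < σ) (hr : 0 < r) (hA : Admissible s σ d)
    (L : Eucl d →L[ℝ] Eucl d) {b : Eucl d × Eucl d → ℂ} (hb : IsSymbol s σ r b) {g : Eucl d → ℂ}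
    (hg : g ∈ sigmaSubmodule s σ d) : ContDiff ℝ ∞ (opInt L b g) := by
  rw [contDiff_infty]
  intro n
  induction n generalizing b g with
  | zero =>
    exact contDiff_zero.2 (differentiable_opInt_and_dirDeriv hs hσ hr hA L hb hg).1.continuous
  | succ n ih =>
    refine contDiff_succ_of_dirDeriv (differentiable_opInt_and_dirDeriv hs hσ hr hA L hb hg).1 fun i => ?_
    rw [dirDeriv_opInt hs hσ hr hA L hb hg]
    exact (ih (hb.dirDeriv_pos hs hσ i) hg).add (ih hb (dirDeriv_mem hs hσ hA hg i))

/-- The integral over η of the η_i-derivative of the inner integral vanishes, since both the inner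
integral and that derivative are integrable. Written out by `dirDeriv_freq_phaseInt`, this is the
identity. -/
theorem coord_mul_opInt (hs : 0 < s) (hσ : 0 < σ) (hr : 0 < r) (hA : Admissible s σ d)
    (L : Eucl d →L[ℝ] Eucl d) {b : Eucl d × Eucl d → ℂ} (hb : IsSymbol s σ r b) {g : Eucl d → ℂ}
    (hg : g ∈ sigmaSubmodule s σ d) (i : Fin d) (x : Eucl d) :
    (x i : ℂ) * opInt L b g x = opInt L b (fun y => (y i : ℂ) * g y) x +
      Complex.I * opInt L (dirDeriv (freqVec i) b) g x := by
  have i0 := integrable_phaseInt hs hσ hr hA L hb hg x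
  have i1 := integrable_phaseInt hs hσ hr hA L (hb.dirDeriv_freq hs hσ i) hg x
  have i2 := integrable_phaseInt hs hσ hr hA L hb (coord_mul_mem hs hσ hA hg i) x
  have hdiff : Differentiable ℝ (phaseInt L b g x) := fun η =>
    (differentiable_phaseInt hs hσ hr.le hA L hb hg (x, η)).comp η
      (hasFDerivAt_prodMk_right x η).differentiableAt
  have e : ∀ η, fderiv ℝ (phaseInt L b g x) η (stdVec i) =
      phaseInt L (dirDeriv (freqVec i) b) g x η + (Complex.I * (x i : ℂ) * phaseInt L b g x η -
        Complex.I * phaseInt L b (fun y => (y i : ℂ) * g y) x η) := fun η => by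
    have h1 := (differentiable_phaseInt hs hσ hr.le hA L hb hg (x, η)).hasFDerivAt
    have h2 : HasFDerivAt (phaseInt L b g x) _ η := h1.comp η (hasFDerivAt_prodMk_right x η)
    rw [h2.fderiv]
    exact dirDeriv_freq_phaseInt hs hσ hr.le hA L hb hg i (x, η)
  have i3 : Integrable (fun η => Complex.I * (x i : ℂ) * phaseInt L b g x η -
      Complex.I * phaseInt L b (fun y => (y i : ℂ) * g y) x η) :=
    (i0.const_mul _).sub (i2.const_mul _)
  -- Integration by parts against the constant 1.
  have key := integral_mul_fderiv_eq_neg_fderiv_mul_of_integrable (μ := volume)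
    (f := fun _ : Eucl d => (1 : ℂ)) (g := phaseInt L b g x) (v := stdVec i) (by simp)
    (by simp only [one_mul, e]; exact i1.add i3) (by simpa using i0)
    (fun _ _ => differentiableAt_const _) (fun η _ => hdiff η)
  simp only [one_mul, e, fderiv_fun_const, Pi.zero_apply, zero_mul, integral_zero, neg_zero,
    zero_apply] at key
  rw [integral_add i1 i3, integral_sub (i0.const_mul _) (i2.const_mul _), integral_const_mul,
    integral_const_mul] at key
  change opInt L _ g x + (Complex.I * (x i : ℂ) * opInt L b g x - Complex.I * opInt L b _ x) = 0
    at key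
  have hI := Complex.I_mul_I
  linear_combination (-Complex.I) * key + ((x i : ℂ) * opInt L b g x -
    opInt L b (fun y => (y i : ℂ) * g y) x) * hI

/-- The monomials of the operator are controlled by the terms of the Leibniz formula. -/
theorem norm_monom_opInt_le (hs : 0 < s) (hσ : 0 < σ) (hr : 0 < r) (hA : Admissible s σ d)
    (L : Eucl d →L[ℝ] Eucl d) (x : Eucl d) (α : Fin d → ℕ) :
    ∀ (b : Eucl d × Eucl d → ℂ) (g : Eucl d → ℂ) (K : ℝ), IsSymbol s σ r b →
      g ∈ sigmaSubmodule s σ d →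
      (∀ α' α'' : Fin d → ℕ, α' + α'' = α →
        ‖opInt L (symDeriv 0 α' b) (fun y => (monom α'' y : ℂ) * g y) x‖ ≤ K) →
      |monom α x| * ‖opInt L b g x‖ ≤ 2 ^ len α * K := by
  induction α using multiIndex_induction with
  | h0 =>
    intro b g K hb hg h
    simpa using h 0 0 (by simp)
  | hs α i ih =>
    intro b g K hb hg h
    have h1 := ih b (fun y => (y i : ℂ) * g y) K hb (coord_mul_mem hs hσ hA hg i)
      fun α' α'' hα => by
        have := h α' (α'' + Pi.single i 1) (by rw [← add_assoc, hα])
        simpa only [monom_add_single, Complex.ofReal_mul, mul_assoc] using this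
    have h2 := ih (dirDeriv (freqVec i) b) g K (hb.dirDeriv_freq hs hσ i) hg fun α' α'' hα => by
        have := h (α' + Pi.single i 1) α'' (by rw [add_right_comm, hα])
        rwa [dirDeriv_freqVec _ hb.1, symDeriv_symDeriv _ _ _ _ hb.1, add_zero]
    have e : ‖opInt L b g x‖ * |x i| ≤ ‖opInt L b (fun y => (y i : ℂ) * g y) x‖ +
        ‖opInt L (dirDeriv (freqVec i) b) g x‖ := by
      have := congrArg norm (coord_mul_opInt hs hσ hr hA L hb hg i x)
      rw [norm_mul, Complex.norm_real, Real.norm_eq_abs] at this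
      rw [mul_comm, this]
      refine (norm_add_le _ _).trans ?_
      rw [norm_mul, Complex.norm_I, one_mul]
    rw [monom_add_single, abs_mul, len_add, len_single, pow_succ]
    calc |monom α x| * |x i| * ‖opInt L b g x‖ = |monom α x| * (‖opInt L b g x‖ * |x i|) := by ring
      _ ≤ |monom α x| * _ := mul_le_mul_of_nonneg_left e (abs_nonneg _)
      _ ≤ _ := by linarith

/-- The monomial is carried along as a fixed weight: derivatives are distributed first, and
`norm_monom_opInt_le` is then applied to each resulting term. -/
theorem norm_mderiv_opInt_le (hs : 0 < s) (hσ : 0 < σ) (hr : 0 < r) (hA : Admissible s σ d)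
    (L : Eucl d →L[ℝ] Eucl d) (x : Eucl d) (α β : Fin d → ℕ) :
    ∀ (b : Eucl d × Eucl d → ℂ) (g : Eucl d → ℂ) (K : ℝ), IsSymbol s σ r b →
      g ∈ sigmaSubmodule s σ d →
      (∀ β' β'' : Fin d → ℕ, β' + β'' = β →
        |monom α x| * ‖opInt L (symDeriv β' 0 b) (mderiv β'' g) x‖ ≤ K) →
      |monom α x| * ‖mderiv β (opInt L b g) x‖ ≤ 2 ^ len β * K := by
  simp only [mderiv_eq_multiDeriv]
  induction β using multiIndex_induction with
  | h0 =>
    intro b g K hb hg h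
    simpa using h 0 0 (by simp)
  | hs β i ih =>
    intro b g K hb hg h
    have hgi := dirDeriv_mem hs hσ hA hg i
    have hbi := hb.dirDeriv_pos hs hσ i
    have h1 := ih b (dirDeriv (stdVec i) g) K hb hgi fun β' β'' hβ => by
        rw [← multiDeriv_add_single' _ _ _ hg.1]
        exact h β' (β'' + Pi.single i 1) (by rw [← add_assoc, hβ])
    have h2 := ih (dirDeriv (posVec i) b) g K hbi hg fun β' β'' hβ => by
        have := h (β' + Pi.single i 1) β'' (by rw [add_right_comm, hβ])
        rwa [dirDeriv_posVec _ hb.1, symDeriv_symDeriv _ _ _ _ hb.1, add_zero]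
    have s1 := opInt_smooth hs hσ hr hA L hbi hg
    have s2 := opInt_smooth hs hσ hr hA L hb hgi
    rw [multiDeriv_add_single' _ _ _ (opInt_smooth hs hσ hr hA L hb hg),
      dirDeriv_opInt hs hσ hr hA L hb hg, multiDeriv_add _ _ s1 s2, len_add, len_single, pow_succ]
    have := mul_le_mul_of_nonneg_left (norm_add_le
      (multiDeriv stdVec β (opInt L (dirDeriv (posVec i) b) g) x)
      (multiDeriv stdVec β (opInt L b (dirDeriv (stdVec i) g)) x)) (abs_nonneg (monom α x))
    rw [Pi.add_apply]
    linarith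

/-- The operator with a fixed symbol is bounded on `Σ_s^σ`. -/
theorem exists_opInt_bound (hs : 0 < s) (hσ : 0 < σ) (hr : 0 < r) (hA : Admissible s σ d)
    (L : Eucl d →L[ℝ] Eucl d) {b : Eucl d × Eucl d → ℂ} (hb : IsSymbol s σ r b) {h₀ : ℝ}
    (hh₀ : 0 < h₀) :
    ∃ h : ℝ, 0 < h ∧ ∃ C : ℝ, 0 < C ∧ ∀ (f : SigmaSpace s σ d) (α β : Fin d → ℕ) (x : Eucl d),
      |monom α x| * ‖mderiv β (opInt L b f) x‖ ≤
        C * gsNorm s σ h f * (h₀ ^ (len α + len β) * mfact α ^ s * mfact β ^ σ) := by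
  set c := shearConst L s
  have hc : 0 < c := shearConst_pos L s
  obtain ⟨k, hk, -, hdec⟩ := exists_norm_exp_decay d hs (show 0 < r * c by positivity)
  have h2s : (1 : ℝ) ≤ 2 ^ s := Real.one_le_rpow (by norm_num) hs.le
  -- The 2 absorbs the number of terms 2^{|α|+|β|}, and 2^s absorbs the splitting of (γ+α)!^s.
  set h₁ := min h₀ k / (2 * 2 ^ s) with hh₁
  have hm : 0 < min h₀ k := lt_min hh₀ hk
  have hh₁0 : 0 < h₁ := by positivity
  obtain ⟨h, hh, C, hC, hb'⟩ := exists_phaseInt_bound hs hσ hr hA L hb hh₁0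
  set I₀ := ∫ y : Eucl d, Real.exp (-‖y‖ ^ (1 / σ))
  have hI₀ : 0 ≤ I₀ := integral_nonneg fun y => (Real.exp_pos _).le
  refine ⟨h, hh, 2 ^ s * (C * (I₀ + 1)), by positivity, fun f α β x => ?_⟩
  set N := gsNorm s σ h f
  have hN : 0 ≤ N := gsNorm_nonneg hh _
  have step : ∀ α : Fin d → ℕ, |monom α x| * ‖mderiv β (opInt L b f) x‖ ≤
      C * (I₀ + 1) * N * ((2 * h₁) ^ (len α + len β) * mfact α ^ s * mfact β ^ σ) *
        Real.exp (r * c * ‖x‖ ^ (1 / s)) := by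
    intro α
    have p1 := rpow_mfact_pos s α
    have p2 := rpow_mfact_pos σ β
    set K := C * (I₀ + 1) * N * (h₁ ^ (len α + len β) * mfact α ^ s * mfact β ^ σ) *
        Real.exp (r * c * ‖x‖ ^ (1 / s)) with hK
    have hmem : ∀ β'', mderiv β'' f ∈ sigmaSubmodule s σ d := fun β'' => by
      simpa using monom_mul_mderiv_mem hs hσ hA f 0 β''
    have := norm_mderiv_opInt_le hs hσ hr hA L x α β b f (2 ^ len α * K) hb f.2
      fun β' β'' hβ => ?_
    · refine this.trans (le_of_eq ?_)
      rw [hK, mul_pow, pow_add 2]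
      ring
    · refine norm_monom_opInt_le hs hσ hr hA L x α _ _ K (hb.symDeriv hs.le hσ.le _ _)
        (hmem β'') fun α' α'' hα => ?_
      rw [symDeriv_symDeriv _ _ _ _ hb.1, zero_add, add_zero]
      have q1 := rpow_mfact_mul_le hs.le α' α''
      have q2 := rpow_mfact_mul_le hσ.le β' β''
      rw [hα] at q1
      rw [hβ] at q2
      have q3 := rpow_mfact_pos s α'
      have q4 := rpow_mfact_pos s α''
      have q5 := rpow_mfact_pos σ β'
      have q6 := rpow_mfact_pos σ β''
      have hint : ‖opInt L (symDeriv β' α' b) (fun y => (monom α'' y : ℂ) * mderiv β'' f y) x‖ ≤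
          C * N * (h₁ ^ (len β' + len α' + len α'' + len β'') *
          (mfact α' ^ s * mfact α'' ^ s) * (mfact β' ^ σ * mfact β'' ^ σ)) *
          Real.exp (r * c * ‖x‖ ^ (1 / s)) * I₀ := by
        rw [← integral_const_mul]
        exact norm_integral_le_of_norm_le ((integrable_exp_neg_norm_rpow d hσ).const_mul _)
          (Filter.Eventually.of_forall fun η => hb' f β' α' α'' β'' x η)
      refine hint.trans ?_
      have e : len β' + len α' + len α'' + len β'' = len α + len β := by
        rw [← hα, ← hβ, len_add, len_add]; ring
      rw [e, hK]
      calc _ = C * N * I₀ * Real.exp (r * c * ‖x‖ ^ (1 / s)) * h₁ ^ (len α + len β) *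
          ((mfact α' ^ s * mfact α'' ^ s) * (mfact β' ^ σ * mfact β'' ^ σ)) := by ring
        _ ≤ C * N * (I₀ + 1) * Real.exp (r * c * ‖x‖ ^ (1 / s)) * h₁ ^ (len α + len β) *
          (mfact α ^ s * mfact β ^ σ) := by gcongr; linarith
        _ = _ := by ring
  have p1 := rpow_mfact_pos s α
  have p2 := rpow_mfact_pos σ β
  set K := C * (I₀ + 1) * N * (h₀ ^ (len α + len β) * mfact α ^ s * mfact β ^ σ) with hK
  -- Multiplication by the decaying exponential cancels the growth allowed by `step`. The moments of
  -- X are then small enough for decay of rate r·c, which undoes the multiplication.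
  set X := |monom α x| * ‖mderiv β (opInt L b f) x‖ * Real.exp (-(r * c * ‖x‖ ^ (1 / s))) with hX
  have hX0 : 0 ≤ X := by positivity
  have mom : ∀ γ : Fin d → ℕ, |monom γ x| * X ≤ K * k ^ len γ * mfact γ ^ s := by
    intro γ
    have p3 := rpow_mfact_pos s γ
    have h1 := step (γ + α)
    rw [monom_add, abs_mul, len_add] at h1
    have h2 : |monom γ x| * X ≤ C * (I₀ + 1) * N * ((2 * h₁) ^ (len γ + len α + len β) *
        mfact (γ + α) ^ s * mfact β ^ σ) := by
      rw [hX, Real.exp_neg, ← div_eq_mul_inv, ← mul_div_assoc, div_le_iff₀ (Real.exp_pos _)]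
      linarith
    refine h2.trans ?_
    have h3 := rpow_mfact_add_le hs.le γ α
    have h4 : ((2 : ℝ) ^ s) ^ (len γ + len α) ≤ (2 ^ s) ^ (len γ + len α + len β) :=
      pow_le_pow_right₀ h2s (by omega)
    have h5 : (2 * h₁ * 2 ^ s) ^ (len γ + len α + len β) ≤ k ^ len γ * h₀ ^ (len α + len β) := by
      have : 2 * h₁ * 2 ^ s = min h₀ k := by rw [hh₁]; field_simp
      rw [this, add_assoc, pow_add]
      gcongr
      · exact min_le_right _ _
      · exact min_le_left _ _
    calc _ ≤ C * (I₀ + 1) * N * ((2 * h₁) ^ (len γ + len α + len β) *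
        ((2 ^ s) ^ (len γ + len α + len β) * (mfact γ ^ s * mfact α ^ s)) * mfact β ^ σ) := by
          gcongr
          exact h3.trans (by gcongr)
      _ = C * (I₀ + 1) * N * ((2 * h₁ * 2 ^ s) ^ (len γ + len α + len β) *
        (mfact γ ^ s * mfact α ^ s) * mfact β ^ σ) := by rw [mul_pow (2 * h₁)]; ring
      _ ≤ C * (I₀ + 1) * N * ((k ^ len γ * h₀ ^ (len α + len β)) *
        (mfact γ ^ s * mfact α ^ s) * mfact β ^ σ) := by gcongr
      _ = _ := by rw [hK]; ring
  have := hdec x X K hX0 (by simpa using mom 0)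
    (fun j m => by simpa [abs_pow] using mom (Pi.single j m))
  rw [hX, mul_assoc, ← Real.exp_add, neg_add_cancel, Real.exp_zero, mul_one] at this
  refine this.trans (le_of_eq ?_)
  rw [hK]
  ring

theorem opInt_mem (hs : 0 < s) (hσ : 0 < σ) (hr : 0 < r) (hA : Admissible s σ d)
    (L : Eucl d →L[ℝ] Eucl d) {b : Eucl d × Eucl d → ℂ} (hb : IsSymbol s σ r b)
    (f : SigmaSpace s σ d) : opInt L b f ∈ sigmaSubmodule s σ d := by
  refine mem_sigmaSubmodule_of_bound (opInt_smooth hs hσ hr hA L hb f.2) fun h₀ hh₀ => ?_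
  obtain ⟨h, hh, C, hC, hbd⟩ := exists_opInt_bound hs hσ hr hA L hb hh₀
  exact ⟨_, hbd f⟩

/-! ### Linearity and continuity of the operator. -/

theorem phaseInt_add (hs : 0 < s) (hσ : 0 < σ) (hr : 0 ≤ r) (hA : Admissible s σ d)
    (L : Eucl d →L[ℝ] Eucl d) {b : Eucl d × Eucl d → ℂ} (hb : IsSymbol s σ r b)
    (f g : SigmaSpace s σ d) (x η : Eucl d) :
    phaseInt L b (f + g : SigmaSpace s σ d) x η = phaseInt L b f x η + phaseInt L b g x η := by
  refine Eq.trans ?_ (integral_add (integrable_phaseFun hs hσ hr hA L hb f.2 (x, η))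
    (integrable_phaseFun hs hσ hr hA L hb g.2 (x, η)))
  refine integral_congr_ae (Filter.Eventually.of_forall fun y => ?_)
  change _ * (f y + g y) * _ = _ * f y * _ + _ * g y * _
  ring

theorem phaseInt_smul (L : Eucl d →L[ℝ] Eucl d) (b : Eucl d × Eucl d → ℂ) (c : ℂ)
    (f : SigmaSpace s σ d) (x η : Eucl d) :
    phaseInt L b (c • f : SigmaSpace s σ d) x η = c * phaseInt L b f x η := by
  unfold phaseInt
  rw [← integral_const_mul]
  congr 1
  funext y
  change _ * (c * f y) * _ = _
  ring

/-- The linear map `f ↦ opInt L b f` on `Σ_s^σ`. -/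
def opLin (hs : 0 < s) (hσ : 0 < σ) (hr : 0 < r) (hA : Admissible s σ d)
    (L : Eucl d →L[ℝ] Eucl d) {b : Eucl d × Eucl d → ℂ} (hb : IsSymbol s σ r b) :
    SigmaSpace s σ d →ₗ[ℂ] SigmaSpace s σ d where
  toFun f := ⟨opInt L b f, opInt_mem hs hσ hr hA L hb f⟩
  map_add' f g := Subtype.ext <| funext fun x => by
    change opInt L b (f + g : SigmaSpace s σ d) x = opInt L b f x + opInt L b g x
    unfold opInt
    simp only [phaseInt_add hs hσ hr.le hA L hb]
    exact integral_add (integrable_phaseInt hs hσ hr hA L hb f.2 x)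
      (integrable_phaseInt hs hσ hr hA L hb g.2 x)
  map_smul' c f := Subtype.ext <| funext fun x => by
    change opInt L b (c • f : SigmaSpace s σ d) x = c * opInt L b f x
    unfold opInt
    simp only [phaseInt_smul]
    exact integral_const_mul _ _

/-- The continuous linear map `f ↦ opInt L b f` on `Σ_s^σ`. -/
def opCLM (hs : 0 < s) (hσ : 0 < σ) (hr : 0 < r) (hA : Admissible s σ d)
    (L : Eucl d →L[ℝ] Eucl d) {b : Eucl d × Eucl d → ℂ} (hb : IsSymbol s σ r b) :
    SigmaSpace s σ d →L[ℂ] SigmaSpace s σ d where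
  toLinearMap := opLin hs hσ hr hA L hb
  cont := by
    refine sigma_withSeminorms.continuous_of_isBounded sigma_withSeminorms
      (opLin hs hσ hr hA L hb) fun h₀ => ?_
    obtain ⟨h, hh, C, hC, hbd⟩ := exists_opInt_bound hs hσ hr hA L hb h₀.2
    refine ⟨{⟨h, hh⟩}, ⟨C, hC.le⟩, fun f => ?_⟩
    rw [Finset.sup_singleton]
    exact gsNorm_le_of_bound h₀.2 (hbd f)

end OpInt

/-! ### The kernel pairing -/

section Pairing

variable {s σ r : ℝ} {d : ℕ}

theorem integrable_of_exp_bound {ρ τ : ℝ} (hρ : 0 < ρ) (hτ : 0 < τ) {F : Eucl d × Eucl d → ℂ}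
    (hF : AEStronglyMeasurable F) {C : ℝ}
    (hb : ∀ p, ‖F p‖ ≤ C * (Real.exp (-‖p.1‖ ^ (1 / ρ)) * Real.exp (-‖p.2‖ ^ (1 / τ)))) :
    Integrable F :=
  (((integrable_exp_neg_norm_rpow d hρ).mul_prod (integrable_exp_neg_norm_rpow d hτ)).const_mul
    C).mono' hF (Filter.Eventually.of_forall hb)

/-- The function `∫ g(z + Lt) f(z + Lt - t) exp(i⟨t, ξ⟩) dt` on phase space. -/
def wignerInt (L : Eucl d →L[ℝ] Eucl d) (g f : Eucl d → ℂ) (p : Eucl d × Eucl d) : ℂ :=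
  oscInt g f L (L - ContinuousLinearMap.id ℝ (Eucl d)) p.1 p.1 p.2

theorem stronglyMeasurable_wignerInt (L : Eucl d →L[ℝ] Eucl d) {g f : Eucl d → ℂ}
    (hg : ContDiff ℝ ∞ g) (hf : ContDiff ℝ ∞ f) : StronglyMeasurable (wignerInt L g f) := by
  have h1 : Continuous (fun q : (Eucl d × Eucl d) × Eucl d => g (L q.2 + q.1.1)) :=
    hg.continuous.comp (by fun_prop)
  have h2 : Continuous (fun q : (Eucl d × Eucl d) × Eucl d =>
      f ((L - ContinuousLinearMap.id ℝ (Eucl d)) q.2 + q.1.1)) :=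
    hf.continuous.comp (by fun_prop)
  have h3 : Continuous (fun q : (Eucl d × Eucl d) × Eucl d => expInner q.1.2 q.2) :=
    (contDiff_expInner (contDiff_snd.comp contDiff_fst) contDiff_snd).continuous
  exact ((h1.mul h2).mul h3).stronglyMeasurable.integral_prod_right

/-- With x = Lt + z and y = x - t this recovers z, so that the shear estimates bound z and t by x
and y. -/
theorem add_sub_shear (L : Eucl d →L[ℝ] Eucl d) (z t : Eucl d) :
    (L t + z) - L ((L t + z) - ((L - ContinuousLinearMap.id ℝ (Eucl d)) t + z)) = z := by
  simp

/-- The constant is larger than necessary, so that this estimate and `shear_rpow_le` share it. -/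
theorem sub_rpow_le (hs : 0 < s) (L : Eucl d →L[ℝ] Eucl d) (x y : Eucl d) :
    ‖x - y‖ ^ (1 / s) ≤ shearConst L s * (‖x‖ ^ (1 / s) + ‖y‖ ^ (1 / s)) := by
  refine rpow_norm_le_of_le (by positivity) (by positivity) ?_
  have h3 := norm_sub_le x y
  have h4 := norm_nonneg L
  nlinarith [norm_nonneg y, norm_nonneg x]

theorem exists_wignerInt_bound (hs : 0 < s) (hσ : 0 < σ) (hA : Admissible s σ d)
    (L : Eucl d →L[ℝ] Eucl d) {g f : Eucl d → ℂ} (hg : g ∈ sigmaSubmodule s σ d)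
    (hf : f ∈ sigmaSubmodule s σ d) {R : ℝ} (hR : 0 < R) :
    ∃ C : ℝ, 0 ≤ C ∧ ∀ p, ‖wignerInt L g f p‖ ≤
      C * (Real.exp (-(R * ‖p.1‖ ^ (1 / s))) * Real.exp (-(R * ‖p.2‖ ^ (1 / σ)))) := by
  set c := shearConst L s
  have hc : 0 < c := shearConst_pos L s
  obtain ⟨k, hk, hdec⟩ := exists_oscInt_decay L (L - ContinuousLinearMap.id ℝ (Eucl d)) hσ hR
  -- Both R‖z‖^{1/s}, at cost cR, and ‖t‖^{1/s}, at cost c, are to be gained from the decay of g at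
  -- x and of f at y.
  obtain ⟨h, hh, C, hC, hb⟩ := exists_mderiv_monom_mderiv_exp_le (d := d) hs hσ hA
    (show 0 < c * (R + 1) by positivity) hk
  set Ng := gsNorm s σ h g
  set Nf := gsNorm s σ h f
  have hNg : 0 ≤ Ng := gsNorm_nonneg hh _
  have hNf : 0 ≤ Nf := gsNorm_nonneg hh _
  set I₀ := ∫ y : Eucl d, Real.exp (-‖y‖ ^ (1 / s))
  have hI₀ : 0 ≤ I₀ := integral_nonneg fun y => (Real.exp_pos _).le
  refine ⟨2 ^ σ * (C * Ng * (C * Nf) * I₀), by positivity, fun p => ?_⟩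
  obtain ⟨z, ξ⟩ := p
  have hbf : ∀ (u : Eucl d → ℂ) (hu : u ∈ sigmaSubmodule s σ d) (α : Fin d → ℕ) (x : Eucl d),
      ‖mderiv α u x‖ ≤ C * gsNorm s σ h u * (k ^ len α * mfact α ^ σ) *
        Real.exp (-(c * (R + 1) * ‖x‖ ^ (1 / s))) := by
    intro u hu α x
    have := hb ⟨u, hu⟩ 0 α 0 x
    simp only [monom_zero, Complex.ofReal_one, one_mul, mderiv_zero_index, len_zero, mfact_zero,
      Real.one_rpow, mul_one, zero_add, add_zero] at this
    rw [Real.exp_neg, ← div_eq_mul_inv, le_div_iff₀ (Real.exp_pos _)]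
    exact this
  have amp : ∀ (α β : Fin d → ℕ) (t : Eucl d),
      ‖mderiv α g (L t + z) * mderiv β f ((L - ContinuousLinearMap.id ℝ (Eucl d)) t + z)‖ ≤
        C * Ng * (C * Nf) * Real.exp (-(R * ‖z‖ ^ (1 / s))) *
          (k ^ (len α + len β) * (mfact α ^ σ * mfact β ^ σ)) * Real.exp (-‖t‖ ^ (1 / s)) := by
    intro α β t
    have p1 := rpow_mfact_pos σ α
    have p2 := rpow_mfact_pos σ β
    set x := L t + z with hx
    set y := (L - ContinuousLinearMap.id ℝ (Eucl d)) t + z with hy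
    have e1 := shear_rpow_le hs L x y
    rw [hx, hy, add_sub_shear, ← hx, ← hy] at e1
    have e2 := sub_rpow_le hs L x y
    have e3 : x - y = t := by rw [hx, hy]; simp
    rw [e3] at e2
    rw [norm_mul]
    calc _ ≤ (C * Ng * (k ^ len α * mfact α ^ σ) * Real.exp (-(c * (R + 1) * ‖x‖ ^ (1 / s)))) *
          (C * Nf * (k ^ len β * mfact β ^ σ) * Real.exp (-(c * (R + 1) * ‖y‖ ^ (1 / s)))) :=
          mul_le_mul (hbf g hg α x) (hbf f hf β y) (norm_nonneg _) (by positivity)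
      _ = C * Ng * (C * Nf) * (k ^ (len α + len β) * (mfact α ^ σ * mfact β ^ σ)) *
          Real.exp (-(c * (R + 1) * ‖x‖ ^ (1 / s)) + -(c * (R + 1) * ‖y‖ ^ (1 / s))) := by
          rw [Real.exp_add, pow_add]; ring
      _ ≤ C * Ng * (C * Nf) * (k ^ (len α + len β) * (mfact α ^ σ * mfact β ^ σ)) *
          Real.exp (-(R * ‖z‖ ^ (1 / s)) + -‖t‖ ^ (1 / s)) := by
          refine mul_le_mul_of_nonneg_left (Real.exp_le_exp.2 ?_) (by positivity)
          have e4 := mul_le_mul_of_nonneg_left e1 hR.le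
          change R * _ ≤ R * (c * _) at e4
          change _ ≤ c * _ at e2
          linarith
      _ = _ := by rw [Real.exp_add]; ring
  have key := hdec g f z z ξ (C * Ng * (C * Nf) * I₀ * Real.exp (-(R * ‖z‖ ^ (1 / s))))
    (by positivity) hg.1 hf.1 (fun α β => by
      refine ((integrable_exp_neg_norm_rpow d hs).const_mul _).mono' ?_
        (Filter.Eventually.of_forall (amp α β))
      have c1 : Continuous (mderiv α g) := (multiDeriv_smooth _ _ hg.1).continuous
      have c2 : Continuous (mderiv β f) := (multiDeriv_smooth _ _ hf.1).continuous
      exact ((c1.comp (by fun_prop)).mul (c2.comp (by fun_prop))).aestronglyMeasurable)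
    (fun α β => by
      have : ‖oscInt (mderiv α g) (mderiv β f) L (L - ContinuousLinearMap.id ℝ (Eucl d)) z z ξ‖ ≤
          C * Ng * (C * Nf) * Real.exp (-(R * ‖z‖ ^ (1 / s))) *
          (k ^ (len α + len β) * (mfact α ^ σ * mfact β ^ σ)) * I₀ := by
        rw [← integral_const_mul]
        refine norm_integral_le_of_norm_le ((integrable_exp_neg_norm_rpow d hs).const_mul _)
          (Filter.Eventually.of_forall fun t => ?_)
        rw [norm_mul, norm_expInner, mul_one]
        exact amp α β t
      refine this.trans (le_of_eq ?_)
      ring)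
  rw [← le_div_iff₀ (Real.exp_pos _), div_eq_mul_inv, ← Real.exp_neg] at key
  refine key.trans (le_of_eq ?_)
  ring

theorem integrable_symbol_mul_wignerInt (hs : 0 < s) (hσ : 0 < σ) (hr : 0 < r)
    (hA : Admissible s σ d) (L : Eucl d →L[ℝ] Eucl d) {b : Eucl d × Eucl d → ℂ}
    (hb : IsSymbol s σ r b) {g f : Eucl d → ℂ} (hg : g ∈ sigmaSubmodule s σ d)
    (hf : f ∈ sigmaSubmodule s σ d) : Integrable (fun p => b p * wignerInt L g f p) := by
  obtain ⟨K, hK, hb'⟩ := hb.exists_norm_le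
  obtain ⟨C, hC, hW⟩ := exists_wignerInt_bound hs hσ hA L hg hf (show 0 < r + 1 by positivity)
  refine integrable_of_exp_bound hs hσ (C := K * C)
    (hb.1.continuous.aestronglyMeasurable.mul
      (stronglyMeasurable_wignerInt L hg.1 hf.1).aestronglyMeasurable) fun p => ?_
  rw [norm_mul]
  calc _ ≤ (K * Real.exp (r * (‖p.1‖ ^ (1 / s) + ‖p.2‖ ^ (1 / σ)))) *
      (C * (Real.exp (-((r + 1) * ‖p.1‖ ^ (1 / s))) * Real.exp (-((r + 1) * ‖p.2‖ ^ (1 / σ))))) :=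
        mul_le_mul (hb' p) (hW p) (norm_nonneg _) (by positivity)
    _ = K * C * Real.exp (r * (‖p.1‖ ^ (1 / s) + ‖p.2‖ ^ (1 / σ)) +
        (-((r + 1) * ‖p.1‖ ^ (1 / s)) + -((r + 1) * ‖p.2‖ ^ (1 / σ)))) := by
        rw [Real.exp_add, Real.exp_add]; ring
    _ = _ := by
        rw [← Real.exp_add]
        congr 2
        ring

theorem exists_triple_bound (hs : 0 < s) (hσ : 0 < σ) (hr : 0 < r)
    (hA : Admissible s σ d) (L : Eucl d →L[ℝ] Eucl d) {b : Eucl d × Eucl d → ℂ}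
    (hb : IsSymbol s σ r b) {g f : Eucl d → ℂ} (hg : g ∈ sigmaSubmodule s σ d)
    (hf : f ∈ sigmaSubmodule s σ d) (η : Eucl d) :
    ∃ C : ℝ, 0 ≤ C ∧ ∀ x t, ‖b (x - L t, η)‖ * ‖f (x - t)‖ * ‖g x‖ ≤
      C * Real.exp (-‖x‖ ^ (1 / s) + -‖x - L t‖ ^ (1 / s) + -‖t‖ ^ (1 / s)) := by
  obtain ⟨K, hK, hb'⟩ := hb.exists_norm_le
  set c := shearConst L s
  have hc : 0 < c := shearConst_pos L s
  -- The rate pays for (r+1)‖x-Lt‖^{1/s}, of which r cancels the symbol, for ‖t‖^{1/s}, and for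
  -- ‖x‖^{1/s}. Decay in all three of x, x-Lt and t permits Fubini before and after the change of
  -- variables.
  set R := (r + 2) * c + 1 with hR
  have hR0 : 0 < R := by positivity
  obtain ⟨Kg, hKg, hg'⟩ := exists_norm_mul_exp_le hs hσ hA hg hR0
  obtain ⟨Kf, hKf, hf'⟩ := exists_norm_mul_exp_le hs hσ hA hf hR0
  refine ⟨K * Real.exp (r * ‖η‖ ^ (1 / σ)) * Kf * Kg, by positivity, fun x t => ?_⟩
  set y := x - t with hy
  have ht : t = x - y := by rw [hy]; abel
  have e1 := shear_rpow_le hs L x y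
  have e2 := sub_rpow_le hs L x y
  rw [← ht] at e1 e2
  have pX := Real.rpow_nonneg (norm_nonneg x) (1 / s)
  have pY := Real.rpow_nonneg (norm_nonneg y) (1 / s)
  have h1 : ‖f y‖ ≤ Kf * Real.exp (-(R * ‖y‖ ^ (1 / s))) := by
    rw [Real.exp_neg, ← div_eq_mul_inv, le_div_iff₀ (Real.exp_pos _)]; exact hf' y
  have h2 : ‖g x‖ ≤ Kg * Real.exp (-(R * ‖x‖ ^ (1 / s))) := by
    rw [Real.exp_neg, ← div_eq_mul_inv, le_div_iff₀ (Real.exp_pos _)]; exact hg' x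
  calc _ ≤ (K * Real.exp (r * (‖x - L t‖ ^ (1 / s) + ‖η‖ ^ (1 / σ)))) *
        (Kf * Real.exp (-(R * ‖y‖ ^ (1 / s)))) * (Kg * Real.exp (-(R * ‖x‖ ^ (1 / s)))) := by
        gcongr
        exact hb' _
    _ = K * Real.exp (r * ‖η‖ ^ (1 / σ)) * Kf * Kg * Real.exp (r * ‖x - L t‖ ^ (1 / s) +
        -(R * ‖y‖ ^ (1 / s)) + -(R * ‖x‖ ^ (1 / s))) := by
        rw [mul_add, Real.exp_add, Real.exp_add, Real.exp_add]; ring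
    _ ≤ _ := by
        refine mul_le_mul_of_nonneg_left (Real.exp_le_exp.2 ?_) (by positivity)
        have := mul_le_mul_of_nonneg_left e1 (show 0 ≤ r + 1 by positivity)
        rw [hR]
        change (r + 1) * _ ≤ (r + 1) * (c * _) at this
        change _ ≤ c * _ at e2
        nlinarith

theorem phaseInt_eq_sub (L : Eucl d →L[ℝ] Eucl d) (b : Eucl d × Eucl d → ℂ) (g : Eucl d → ℂ)
    (x η : Eucl d) :
    phaseInt L b g x η = ∫ t, b (x - L t, η) * g (x - t) * expInner η t := by
  unfold phaseInt
  rw [← integral_sub_left_eq_self _ volume x]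
  simp

theorem integral_phaseInt_mul (hs : 0 < s) (hσ : 0 < σ) (hr : 0 < r)
    (hA : Admissible s σ d) (L : Eucl d →L[ℝ] Eucl d) {b : Eucl d × Eucl d → ℂ}
    (hb : IsSymbol s σ r b) {g f : Eucl d → ℂ} (hg : g ∈ sigmaSubmodule s σ d)
    (hf : f ∈ sigmaSubmodule s σ d) (η : Eucl d) :
    ∫ x, phaseInt L b f x η * g x = ∫ z, b (z, η) * wignerInt L g f (z, η) := by
  obtain ⟨C, hC, hbd⟩ := exists_triple_bound hs hσ hr hA L hb hg hf η
  set G : Eucl d × Eucl d → ℂ := fun q =>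
    b (q.1 - L q.2, η) * f (q.1 - q.2) * expInner η q.2 * g q.1 with hG
  have hGc : Continuous G := by
    have c1 : Continuous (fun q : Eucl d × Eucl d => b (q.1 - L q.2, η)) :=
      hb.1.continuous.comp (by fun_prop)
    have c2 : Continuous (fun q : Eucl d × Eucl d => f (q.1 - q.2)) :=
      hf.1.continuous.comp (by fun_prop)
    exact ((c1.mul c2).mul ((expInner_smooth η).continuous.comp continuous_snd)).mul
      (hg.1.continuous.comp continuous_fst)
  have hGb : ∀ q, ‖G q‖ ≤
      C * Real.exp (-‖q.1‖ ^ (1 / s) + -‖q.1 - L q.2‖ ^ (1 / s) + -‖q.2‖ ^ (1 / s)) := fun q => by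
    rw [hG, norm_mul, norm_mul, norm_mul, norm_expInner, mul_one]
    exact hbd q.1 q.2
  have i1 : Integrable G := by
    refine integrable_of_exp_bound hs hs hGc.aestronglyMeasurable (C := C) fun q =>
      (hGb q).trans ?_
    rw [← Real.exp_add]
    gcongr
    have := Real.rpow_nonneg (norm_nonneg (q.1 - L q.2)) (1 / s)
    linarith
  have i2 : Integrable (fun q : Eucl d × Eucl d => G (L q.2 + q.1, q.2)) := by
    refine integrable_of_exp_bound hs hs
      (hGc.comp (by fun_prop)).aestronglyMeasurable (C := C) fun q => (hGb _).trans ?_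
    rw [← Real.exp_add]
    gcongr
    have := Real.rpow_nonneg (norm_nonneg (L q.2 + q.1)) (1 / s)
    simp only [add_sub_cancel_left]
    linarith
  calc ∫ x, phaseInt L b f x η * g x = ∫ x, ∫ t, G (x, t) := by
        congr 1
        funext x
        rw [phaseInt_eq_sub, ← integral_mul_const]
    _ = ∫ t, ∫ x, G (x, t) := integral_integral_swap i1
    -- For fixed t the substitution x = Lt + z is a translation, so no Jacobian occurs.
    _ = ∫ t, ∫ z, G (L t + z, t) := by
        congr 1
        funext t
        exact (integral_add_left_eq_self (fun x => G (x, t)) (L t)).symm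
    _ = ∫ z, ∫ t, G (L t + z, t) := (integral_integral_swap i2).symm
    _ = _ := by
        congr 1
        funext z
        rw [wignerInt, oscInt, ← integral_const_mul]
        congr 1
        funext t
        simp only [hG, add_sub_cancel_left]
        rw [show (L - ContinuousLinearMap.id ℝ (Eucl d)) t + z = L t + z - t by simp; abel]
        ring

/-- Absolute values may grow in η before the inner integration. Fubini is therefore used in stages:
η and x are exchanged with the y-integral already carried out, the other variables at fixed η, and z
and η at the end through the decay of `wignerInt`. -/
theorem integral_opInt_mul (hs : 0 < s) (hσ : 0 < σ) (hr : 0 < r)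
    (hA : Admissible s σ d) (L : Eucl d →L[ℝ] Eucl d) {b : Eucl d × Eucl d → ℂ}
    (hb : IsSymbol s σ r b) {g f : Eucl d → ℂ} (hg : g ∈ sigmaSubmodule s σ d)
    (hf : f ∈ sigmaSubmodule s σ d) :
    ∫ x, opInt L b f x * g x = ∫ p, b p * wignerInt L g f p := by
  obtain ⟨C, hC, hbd⟩ := exists_norm_phaseInt_le hs hσ hr hA L hb hf
  set c := shearConst L s
  have hc : 0 < c := shearConst_pos L s
  obtain ⟨Kg, hKg, hg'⟩ := exists_norm_mul_exp_le hs hσ hA hg (show 0 < r * c + 1 by positivity)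
  have hi : Integrable (fun p : Eucl d × Eucl d => phaseInt L b f p.1 p.2 * g p.1) := by
    refine integrable_of_exp_bound hs hσ (C := C * Kg)
      ((differentiable_phaseInt hs hσ hr.le hA L hb hf).continuous.mul
        (hg.1.continuous.comp continuous_fst)).aestronglyMeasurable fun p => ?_
    rw [norm_mul]
    have h2 : ‖g p.1‖ ≤ Kg * Real.exp (-((r * c + 1) * ‖p.1‖ ^ (1 / s))) := by
      rw [Real.exp_neg, ← div_eq_mul_inv, le_div_iff₀ (Real.exp_pos _)]; exact hg' _
    calc _ ≤ (C * Real.exp (r * c * ‖p.1‖ ^ (1 / s)) * Real.exp (-‖p.2‖ ^ (1 / σ))) *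
          (Kg * Real.exp (-((r * c + 1) * ‖p.1‖ ^ (1 / s)))) :=
          mul_le_mul (hbd _ _) h2 (norm_nonneg _) (by positivity)
      _ = C * Kg * (Real.exp (r * c * ‖p.1‖ ^ (1 / s) + -((r * c + 1) * ‖p.1‖ ^ (1 / s))) *
          Real.exp (-‖p.2‖ ^ (1 / σ))) := by rw [Real.exp_add]; ring
      _ = _ := by
          congr 3
          ring
  calc ∫ x, opInt L b f x * g x = ∫ x, ∫ η, phaseInt L b f x η * g x := by
        congr 1
        funext x
        rw [opInt, integral_mul_const]
    _ = ∫ η, ∫ x, phaseInt L b f x η * g x := integral_integral_swap hi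
    _ = ∫ η, ∫ z, b (z, η) * wignerInt L g f (z, η) := by
        congr 1
        funext η
        exact integral_phaseInt_mul hs hσ hr hA L hb hg hf η
    _ = _ := (integral_prod_symm _ (integrable_symbol_mul_wignerInt hs hσ hr hA L hb hg hf)).symm

/-- The substitution t ↦ -t exchanges the two arguments z + Lt and z + Lt - t once L is replaced by
I - L. -/
theorem wignerInt_transpose (L : Eucl d →L[ℝ] Eucl d) (g f : Eucl d → ℂ) (z ξ : Eucl d) :
    wignerInt L g f (z, -ξ) = wignerInt (ContinuousLinearMap.id ℝ (Eucl d) - L) f g (z, ξ) := by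
  unfold wignerInt oscInt
  rw [← integral_neg_eq_self]
  congr 1
  funext t
  rw [expInner_neg, neg_neg]
  simp only [map_neg]
  rw [show -(L - ContinuousLinearMap.id ℝ (Eucl d)) t + z = (ContinuousLinearMap.id ℝ (Eucl d) - L) t + z by
    simp, show -L t + z = (ContinuousLinearMap.id ℝ (Eucl d) - L - ContinuousLinearMap.id ℝ (Eucl d)) t + z by
    simp]
  ring

/-- The transpose of an operator is the operator with the reflected symbol and the complementary
shear. -/
theorem integral_opInt_mul_comm (hs : 0 < s) (hσ : 0 < σ) (hr : 0 < r)
    (hA : Admissible s σ d) (L : Eucl d →L[ℝ] Eucl d) {b : Eucl d × Eucl d → ℂ}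
    (hb : IsSymbol s σ r b) {g f : Eucl d → ℂ} (hg : g ∈ sigmaSubmodule s σ d)
    (hf : f ∈ sigmaSubmodule s σ d) :
    ∫ x, opInt L b f x * g x =
      ∫ x, opInt (ContinuousLinearMap.id ℝ (Eucl d) - L) (fun p => b (p.1, -p.2)) g x * f x := by
  rw [integral_opInt_mul hs hσ hr hA L hb hg hf,
    integral_opInt_mul hs hσ hr hA _ hb.reflect hf hg]
  have i1 := integrable_symbol_mul_wignerInt hs hσ hr hA L hb hg hf
  have i2 := integrable_symbol_mul_wignerInt hs hσ hr hA (ContinuousLinearMap.id ℝ (Eucl d) - L)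
    hb.reflect hf hg
  calc ∫ p, b p * wignerInt L g f p = ∫ ξ, ∫ z, b (z, ξ) * wignerInt L g f (z, ξ) :=
        integral_prod_symm _ i1
    _ = ∫ ξ, ∫ z, b (z, -ξ) * wignerInt L g f (z, -ξ) :=
        (integral_neg_eq_self (fun ξ => ∫ z, b (z, ξ) * wignerInt L g f (z, ξ)) volume).symm
    _ = ∫ ξ, ∫ z, b (z, -ξ) * wignerInt (ContinuousLinearMap.id ℝ (Eucl d) - L) f g (z, ξ) := by
        simp only [wignerInt_transpose]
    _ = _ := (integral_prod_symm _ i2).symm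

theorem kernelTest_tensor (A : Matrix (Fin d) (Fin d) ℝ) (g f : Eucl d → ℂ) (p : Eucl d × Eucl d) :
    kernelTest A (tensor g f) p = (((2 * Real.pi) ^ (-(d : ℝ) / 2) : ℝ) : ℂ) *
      wignerInt (LinearMap.toContinuousLinearMap A.toEuclideanLin) g f p := by
  unfold kernelTest invFourierSnd wignerInt oscInt
  congr 1
  congr 1
  funext t
  simp only [tensor, invShear, expInner]
  congr 3
  · simp [add_comm]
  · simp
    abel

end Pairing

/-! ### Bounded sets of `Σ_s^σ` are relatively compact -/

section Montel

open Filter Topology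

variable {s σ : ℝ} {d : ℕ}

theorem norm_sub_le_of_dirDeriv_le {u : Eucl d → ℂ} (hu : ContDiff ℝ ∞ u) {K : Fin d → ℝ}
    (hK : ∀ i x, ‖dirDeriv (stdVec i) u x‖ ≤ K i) (x y : Eucl d) :
    ‖u y - u x‖ ≤ (∑ i, K i) * ‖y - x‖ :=
  convex_univ.norm_image_sub_le_of_norm_fderiv_le (𝕜 := ℝ)
    (fun z _ => hu.differentiable (by simp) z)
    (fun z _ => (norm_clm_le _).trans (Finset.sum_le_sum fun i _ => hK i z))
    (Set.mem_univ x) (Set.mem_univ y)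

theorem norm_taylor_le {u : Eucl d → ℂ} (hu : ContDiff ℝ ∞ u) {K : Fin d → Fin d → ℝ}
    (hK : ∀ i j x, ‖dirDeriv (stdVec j) (dirDeriv (stdVec i) u) x‖ ≤ K i j) (x y : Eucl d) :
    ‖u y - u x - ∑ i, ((y - x) i : ℂ) * dirDeriv (stdVec i) u x‖ ≤
      (∑ i, ∑ j, K i j) * ‖y - x‖ * ‖y - x‖ := by
  have hφ : fderiv ℝ u x (y - x) = ∑ i, ((y - x) i : ℂ) * dirDeriv (stdVec i) u x := by
    conv_lhs => rw [clm_eq_sum (fderiv ℝ u x)]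
    simp [dirDeriv]
  rw [← hφ]
  have hK0 : 0 ≤ ∑ i, ∑ j, K i j := Finset.sum_nonneg fun i _ => Finset.sum_nonneg fun j _ =>
    (norm_nonneg _).trans (hK i j 0)
  refine (convex_closedBall x ‖y - x‖).norm_image_sub_le_of_norm_fderiv_le' (𝕜 := ℝ)
    (fun z _ => hu.differentiable (by simp) z) (fun z hz => ?_)
    (Metric.mem_closedBall_self (norm_nonneg _)) (by simp [dist_eq_norm])
  refine (norm_clm_le _).trans ?_
  rw [mem_closedBall_iff_norm] at hz
  calc _ ≤ ∑ i, (∑ j, K i j) * ‖z - x‖ := Finset.sum_le_sum fun i _ =>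
        norm_sub_le_of_dirDeriv_le (dirDeriv_smooth _ hu) (hK i) x z
    _ ≤ _ := by
        rw [← Finset.sum_mul]
        exact mul_le_mul_of_nonneg_left hz hK0

theorem mderiv_add_single {f : Eucl d → ℂ} (hf : ContDiff ℝ ∞ f) (α : Fin d → ℕ) (i : Fin d) :
    mderiv (α + Pi.single i 1) f = dirDeriv (stdVec i) (mderiv α f) :=
  multiDeriv_add_single stdVec α i hf

theorem mderiv_smooth {f : Eucl d → ℂ} (hf : ContDiff ℝ ∞ f) (α : Fin d → ℕ) :
    ContDiff ℝ ∞ (mderiv α f) :=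
  multiDeriv_smooth stdVec α hf

theorem mderiv_sub {f g : Eucl d → ℂ} (hf : ContDiff ℝ ∞ f) (hg : ContDiff ℝ ∞ g)
    (α : Fin d → ℕ) : mderiv α (f - g) = mderiv α f - mderiv α g := by
  have hg' : ContDiff ℝ ∞ ((-1 : ℂ) • g) := hg.const_smul (-1 : ℂ)
  rw [sub_eq_add_neg, ← neg_one_smul ℂ g, mderiv_add α hf hg', mderiv_smul α _ hg, neg_one_smul, sub_eq_add_neg]

/-- Pointwise limits of all derivatives of a family with uniformly bounded derivatives. -/
theorem smooth_of_tendsto_mderiv {l : Filter (SigmaSpace s σ d)} [l.NeBot]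
    {F : (Fin d → ℕ) → Eucl d → ℂ}
    (hF : ∀ β x, Tendsto (fun g : SigmaSpace s σ d => mderiv β g x) l (𝓝 (F β x)))
    {K : (Fin d → ℕ) → ℝ}
    (hK : ∀ᶠ g : SigmaSpace s σ d in l, ∀ β x, ‖mderiv β g x‖ ≤ K β) :
    ContDiff ℝ ∞ (F 0) ∧ ∀ β, mderiv β (F 0) = F β := by
  -- The second-order Taylor estimate has a constant uniform in g, so it passes to the pointwise
  -- limit. It identifies the partial derivatives of F β as the functions F (β + e_i).
  have taylor : ∀ β x y, ‖F β y - F β x - ∑ i, ((y - x) i : ℂ) * F (β + Pi.single i 1) x‖ ≤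
      (∑ i, ∑ j, K (β + Pi.single i 1 + Pi.single j 1)) * ‖y - x‖ * ‖y - x‖ := by
    intro β x y
    refine le_of_tendsto (((hF β y).sub (hF β x)).sub
      (tendsto_finsetSum _ fun i _ => (hF (β + Pi.single i 1) x).const_mul _)).norm ?_
    filter_upwards [hK] with g hg
    simp only [mderiv_add_single g.smooth]
    refine norm_taylor_le (mderiv_smooth g.smooth β) (fun i j z => ?_) x y
    rw [← mderiv_add_single g.smooth, ← mderiv_add_single g.smooth]
    exact hg _ z
  have deriv : ∀ β x, HasFDerivAt (F β) (∑ i, (EuclideanSpace.proj i : Eucl d →L[ℝ] ℝ).smulRight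
      (F (β + Pi.single i 1) x)) x := by
    intro β x
    rw [hasFDerivAt_iff_isLittleO]
    have h1 : (fun y => F β y - F β x - (∑ i, (EuclideanSpace.proj i : Eucl d →L[ℝ] ℝ).smulRight
        (F (β + Pi.single i 1) x)) (y - x)) =O[𝓝 x] fun y => ‖y - x‖ * ‖y - x‖ := by
      refine Asymptotics.IsBigO.of_bound
        (∑ i, ∑ j, K (β + Pi.single i 1 + Pi.single j 1)) (Eventually.of_forall fun y => ?_)
      rw [norm_mul, norm_norm, ← mul_assoc]
      refine le_trans (le_of_eq ?_) (taylor β x y)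
      simp
    refine h1.trans_isLittleO ?_
    have h2 : Tendsto (fun y => ‖y - x‖) (𝓝 x) (𝓝 0) := by
      have : Continuous fun y : Eucl d => ‖y - x‖ := by fun_prop
      simpa using this.tendsto x
    have h3 := ((Asymptotics.isLittleO_one_iff ℝ).2 h2).mul_isBigO
      (Asymptotics.isBigO_refl (fun y => ‖y - x‖) (𝓝 x))
    simp only [one_mul] at h3
    exact h3.of_norm_right
  have dd : ∀ β i, dirDeriv (stdVec i) (F β) = F (β + Pi.single i 1) := by
    intro β i
    funext x
    rw [dirDeriv, (deriv β x).fderiv]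
    simp [stdVec]
  have sm : ∀ n : ℕ, ∀ β, ContDiff ℝ n (F β) := by
    intro n
    induction n with
    | zero =>
      intro β
      exact contDiff_zero.2 (continuous_iff_continuousAt.2 fun x => (deriv β x).continuousAt)
    | succ n ih =>
      intro β
      refine contDiff_succ_of_dirDeriv (fun x => (deriv β x).differentiableAt) fun i => ?_
      rw [dd]
      exact ih _
  have sm0 : ContDiff ℝ ∞ (F 0) := contDiff_infty.2 fun n => sm n 0
  refine ⟨sm0, fun β => ?_⟩
  induction β using multiIndex_induction with
  | h0 => exact mderiv_zero_index _
  | hs α i ih => rw [mderiv_add_single sm0, ih, dd]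

/-- The set of all `f` such that `‖f‖_h ≤ M h` for every `h > 0`. -/
def sigmaBall (s σ : ℝ) (d : ℕ) (M : ℝ → ℝ) : Set (SigmaSpace s σ d) :=
  {f | ∀ h : ℝ, 0 < h → gsNorm s σ h f ≤ M h}

theorem sigmaBall_bound {M : ℝ → ℝ} {f : SigmaSpace s σ d} (hf : f ∈ sigmaBall s σ d M) {h : ℝ}
    (hh : 0 < h) (α β : Fin d → ℕ) (x : Eucl d) :
    |monom α x| * ‖mderiv β f x‖ ≤ M h * (h ^ (len α + len β) * mfact α ^ s * mfact β ^ σ) :=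
  (monom_mderiv_le f hh α β x).trans
    (mul_le_mul_of_nonneg_right (hf h hh) (gsDen_pos s σ hh α β).le)

theorem gsNorm_sub_le (f g : SigmaSpace s σ d) {h : ℝ} (hh : 0 < h) :
    gsNorm s σ h (f - g : SigmaSpace s σ d) ≤ gsNorm s σ h f + gsNorm s σ h g :=
  map_sub_le_add (sigmaSeminorm s σ d ⟨h, hh⟩) f g

theorem finite_len_le (N : ℕ) : {α : Fin d → ℕ | len α ≤ N}.Finite := by
  refine (Set.Finite.pi' (t := fun _ : Fin d => {n : ℕ | n ≤ N})
    fun _ => Set.finite_le_nat N).subset fun α hα i => ?_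
  exact (Finset.single_le_sum (f := α) (fun _ _ => Nat.zero_le _) (Finset.mem_univ i)).trans hα

/-- In a bounded set, pointwise convergence to `0` implies the uniform convergence of
`x^α ∂^β f`. -/
theorem eventually_monom_mderiv_le {l : Filter (SigmaSpace s σ d)} {M : ℝ → ℝ}
    (hM : ∀ᶠ g in l, g ∈ sigmaBall s σ d M) {β : Fin d → ℕ}
    (h0 : ∀ x, Tendsto (fun g : SigmaSpace s σ d => mderiv β g x) l (𝓝 0)) (α : Fin d → ℕ) {ε : ℝ}
    (hε : 0 < ε) : ∀ᶠ g : SigmaSpace s σ d in l, ∀ x, |monom α x| * ‖mderiv β g x‖ ≤ ε := by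
  set k : Fin d → ℝ := fun i => M 1 * (mfact (α + Pi.single i 1) ^ s * mfact β ^ σ)
  set Λ : Fin d → ℝ := fun i => M 1 * (mfact (β + Pi.single i 1) ^ σ)
  -- Outside the ball of radius R, one more power of ‖x‖ gives the bound ε by itself.
  set R := |∑ i, k i| / ε + 1 with hR
  have hR0 : 0 < R := by positivity
  obtain ⟨P, hP⟩ := (isCompact_closedBall (0 : Eucl d) R).exists_bound_of_continuousOn
    (monom_smooth α).continuous.continuousOn
  set P' := |P| + 1
  have hP' : 0 < P' := by positivity
  set L := |∑ i, Λ i| + 1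
  have hL : 0 < L := by positivity
  -- Inside the ball, the uniform Lipschitz bound L reduces the claim to finitely many centres; half
  -- of ε is spent on the Lipschitz error and half on the values at the centres.
  obtain ⟨t, -, ht, hcov⟩ := (isCompact_closedBall (0 : Eucl d) R).finite_cover_balls
    (show 0 < ε / (2 * P' * L) by positivity)
  have hev : ∀ᶠ g : SigmaSpace s σ d in l, ∀ c ∈ t, ‖mderiv β g c‖ < ε / (2 * P') := by
    refine (Set.Finite.eventually_all ht).2 fun c _ => ?_
    have := (h0 c).norm
    rw [norm_zero] at this
    exact this.eventually_lt_const (by positivity)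
  filter_upwards [hM, hev] with g hg hgt x
  rcases le_or_gt ‖x‖ R with hx | hx
  · have hx' : x ∈ Metric.closedBall (0 : Eucl d) R := by simpa using hx
    obtain ⟨c, hc, hxc⟩ := Set.mem_iUnion₂.1 (hcov hx')
    have h1 : |monom α x| ≤ P' := by
      have := hP x hx'
      rw [Complex.norm_real, Real.norm_eq_abs] at this
      linarith [le_abs_self P]
    have h2 : ‖mderiv β g x - mderiv β g c‖ ≤ (∑ i, Λ i) * ‖x - c‖ := by
      refine norm_sub_le_of_dirDeriv_le (mderiv_smooth g.smooth β) (fun i z => ?_) c x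
      rw [← mderiv_add_single g.smooth]
      simpa using sigmaBall_bound hg one_pos 0 (β + Pi.single i 1) z
    have h3 : (∑ i, Λ i) * ‖x - c‖ ≤ L * (ε / (2 * P' * L)) := by
      rw [Metric.mem_ball, dist_eq_norm] at hxc
      refine mul_le_mul ?_ hxc.le (norm_nonneg _) hL.le
      linarith [le_abs_self (∑ i, Λ i)]
    have h4 : L * (ε / (2 * P' * L)) = ε / (2 * P') := by field_simp
    have h5 : ‖mderiv β g x‖ ≤ ε / (2 * P') + ε / (2 * P') := by
      calc ‖mderiv β g x‖ = ‖(mderiv β g x - mderiv β g c) + mderiv β g c‖ := by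
            rw [sub_add_cancel]
        _ ≤ _ := (norm_add_le _ _).trans (add_le_add (by linarith) (hgt c hc).le)
    calc |monom α x| * ‖mderiv β g x‖ ≤ P' * (ε / (2 * P') + ε / (2 * P')) :=
          mul_le_mul h1 h5 (norm_nonneg _) hP'.le
      _ = ε := by field_simp; ring
  · have h1 : ‖x‖ * (|monom α x| * ‖mderiv β g x‖) ≤ ∑ i, k i := by
      calc _ ≤ (∑ i, |x i|) * (|monom α x| * ‖mderiv β g x‖) :=
            mul_le_mul_of_nonneg_right (norm_le_sum_abs x) (by positivity)
        _ ≤ _ := by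
            rw [Finset.sum_mul]
            refine Finset.sum_le_sum fun i _ => ?_
            have := sigmaBall_bound hg one_pos (α + Pi.single i 1) β x
            rw [monom_add_single, abs_mul] at this
            simp only [one_pow, one_mul] at this
            calc _ = |monom α x| * |x i| * ‖mderiv β g x‖ := by ring
              _ ≤ _ := this
    have h2 : R * (|monom α x| * ‖mderiv β g x‖) ≤ |∑ i, k i| :=
      (mul_le_mul_of_nonneg_right hx.le (by positivity)).trans (h1.trans (le_abs_self _))
    have h3 : |∑ i, k i| ≤ R * ε := by
      rw [hR, add_mul, div_mul_cancel₀ _ hε.ne']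
      linarith
    exact le_of_mul_le_mul_left (h2.trans h3) hR0

theorem tendsto_gsNorm_zero {l : Filter (SigmaSpace s σ d)} {M : ℝ → ℝ}
    (hM : ∀ᶠ g in l, g ∈ sigmaBall s σ d M)
    (h0 : ∀ β x, Tendsto (fun g : SigmaSpace s σ d => mderiv β g x) l (𝓝 0)) {h ε : ℝ}
    (hh : 0 < h) (hε : 0 < ε) : ∀ᶠ g : SigmaSpace s σ d in l, gsNorm s σ h g ≤ ε := by
  -- The bound with h/2 in place of h gains 2^{-(|α|+|β|)}, which settles all but finitely many
  -- pairs of multi-indices.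
  obtain ⟨N, hN⟩ : ∃ N : ℕ, |M (h / 2)| * (1 / 2 : ℝ) ^ N < ε := by
    obtain ⟨N, hN⟩ := exists_pow_lt_of_lt_one (show 0 < ε / (|M (h / 2)| + 1) by positivity)
      (show (1 / 2 : ℝ) < 1 by norm_num)
    refine ⟨N, ?_⟩
    rw [lt_div_iff₀ (by positivity)] at hN
    have : 0 ≤ (1 / 2 : ℝ) ^ N := by positivity
    nlinarith
  have hev : ∀ᶠ g : SigmaSpace s σ d in l, ∀ α ∈ {α : Fin d → ℕ | len α ≤ N},
      ∀ β ∈ {α : Fin d → ℕ | len α ≤ N}, ∀ x, |monom α x| * ‖mderiv β g x‖ ≤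
        ε * (h ^ (len α + len β) * mfact α ^ s * mfact β ^ σ) :=
    (Set.Finite.eventually_all (finite_len_le N)).2 fun α _ =>
      (Set.Finite.eventually_all (finite_len_le N)).2 fun β _ =>
        eventually_monom_mderiv_le hM (h0 β) α (mul_pos hε (gsDen_pos s σ hh α β))
  filter_upwards [hM, hev] with g hg hgN
  refine gsNorm_le_of_bound hh fun α β x => ?_
  by_cases hαβ : len α ≤ N ∧ len β ≤ N
  · exact hgN α hαβ.1 β hαβ.2 x
  · have hlen : N ≤ len α + len β := by
      by_contra hcon
      exact hαβ ⟨by omega, by omega⟩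
    refine (sigmaBall_bound hg (half_pos hh) α β x).trans ?_
    have e : M (h / 2) * ((h / 2) ^ (len α + len β) * mfact α ^ s * mfact β ^ σ) =
        (M (h / 2) * (1 / 2 : ℝ) ^ (len α + len β)) *
          (h ^ (len α + len β) * mfact α ^ s * mfact β ^ σ) := by
      rw [div_eq_mul_one_div h 2, mul_pow]; ring
    rw [e]
    refine mul_le_mul_of_nonneg_right ?_ (gsDen_pos s σ hh α β).le
    refine le_trans ?_ hN.le
    exact mul_le_mul (le_abs_self _) (pow_le_pow_of_le_one (by norm_num) (by norm_num) hlen)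
      (by positivity) (abs_nonneg _)

theorem isCompact_sigmaBall (M : ℝ → ℝ) : IsCompact (sigmaBall s σ d M) := by
  rw [isCompact_iff_ultrafilter_le_nhds']
  intro l hl
  have hl' : ∀ᶠ g in (l : Filter (SigmaSpace s σ d)), g ∈ sigmaBall s σ d M := hl
  -- Each value ∂^βg(x) stays in a fixed closed disc, so it converges along the ultrafilter without
  -- passing to a subsequence.
  have hex : ∀ β x, ∃ w : ℂ, Tendsto (fun g : SigmaSpace s σ d => mderiv β g x) l (𝓝 w) := by
    intro β x
    have hc := isCompact_closedBall (0 : ℂ) (M 1 * mfact β ^ σ)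
    obtain ⟨w, -, hw⟩ := hc.ultrafilter_le_nhds' (l.map fun g : SigmaSpace s σ d => mderiv β g x) (by
      rw [Ultrafilter.mem_map]
      filter_upwards [hl'] with g hg
      simpa using sigmaBall_bound hg one_pos 0 β x)
    exact ⟨w, hw⟩
  choose F hF using hex
  obtain ⟨hsm, hder⟩ := smooth_of_tendsto_mderiv hF (K := fun β => M 1 * mfact β ^ σ) (by
    filter_upwards [hl'] with g hg β x
    simpa using sigmaBall_bound hg one_pos 0 β x)
  have hbound : ∀ h : ℝ, 0 < h → ∀ (α β : Fin d → ℕ) (x : Eucl d),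
      |monom α x| * ‖mderiv β (F 0) x‖ ≤
        M h * (h ^ (len α + len β) * mfact α ^ s * mfact β ^ σ) := by
    intro h hh α β x
    rw [hder]
    refine le_of_tendsto ((hF β x).norm.const_mul _) ?_
    filter_upwards [hl'] with g hg
    exact sigmaBall_bound hg hh α β x
  have hmem : F 0 ∈ sigmaSubmodule s σ d :=
    mem_sigmaSubmodule_of_bound hsm fun h hh => ⟨M h, hbound h hh⟩
  set f : SigmaSpace s σ d := ⟨F 0, hmem⟩ with hf
  have hfM : f ∈ sigmaBall s σ d M := fun h hh => gsNorm_le_of_bound hh (hbound h hh)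
  refine ⟨f, hfM, ?_⟩
  change Tendsto (fun g => g) (l : Filter (SigmaSpace s σ d)) (𝓝 f)
  rw [sigma_withSeminorms.tendsto_nhds]
  rintro ⟨h, hh⟩ ε hε
  -- The differences g - f remain in a set of the same type, hence their pointwise convergence
  -- implies convergence in every norm.
  have h1 : ∀ᶠ g in (l : Filter (SigmaSpace s σ d)).map (fun g => g - f),
      g ∈ sigmaBall s σ d (fun h => M h + M h) := by
    rw [eventually_map]
    filter_upwards [hl'] with g hg h hh
    exact (gsNorm_sub_le g f hh).trans (add_le_add (hg h hh) (hfM h hh))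
  have h2 : ∀ β x, Tendsto (fun g : SigmaSpace s σ d => mderiv β g x)
      ((l : Filter (SigmaSpace s σ d)).map (fun g => g - f)) (𝓝 0) := by
    intro β x
    rw [tendsto_map'_iff]
    have := (hF β x).sub_const (F β x)
    rw [sub_self] at this
    refine this.congr fun g => ?_
    have e : mderiv β (g - f : SigmaSpace s σ d) = mderiv β g - mderiv β f :=
      mderiv_sub g.smooth f.smooth β
    change _ = mderiv β (g - f : SigmaSpace s σ d) x
    rw [e, Pi.sub_apply]
    congr 1
    exact (congrFun (hder β) x).symm
  have h3 := tendsto_gsNorm_zero h1 h2 hh (half_pos hε)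
  rw [eventually_map] at h3
  filter_upwards [h3] with g hg
  change gsNorm s σ h (g - f : SigmaSpace s σ d) < ε
  linarith

end Montel

/-! ### Reflexivity of `Σ_s^σ` and the density of the inclusion into the dual space -/

section Density

open Filter Topology

variable {s σ : ℝ} {d : ℕ}

theorem zero_mem_sigmaBall {M : ℝ → ℝ} (hM : ∀ h, 0 < h → 0 ≤ M h) :
    (0 : SigmaSpace s σ d) ∈ sigmaBall s σ d M := fun h hh => by
  have : gsNorm s σ h (0 : SigmaSpace s σ d) = 0 := map_zero (sigmaSeminorm s σ d ⟨h, hh⟩)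
  rw [this]
  exact hM h hh

theorem smul_mem_sigmaBall {M : ℝ → ℝ} {f : SigmaSpace s σ d} (hf : f ∈ sigmaBall s σ d M) {c : ℂ}
    (hc : ‖c‖ ≤ 1) : c • f ∈ sigmaBall s σ d M := fun h hh => by
  have e : gsNorm s σ h (c • f : SigmaSpace s σ d) = ‖c‖ * gsNorm s σ h f :=
    map_smul_eq_mul (sigmaSeminorm s σ d ⟨h, hh⟩) c f
  have := gsNorm_nonneg (s := s) (σ := σ) hh (f : Eucl d → ℂ)
  rw [e]
  exact (mul_le_of_le_one_left this hc).trans (hf h hh)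

theorem combo_mem_sigmaBall {M : ℝ → ℝ} {f g : SigmaSpace s σ d} (hf : f ∈ sigmaBall s σ d M)
    (hg : g ∈ sigmaBall s σ d M) {a b : ℝ} (ha : 0 ≤ a) (hb : 0 ≤ b) (hab : a + b = 1) :
    (a : ℂ) • f + (b : ℂ) • g ∈ sigmaBall s σ d M := fun h hh => by
  set p := sigmaSeminorm s σ d ⟨h, hh⟩
  change p ((a : ℂ) • f + (b : ℂ) • g) ≤ M h
  refine (map_add_le_add p _ _).trans ?_
  rw [map_smul_eq_mul, map_smul_eq_mul, Complex.norm_real, Complex.norm_real,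
    Real.norm_of_nonneg ha, Real.norm_of_nonneg hb]
  calc _ ≤ a * M h + b * M h := add_le_add (mul_le_mul_of_nonneg_left (hf h hh) ha)
        (mul_le_mul_of_nonneg_left (hg h hh) hb)
    _ = M h := by rw [← add_mul, hab, one_mul]

/-- A continuous functional on the strong dual space is bounded by the supremum over some
`sigmaBall`. -/
theorem exists_sigmaBall_dominating (ℓ : SigmaDual s σ d →L[ℂ] ℂ) :
    ∃ M : ℝ → ℝ, (∀ h, 0 < h → 0 ≤ M h) ∧ ∀ (u : SigmaDual s σ d) (C : ℝ), 0 < C →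
      (∀ g ∈ sigmaBall s σ d M, ‖u g‖ ≤ C) → ‖ℓ u‖ ≤ C := by
  have h1 : ∀ᶠ u in 𝓝 (0 : SigmaDual s σ d), ‖ℓ u‖ < 1 := by
    have := ℓ.continuous.norm.tendsto 0
    rw [map_zero, norm_zero] at this
    exact this.eventually_lt_const one_pos
  -- A basic neighbourhood in the strong dual consists of the u with |u| ≤ ε on a bounded set B. The
  -- norms of B, divided by ε, define M.
  obtain ⟨⟨B, ε⟩, ⟨hB, hε⟩, hsub⟩ :=
    (ContinuousLinearMap.hasBasis_nhds_zero_of_basis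
      (Metric.nhds_basis_closedBall (x := (0 : ℂ)))).mem_iff.1 h1
  rw [sigma_withSeminorms.isVonNBounded_iff_seminorm_bounded] at hB
  simp only at hε hB hsub
  choose N hN0 hN using hB
  refine ⟨fun h => if hh : 0 < h then N ⟨h, hh⟩ / ε else 0, fun h hh => ?_, fun u C hC hu => ?_⟩
  · simp only [dif_pos hh]
    exact (div_pos (hN0 _) hε).le
  · have hmem : (C⁻¹ : ℂ) • u ∈ {f : SigmaDual s σ d | ∀ x ∈ B, f x ∈ Metric.closedBall 0 ε} := by
      intro x hx
      have hxM : ((ε : ℂ)⁻¹ • x) ∈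
          sigmaBall s σ d (fun h => if hh : 0 < h then N ⟨h, hh⟩ / ε else 0) := by
        intro h hh
        refine le_of_le_of_eq ?_ (dif_pos hh).symm
        have e : gsNorm s σ h ((ε : ℂ)⁻¹ • x : SigmaSpace s σ d) =
            ‖(ε : ℂ)⁻¹‖ * sigmaSeminorm s σ d ⟨h, hh⟩ x :=
          map_smul_eq_mul (sigmaSeminorm s σ d ⟨h, hh⟩) _ x
        rw [e, norm_inv, Complex.norm_real, Real.norm_of_nonneg hε.le, div_eq_inv_mul]
        exact mul_le_mul_of_nonneg_left (hN ⟨h, hh⟩ x hx).le (by positivity)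
      have h2 := hu _ hxM
      rw [map_smul, norm_smul, norm_inv, Complex.norm_real, Real.norm_of_nonneg hε.le,
        inv_mul_le_iff₀ hε] at h2
      rw [mem_closedBall_zero_iff]
      change ‖(C⁻¹ : ℂ) • u x‖ ≤ ε
      rw [norm_smul, norm_inv, Complex.norm_real, Real.norm_of_nonneg hC.le, inv_mul_le_iff₀ hC]
      linarith
    have h3 : ‖ℓ ((C⁻¹ : ℂ) • u)‖ < 1 := hsub hmem
    rw [map_smul, norm_smul, norm_inv, Complex.norm_real, Real.norm_of_nonneg hC.le,
      inv_mul_lt_iff₀ hC, mul_one] at h3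
    exact h3.le

/-- The ball is compact, convex and balanced, and so is its image in the finite-dimensional space of
values. If (ℓ u) lay outside, a separating functional would be a combination v of the given u,
bounded by r on the ball but with Re ℓ v > r, against the domination of ℓ. -/
theorem exists_mem_sigmaBall_eval_eq {M : ℝ → ℝ} (hM : ∀ h, 0 < h → 0 ≤ M h)
    {ℓ : SigmaDual s σ d →L[ℂ] ℂ} (hℓ : ∀ (u : SigmaDual s σ d) (C : ℝ), 0 < C →
      (∀ g ∈ sigmaBall s σ d M, ‖u g‖ ≤ C) → ‖ℓ u‖ ≤ C) (t : Finset (SigmaDual s σ d)) :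
    ∃ g ∈ sigmaBall s σ d M, ∀ u ∈ t, u g = ℓ u := by
  set Φ : SigmaSpace s σ d → (t → ℂ) := fun g u => u.1 g with hΦ
  have hΦc : Continuous Φ := continuous_pi fun u => u.1.continuous
  have hΦconv : Convex ℝ (Φ '' sigmaBall s σ d M) := by
    rintro _ ⟨f, hf, rfl⟩ _ ⟨g, hg, rfl⟩ a b ha hb hab
    refine ⟨_, combo_mem_sigmaBall hf hg ha hb hab, ?_⟩
    funext u
    simp [hΦ]
  by_cases hmem : (fun u : t => ℓ u.1) ∈ Φ '' sigmaBall s σ d M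
  · obtain ⟨g, hg, he⟩ := hmem
    exact ⟨g, hg, fun u hu => congrFun he ⟨u, hu⟩⟩
  exfalso
  classical
  obtain ⟨θ, r, hr, hr'⟩ := RCLike.geometric_hahn_banach_closed_point (𝕜 := ℂ) hΦconv
    ((isCompact_sigmaBall M).image hΦc).isClosed hmem
  set v : SigmaDual s σ d := ∑ u : t, θ (Pi.single u 1) • u.1 with hv
  have hθ : ∀ w : t → ℂ, θ w = ∑ u, θ (Pi.single u 1) * w u := by
    intro w
    conv_lhs => rw [← Finset.univ_sum_single w]
    rw [map_sum]
    refine Finset.sum_congr rfl fun u _ => ?_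
    have : (Pi.single u (w u) : t → ℂ) = w u • Pi.single u 1 := by
      rw [← Pi.single_smul, smul_eq_mul, mul_one]
    rw [this, map_smul, smul_eq_mul, mul_comm]
  have hvg : ∀ g : SigmaSpace s σ d, v g = θ (Φ g) := by
    intro g
    rw [hθ, hv]
    simp [hΦ]
  have hvℓ : ℓ v = θ fun u => ℓ u.1 := by
    rw [hθ, hv]
    simp
  have hr0 : 0 < r := by
    have := hr _ ⟨0, zero_mem_sigmaBall hM, rfl⟩
    rw [← hvg] at this
    simpa using this
  have hbound : ∀ g ∈ sigmaBall s σ d M, ‖v g‖ ≤ r := by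
    intro g hg
    -- Balancedness allows g to be rotated until v g is real, which turns the bound on the real part
    -- into one on the modulus.
    obtain ⟨c, hc, hc'⟩ := RCLike.exists_norm_eq_mul_self (v g)
    have := hr _ ⟨c • g, smul_mem_sigmaBall hg hc.le, rfl⟩
    rw [← hvg, map_smul, smul_eq_mul, ← hc'] at this
    simpa using this.le
  have h1 := hℓ v r hr0 hbound
  rw [← hvℓ] at hr'
  exact absurd (hr'.trans_le ((RCLike.re_le_norm _).trans h1)) (lt_irrefl _)

/-- Continuous functionals on the strong dual space of `Σ_s^σ` are evaluations. -/
theorem exists_eval_eq (ℓ : SigmaDual s σ d →L[ℂ] ℂ) :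
    ∃ g : SigmaSpace s σ d, ∀ u : SigmaDual s σ d, ℓ u = u g := by
  obtain ⟨M, hM, hℓ⟩ := exists_sigmaBall_dominating ℓ
  -- The finite intersection property yields one g that serves all functionals u.
  obtain ⟨g, -, hg⟩ := (isCompact_sigmaBall (s := s) (σ := σ) (d := d) M).inter_iInter_nonempty
    (fun u : SigmaDual s σ d => {g | u g = ℓ u})
    (fun u => isClosed_eq u.continuous continuous_const) fun t => by
      obtain ⟨g, hg, hgt⟩ := exists_mem_sigmaBall_eval_eq hM hℓ t
      exact ⟨g, hg, Set.mem_iInter₂.2 hgt⟩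
  exact ⟨g, fun u => (Set.mem_iInter.1 hg u).symm⟩

/-! ### Conjugation, and the density of functions in the dual space. -/

theorem mderiv_conj {f : Eucl d → ℂ} (hf : ContDiff ℝ ∞ f) (β : Fin d → ℕ) :
    mderiv β (fun x => starRingEnd ℂ (f x)) = fun x => starRingEnd ℂ (mderiv β f x) := by
  have sm : ∀ {u : Eucl d → ℂ}, ContDiff ℝ ∞ u → ContDiff ℝ ∞ (fun x => starRingEnd ℂ (u x)) :=
    fun hu => Complex.conjCLE.contDiff.comp hu
  induction β using multiIndex_induction with
  | h0 => simp [mderiv_zero_index]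
  | hs α i ih =>
    rw [mderiv_add_single (sm hf), mderiv_add_single hf, ih]
    funext x
    have h1 : HasFDerivAt (mderiv α f) (fderiv ℝ (mderiv α f) x) x :=
      ((mderiv_smooth hf α).differentiable (by simp) x).hasFDerivAt
    have h2 := (Complex.conjCLE.toContinuousLinearMap.hasFDerivAt (x := mderiv α f x)).comp x h1
    have h3 : fderiv ℝ (fun x => starRingEnd ℂ (mderiv α f x)) x = _ := h2.fderiv
    rw [dirDeriv, h3]
    rfl

theorem conj_mem {f : Eucl d → ℂ} (hf : f ∈ sigmaSubmodule s σ d) :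
    (fun x => starRingEnd ℂ (f x)) ∈ sigmaSubmodule s σ d := by
  refine mem_sigmaSubmodule_of_bound (Complex.conjCLE.contDiff.comp hf.1) fun h hh =>
    ⟨gsNorm s σ h f, fun α β y => ?_⟩
  rw [mderiv_conj hf.1, RCLike.norm_conj]
  exact monom_mderiv_le ⟨f, hf⟩ hh α β y

theorem eq_zero_of_toDual_eq_zero {g : SigmaSpace s σ d}
    (h : ∀ f : SigmaSpace s σ d, toDual f g = 0) : g = 0 := by
  have h1 : ∫ x, starRingEnd ℂ (g x) * g x = 0 := h ⟨_, conj_mem g.2⟩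
  have h2 : ∀ x, starRingEnd ℂ (g x) * g x = ((‖g x‖ ^ 2 : ℝ) : ℂ) := fun x => by
    rw [← Complex.normSq_eq_conj_mul_self, Complex.normSq_eq_norm_sq]
  have h0 := SigmaSpace.integrable_mul ⟨_, conj_mem g.2⟩ g
  simp only [h2] at h1
  rw [integral_complex_ofReal, Complex.ofReal_eq_zero] at h1
  have hi : Integrable (fun x => ‖g x‖ ^ 2) := by
    refine h0.norm.congr (Eventually.of_forall fun x => ?_)
    change ‖starRingEnd ℂ (g x) * g x‖ = ‖g x‖ ^ 2
    rw [norm_mul, RCLike.norm_conj, sq]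
  have hc : Continuous (fun x => ‖g x‖ ^ 2) := g.smooth.continuous.norm.pow 2
  have h3 := (integral_eq_zero_iff_of_nonneg (fun x => by positivity) hi).1 h1
  have h4 := (hc.ae_eq_iff_eq volume continuous_const).1 h3
  refine Subtype.ext (funext fun x => ?_)
  have h5 : ‖g x‖ ^ 2 = 0 := congrFun h4 x
  exact norm_eq_zero.1 (pow_eq_zero_iff two_ne_zero |>.1 h5)

theorem toDual_comm (f g : SigmaSpace s σ d) : toDual f g = toDual g f :=
  integral_congr_ae (Eventually.of_forall fun x => mul_comm (f x) (g x))

/-- The inclusion of `Σ_s^σ` into its dual space as a linear map. -/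
def toDualLin (s σ : ℝ) (d : ℕ) : SigmaSpace s σ d →ₗ[ℂ] SigmaDual s σ d where
  toFun := toDual
  map_add' f g := by
    ext u
    rw [toDual_comm, map_add, toDual_comm u f, toDual_comm u g]
    rfl
  map_smul' c f := by
    ext u
    rw [toDual_comm, map_smul, toDual_comm u f]
    rfl

theorem denseRange_toDual : DenseRange (toDual : SigmaSpace s σ d → SigmaDual s σ d) := by
  intro u
  by_contra hu
  set S : Submodule ℂ (SigmaDual s σ d) := (LinearMap.range (toDualLin s σ d)).topologicalClosure
  have hS : closure (Set.range (toDual : SigmaSpace s σ d → SigmaDual s σ d)) = S := rfl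
  rw [hS] at hu
  have hconv : Convex ℝ (S : Set (SigmaDual s σ d)) := (S.restrictScalars ℝ).convex
  obtain ⟨θ, r, hr, hr'⟩ := RCLike.geometric_hahn_banach_closed_point (𝕜 := ℂ) hconv
    (Submodule.isClosed_topologicalClosure _) hu
  obtain ⟨g, hg⟩ := exists_eval_eq θ
  have hr0 : 0 < r := by simpa using hr 0 S.zero_mem
  have hz : ∀ f : SigmaSpace s σ d, toDual f g = 0 := by
    intro f
    by_contra hne
    -- On a subspace, a functional with real part below r must vanish: otherwise some multiple takes
    -- the value r.
    have hmem : ((r : ℂ) / toDual f g) • toDual f ∈ S :=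
      S.smul_mem _ (Submodule.le_topologicalClosure _ ⟨f, rfl⟩)
    have := hr _ hmem
    rw [map_smul, hg, smul_eq_mul, div_mul_cancel₀ _ hne] at this
    simp at this
  rw [hg, eq_zero_of_toDual_eq_zero hz, map_zero] at hr'
  simp at hr'
  linarith

end Density

/-! ### The main theorem in the non-trivial case -/

theorem exists_continuous_extension_of_admissible {d : ℕ} (A : Matrix (Fin d) (Fin d) ℝ) {s σ : ℝ}
    (hs : 0 < s) (hσ : 0 < σ) (hA : Admissible s σ d) {a : Eucl d × Eucl d → ℂ}
    (ha : a ∈ GammaZero s σ σ s d) :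
    (∀ f g : SigmaSpace s σ d, Integrable (fun p => a p * kernelTest A (tensor g f) p)) ∧
    ∃ T : SigmaSpace s σ d →L[ℂ] SigmaSpace s σ d,
      (∀ f g : SigmaSpace s σ d, toDual (T f) g = Op A a f g) ∧
      ∃ T' : SigmaDual s σ d →L[ℂ] SigmaDual s σ d,
        (∀ f : SigmaSpace s σ d, T' (toDual f) = toDual (T f)) ∧
        ∀ G : SigmaDual s σ d → SigmaDual s σ d, Continuous G →
          (∀ f : SigmaSpace s σ d, G (toDual f) = toDual (T f)) → G = T' := by
  obtain ⟨r, hr, hb⟩ := exists_isSymbol_of_mem_GammaZero ha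
  set L := LinearMap.toContinuousLinearMap A.toEuclideanLin
  -- One factor comes from the partial Fourier transform and one from the kernel, so c·c =
  -- (2π)^{-d}.
  set c : ℂ := (((2 * Real.pi) ^ (-(d : ℝ) / 2) : ℝ) : ℂ) with hc
  have hk : ∀ f g : SigmaSpace s σ d, (fun p => a p * kernelTest A (tensor g f) p) =
      fun p => c * (a p * wignerInt L g f p) := fun f g => funext fun p => by
    rw [kernelTest_tensor, mul_left_comm]
  set T₀ := opCLM hs hσ hr hA L hb
  set T₁ := opCLM hs hσ hr hA (ContinuousLinearMap.id ℝ (Eucl d) - L) hb.reflect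
  have hpair : ∀ f g : SigmaSpace s σ d, toDual (((c * c) • T₀) f) g =
      (c * c) * ∫ x, opInt L a f x * g x := fun f g => by
    rw [toDual_comm, smul_apply, map_smul, toDual_comm, smul_eq_mul]
    rfl
  -- The extension is the adjoint of the transposed operator T₁; on functions it agrees with T₀, up
  -- to the common scalar, by `integral_opInt_mul_comm`.
  have hext : ∀ f : SigmaSpace s σ d, ContinuousLinearMap.precomp ℂ ((c * c) • T₁) (toDual f) =
      toDual (((c * c) • T₀) f) := fun f => by
    ext g
    rw [hpair, integral_opInt_mul_comm hs hσ hr hA L hb g.2 f.2]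
    change toDual f ((c * c) • T₁ g) = _
    rw [map_smul, toDual_comm]
    rfl
  refine ⟨fun f g => ?_, (c * c) • T₀, fun f g => ?_,
    ContinuousLinearMap.precomp ℂ ((c * c) • T₁), hext, fun G hG hGT => ?_⟩
  · rw [hk]
    exact (integrable_symbol_mul_wignerInt hs hσ hr hA L hb g.2 f.2).const_mul c
  · rw [hpair, integral_opInt_mul hs hσ hr hA L hb g.2 f.2, Op, kernelPairing, hk,
      integral_const_mul, mul_assoc]
  · refine denseRange_toDual.equalizer hG (ContinuousLinearMap.continuous _) (funext fun f => ?_)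
    exact (hGT f).trans (hext f).symm

theorem exists_continuous_extension_of_subsingleton {d : ℕ} (A : Matrix (Fin d) (Fin d) ℝ) {s σ : ℝ}
    [Subsingleton (SigmaSpace s σ d)] (a : Eucl d × Eucl d → ℂ) :
    (∀ f g : SigmaSpace s σ d, Integrable (fun p => a p * kernelTest A (tensor g f) p)) ∧
    ∃ T : SigmaSpace s σ d →L[ℂ] SigmaSpace s σ d,
      (∀ f g : SigmaSpace s σ d, toDual (T f) g = Op A a f g) ∧
      ∃ T' : SigmaDual s σ d →L[ℂ] SigmaDual s σ d,
        (∀ f : SigmaSpace s σ d, T' (toDual f) = toDual (T f)) ∧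
        ∀ G : SigmaDual s σ d → SigmaDual s σ d, Continuous G →
          (∀ f : SigmaSpace s σ d, G (toDual f) = toDual (T f)) → G = T' := by
  have hz : ∀ (f : SigmaSpace s σ d) (x : Eucl d), f x = 0 := fun f x =>
    congrFun (congrArg Subtype.val (Subsingleton.elim f 0)) x
  have hk : ∀ (f g : SigmaSpace s σ d) p, a p * kernelTest A (tensor g f) p = 0 := fun f g p => by
    simp [kernelTest, invFourierSnd, tensor, hz]
  have hu : ∀ u v : SigmaDual s σ d, u = v := fun u v =>
    ContinuousLinearMap.ext fun g => by rw [Subsingleton.elim g 0, map_zero, map_zero]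
  refine ⟨fun f g => by simp [hk], 0, fun f g => ?_, 0, fun f => hu _ _, fun G _ _ =>
    funext fun u => hu _ _⟩
  rw [Op, kernelPairing]
  simp only [hk]
  rw [Subsingleton.elim g 0, map_zero]
  simp

/-! ### Triviality of `Σ_s^σ` for `s + σ = 1` -/

section Trivial

open Filter Topology

/-- An entire function of order `1 / s` with small type that decays fast on the positive half line
vanishes at the origin. -/
theorem entire_eq_zero_of_decay {s : ℝ} (hs : 0 < s) {F : ℂ → ℂ} (hF : Differentiable ℂ F)
    {C : ℝ} (hC : ∀ z, ‖F z‖ ≤ C * Real.exp (1 / 2 * ‖z‖ ^ (1 / s))) {D : ℝ}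
    (hD : ∀ᶠ t : ℝ in atTop, ‖F t‖ ≤ D * Real.exp (-(2 * t ^ (1 / s)))) : F 0 = 0 := by
  -- After ζ ↦ ζ^p the order 1/s becomes 3/2. It lies below 2, as Phragmén-Lindelöf in a half-plane
  -- requires, and above 1, so that ζ^{3/2} has negative real part on the imaginary axis away from
  -- 0.
  set p : ℝ := 3 * s / 2 with hp
  have hp0 : 0 < p := by positivity
  have hps : p * (1 / s) = 3 / 2 := by rw [hp]; field_simp
  have hC0 : 0 ≤ C := by
    have h1 := (norm_nonneg _).trans (hC 0)
    exact nonneg_of_mul_nonneg_left h1 (Real.exp_pos _)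
  -- The exponential factor restores boundedness on the imaginary axis, while on the positive axis
  -- it uses up only half of the decay e^{-2x^{3/2}}.
  set H : ℂ → ℂ := fun ζ => F (ζ ^ (p : ℂ)) * Complex.exp (ζ ^ ((3 / 2 : ℝ) : ℂ)) with hH
  have hnorm : ∀ ζ : ℂ, ‖H ζ‖ ≤ C * Real.exp (1 / 2 * ‖ζ‖ ^ (3 / 2 : ℝ) +
      (ζ ^ ((3 / 2 : ℝ) : ℂ)).re) := by
    intro ζ
    rw [hH, norm_mul, Complex.norm_exp, Real.exp_add, ← mul_assoc]
    refine mul_le_mul_of_nonneg_right ?_ (Real.exp_pos _).le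
    have := hC (ζ ^ (p : ℂ))
    rwa [Complex.norm_cpow_real, ← Real.rpow_mul (norm_nonneg _), hps] at this
  have hcont : ∀ {q : ℝ}, 0 < q → DiffContOnCl ℂ (fun ζ : ℂ => ζ ^ (q : ℂ)) {z | 0 < z.re} := by
    intro q hq
    refine ⟨fun z hz => ?_, fun z hz => ?_⟩
    · exact ((differentiableAt_id.cpow_const (Or.inl hz)).differentiableWithinAt :
        DifferentiableWithinAt ℂ (fun ζ : ℂ => ζ ^ (q : ℂ)) _ z)
    · rw [Complex.closure_setOfPred_lt_re] at hz
      exact (Complex.continuousAt_cpow_const_of_re_pos (Or.inl hz) (by simpa)).continuousWithinAt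
  have hd : DiffContOnCl ℂ H {z | 0 < z.re} :=
    (hF.comp_diffContOnCl (hcont hp0)).smul
      (Complex.differentiable_exp.comp_diffContOnCl (hcont (by norm_num)))
  have hgrowth : ∃ c < (2 : ℝ), ∃ B, H =O[Bornology.cobounded ℂ ⊓ 𝓟 {z | 0 < z.re}]
      fun z => Real.exp (B * ‖z‖ ^ c) := by
    refine ⟨3 / 2, by norm_num, 3 / 2, Asymptotics.IsBigO.of_bound C (Eventually.of_forall
      fun z => (hnorm z).trans ?_)⟩
    rw [Real.norm_of_nonneg (Real.exp_pos _).le]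
    refine mul_le_mul_of_nonneg_left (Real.exp_le_exp.2 ?_) hC0
    have := Complex.re_le_norm (z ^ ((3 / 2 : ℝ) : ℂ))
    rw [Complex.norm_cpow_real] at this
    linarith
  have him : ∃ K, ∀ x : ℝ, ‖H (x * Complex.I)‖ ≤ K := by
    refine ⟨C, fun x => (hnorm _).trans (mul_le_of_le_one_right hC0 (Real.exp_le_one_iff.2 ?_))⟩
    rcases eq_or_ne x 0 with rfl | hx
    · simp
    have hx' : 0 ≤ ‖(x : ℂ) * Complex.I‖ ^ (3 / 2 : ℝ) := Real.rpow_nonneg (norm_nonneg _) _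
    -- The argument of ζ^{3/2} is ±3π/4 there, and its cosine -1/√2 outweighs the type 1/2 of F.
    have hcos : Real.cos (Complex.arg ((x : ℂ) * Complex.I) * (3 / 2)) ≤ -(1 / 2) := by
      have h34 : Real.cos (Real.pi / 2 * (3 / 2)) ≤ -(1 / 2) := by
        rw [show Real.pi / 2 * (3 / 2) = Real.pi - Real.pi / 4 by ring, Real.cos_pi_sub,
          Real.cos_pi_div_four]
        have : (1 : ℝ) ≤ √2 := Real.one_le_sqrt.2 (by norm_num)
        linarith
      rcases lt_or_gt_of_ne hx with h | h
      · have e : Complex.arg ((x : ℂ) * Complex.I) = -(Real.pi / 2) := by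
          rw [show (x : ℂ) * Complex.I = ((-x : ℝ) : ℂ) * -Complex.I by push_cast; ring,
            Complex.arg_real_mul _ (neg_pos.2 h), Complex.arg_neg_I]
        rw [e, neg_mul, Real.cos_neg]
        exact h34
      · rw [Complex.arg_real_mul _ h, Complex.arg_I]
        exact h34
    rw [Complex.cpow_ofReal_re]
    nlinarith
  have hre : Asymptotics.SuperpolynomialDecay atTop Real.exp fun x : ℝ => ‖H x‖ := by
    intro n
    have hlim : Tendsto (fun x : ℝ => |D| * Real.exp (n * x - x ^ (3 / 2 : ℝ))) atTop (𝓝 0) := by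
      rw [← mul_zero |D|]
      refine (Real.tendsto_exp_atBot.comp ?_).const_mul _
      have h1 : Tendsto (fun x : ℝ => x * (n - x ^ (1 / 2 : ℝ))) atTop atBot :=
        tendsto_id.atTop_mul_atBot₀ (tendsto_atBot_add_const_left _ _
          (tendsto_neg_atTop_atBot.comp (tendsto_rpow_atTop (by norm_num))))
      refine h1.congr' ?_
      filter_upwards [eventually_gt_atTop 0] with x hx
      rw [show (3 / 2 : ℝ) = 1 + 1 / 2 by norm_num, Real.rpow_add hx, Real.rpow_one]
      ring
    refine squeeze_zero' (Eventually.of_forall fun x => by positivity) ?_ hlim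
    filter_upwards [(tendsto_rpow_atTop hp0).eventually hD, eventually_gt_atTop 0] with x hx hx0
    have e1 : (x : ℂ) ^ (p : ℂ) = ((x ^ p : ℝ) : ℂ) := (Complex.ofReal_cpow hx0.le p).symm
    have e2 : (x : ℂ) ^ ((3 / 2 : ℝ) : ℂ) = ((x ^ (3 / 2 : ℝ) : ℝ) : ℂ) :=
      (Complex.ofReal_cpow hx0.le _).symm
    rw [← Real.rpow_mul hx0.le, hps] at hx
    simp only [hH, e1, e2]
    rw [norm_mul, Complex.norm_exp, Complex.ofReal_re, ← Real.exp_nat_mul]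
    calc _ ≤ Real.exp (n * x) * (|D| * Real.exp (-(2 * x ^ (3 / 2 : ℝ))) *
          Real.exp (x ^ (3 / 2 : ℝ))) := by
          gcongr
          exact hx.trans (mul_le_mul_of_nonneg_right (le_abs_self D) (Real.exp_pos _).le)
      _ = |D| * Real.exp (n * x + (-(2 * x ^ (3 / 2 : ℝ)) + x ^ (3 / 2 : ℝ))) := by
          rw [Real.exp_add, Real.exp_add]; ring
      _ = _ := by
          congr 2
          ring
  have h0 := PhragmenLindelof.eq_zero_on_right_half_plane_of_superexponential_decay hd hgrowth hre
    him (show (0 : ℂ) ∈ {z : ℂ | 0 ≤ z.re} by simp)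
  simpa [hH, Complex.zero_cpow, hp0.ne'] using h0

/-! ### Entire extension of functions along a line. -/

theorem pow_le_exp_mul_factorial_rpow {s x : ℝ} (hs : 0 < s) (hx : 0 ≤ x) (m : ℕ) :
    x ^ m ≤ Real.exp (s * x ^ (1 / s)) * (m ! : ℝ) ^ s := by
  have h1 := Real.pow_div_factorial_le_exp (x ^ (1 / s)) (by positivity) m
  rw [div_le_iff₀ (by positivity)] at h1
  have h2 := Real.rpow_le_rpow (by positivity) h1 hs.le
  rw [Real.mul_rpow (by positivity) (by positivity), ← Real.exp_mul, mul_comm _ s,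
    ← Real.rpow_natCast, ← Real.rpow_mul hx, ← Real.rpow_mul hx] at h2
  rwa [show 1 / s * (m : ℝ) * s = m by field_simp, Real.rpow_natCast] at h2

/-- The bound of the terms of a Taylor series with coefficients of Gevrey growth `1 - s`. -/
theorem norm_taylor_term_le {s h N x : ℝ} (hs : 0 < s) (hh : 0 < h) (hN : 0 ≤ N) (hx : 0 ≤ x)
    {w : ℂ} {m : ℕ} (hw : ‖w‖ ≤ N * h ^ m * (m ! : ℝ) ^ (1 - s)) :
    ‖w‖ / m ! * x ^ m ≤ N * Real.exp (s * (2 * h * x) ^ (1 / s)) * (1 / 2) ^ m := by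
  have hf : (0 : ℝ) < (m ! : ℝ) := by positivity
  have h1 := pow_le_exp_mul_factorial_rpow hs (show 0 ≤ 2 * h * x by positivity) m
  have e : (m ! : ℝ) ^ (1 - s) = m ! / (m ! : ℝ) ^ s := by rw [Real.rpow_sub hf, Real.rpow_one]
  have hfs : (0 : ℝ) < (m ! : ℝ) ^ s := Real.rpow_pos_of_pos hf s
  calc ‖w‖ / m ! * x ^ m ≤ N * h ^ m * (m ! : ℝ) ^ (1 - s) / m ! * x ^ m := by gcongr
    _ = N * ((2 * h * x) ^ m / (m ! : ℝ) ^ s) * (1 / 2) ^ m := by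
        rw [e, mul_pow, mul_pow, one_div, inv_pow]
        field_simp
    _ ≤ _ := by
        gcongr
        rwa [div_le_iff₀ hfs]

/-- A Taylor series with coefficients of Gevrey growth `1 - s` defines an entire function. -/
theorem exists_entire_of_bound {s h N : ℝ} (hs : 0 < s) (hh : 0 < h) (hN : 0 ≤ N) {c : ℕ → ℂ}
    (hc : ∀ m, ‖c m‖ ≤ N * h ^ m * (m ! : ℝ) ^ (1 - s)) :
    ∃ F : ℂ → ℂ, Differentiable ℂ F ∧ (∀ z, HasSum (fun m => c m / m ! * z ^ m) (F z)) ∧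
      ∀ z, ‖F z‖ ≤ 2 * N * Real.exp (s * (2 * h * ‖z‖) ^ (1 / s)) := by
  have hterm : ∀ (z : ℂ) m, ‖c m / m ! * z ^ m‖ ≤
      N * Real.exp (s * (2 * h * ‖z‖) ^ (1 / s)) * (1 / 2) ^ m := fun z m => by
    rw [norm_mul, norm_div, Complex.norm_natCast, norm_pow]
    exact norm_taylor_term_le hs hh hN (norm_nonneg z) (hc m)
  have hsum : ∀ K : ℝ, HasSum (fun m : ℕ => K * (1 / 2 : ℝ) ^ m) (K * 2) := fun K =>
    hasSum_geometric_two.mul_left K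
  have hsm : ∀ z, Summable (fun m => c m / m ! * z ^ m) := fun z =>
    Summable.of_norm_bounded (hsum _).summable (hterm z)
  refine ⟨fun z => ∑' m, c m / m ! * z ^ m, fun z => ?_, fun z => (hsm z).hasSum, fun z => ?_⟩
  · have hd : DifferentiableOn ℂ (fun z => ∑' m, c m / m ! * z ^ m) (Metric.ball 0 (‖z‖ + 1)) := by
      refine Complex.differentiableOn_tsum_of_summable_norm
        (hsum (N * Real.exp (s * (2 * h * (‖z‖ + 1)) ^ (1 / s)))).summable
        (fun m => by fun_prop) Metric.isOpen_ball fun m w hw => (hterm w m).trans ?_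
      have hw' : ‖w‖ ≤ ‖z‖ + 1 := (mem_ball_zero_iff.1 hw).le
      gcongr
    exact (hd z (by simp)).differentiableAt (Metric.isOpen_ball.mem_nhds (by simp))
  · refine (tsum_of_norm_bounded (hsum _) (hterm z)).trans (le_of_eq ?_)
    ring

/-- Taylor's formula for functions of Gevrey growth `1 - s`. -/
theorem hasSum_taylor_of_bound {s h N : ℝ} (hs : 0 < s) (hh : 0 < h) (hN : 0 ≤ N)
    {c : ℕ → ℝ → ℂ} (hd : ∀ m t, HasDerivAt (c m) (c (m + 1) t) t)
    (hc : ∀ m t, ‖c m t‖ ≤ N * h ^ m * (m ! : ℝ) ^ (1 - s)) {T : ℝ} (hT : 0 < T) {v : ℂ}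
    (hv : HasSum (fun m => c m 0 / m ! * (T : ℂ) ^ m) v) : c 0 T = v := by
  have hiter : ∀ m, iteratedDeriv m (c 0) = c m := by
    intro m
    induction m with
    | zero => exact iteratedDeriv_zero
    | succ m ih =>
      rw [iteratedDeriv_succ, ih]
      exact funext fun t => (hd m t).deriv
  have hsm : ContDiff ℝ ∞ (c 0) := contDiff_of_differentiable_iteratedDeriv fun m _ => by
    rw [hiter]
    exact fun t => (hd m t).differentiableAt
  have hwithin : ∀ m, ∀ t ∈ Set.Icc 0 T, iteratedDerivWithin m (c 0) (Set.Icc 0 T) t = c m t := by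
    intro m t ht
    rw [iteratedDerivWithin_eq_iteratedDeriv (uniqueDiffOn_Icc hT)
      (hsm.contDiffAt.of_le (by exact_mod_cast le_top)) ht, hiter]
  have hrem : ∀ n : ℕ, ‖c 0 T - ∑ m ∈ Finset.range (n + 1), c m 0 / m ! * (T : ℂ) ^ m‖ ≤
      N * Real.exp (s * (2 * (2 * h) * T) ^ (1 / s)) * (1 / 2) ^ (n + 1) := by
    intro n
    have h1 := taylor_mean_remainder_bound hT.le
      (hsm.contDiffOn.of_le (by exact_mod_cast le_top)) (Set.right_mem_Icc.2 hT.le)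
      (n := n) (C := N * h ^ (n + 1) * ((n + 1)! : ℝ) ^ (1 - s)) fun t ht => by
        rw [hwithin _ t ht]
        exact hc _ t
    rw [taylor_within_apply] at h1
    have e1 : ∑ k ∈ Finset.range (n + 1), ((k ! : ℝ)⁻¹ * (T - 0) ^ k) •
        iteratedDerivWithin k (c 0) (Set.Icc 0 T) 0 =
        ∑ m ∈ Finset.range (n + 1), c m 0 / m ! * (T : ℂ) ^ m := by
      refine Finset.sum_congr rfl fun k _ => ?_
      rw [hwithin k 0 (Set.left_mem_Icc.2 hT.le), Complex.real_smul, sub_zero]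
      push_cast
      ring
    rw [e1, sub_zero] at h1
    refine h1.trans ?_
    set W : ℝ := N * (2 * h) ^ (n + 1) * ((n + 1)! : ℝ) ^ (1 - s) with hW
    have hW0 : 0 ≤ W := by positivity
    have h2 := norm_taylor_term_le hs (show 0 < 2 * h by positivity) hN hT.le (m := n + 1)
      (w := (W : ℂ)) (by rw [Complex.norm_real, Real.norm_of_nonneg hW0])
    rw [Complex.norm_real, Real.norm_of_nonneg hW0] at h2
    refine le_trans ?_ h2
    -- The Taylor remainder bound has n! in the denominator instead of (n+1)!. The missing factor n
    -- + 1 is absorbed by passing from h to 2h.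
    have h3 : ((n + 1 : ℕ) : ℝ) ≤ 2 ^ (n + 1) := by exact_mod_cast Nat.lt_two_pow_self.le
    have h4 : ((n + 1)! : ℝ) = ((n + 1 : ℕ) : ℝ) * n ! := by
      rw [Nat.factorial_succ]; push_cast; ring
    have hn : (0 : ℝ) < n ! := by positivity
    have hn1 : (0 : ℝ) < ((n + 1 : ℕ) : ℝ) := by positivity
    calc N * h ^ (n + 1) * ((n + 1)! : ℝ) ^ (1 - s) * T ^ (n + 1) / n ! =
        N * h ^ (n + 1) * ((n + 1)! : ℝ) ^ (1 - s) * T ^ (n + 1) / (n + 1)! * ((n + 1 : ℕ) : ℝ) := by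
          rw [h4]
          field_simp
      _ ≤ N * h ^ (n + 1) * ((n + 1)! : ℝ) ^ (1 - s) * T ^ (n + 1) / (n + 1)! * 2 ^ (n + 1) := by
          gcongr
      _ = _ := by
          rw [hW, mul_pow]
          ring
  have hlim := (tendsto_add_atTop_iff_nat 1).2 hv.tendsto_sum_nat
  have hz : Tendsto (fun n : ℕ => N * Real.exp (s * (2 * (2 * h) * T) ^ (1 / s)) *
      (1 / 2 : ℝ) ^ (n + 1)) atTop (𝓝 0) := by
    have := (tendsto_pow_atTop_nhds_zero_of_lt_one (show (0 : ℝ) ≤ 1 / 2 by norm_num)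
      (by norm_num)).const_mul (N * Real.exp (s * (2 * (2 * h) * T) ^ (1 / s)))
    rw [mul_zero] at this
    exact (tendsto_add_atTop_iff_nat 1).2 this
  have h5 := squeeze_zero_norm hrem hz
  have h6 := tendsto_nhds_unique h5 (tendsto_const_nhds.sub hlim)
  exact (sub_eq_zero.1 h6.symm)

theorem monom_single_index {d : ℕ} (i : Fin d) (n : ℕ) (x : Eucl d) :
    monom (Pi.single i n) x = x i ^ n := by
  unfold monom
  rw [Finset.prod_eq_single i (fun j _ hj => by simp [Pi.single_eq_of_ne hj]) (by simp)]
  simp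

theorem mfact_single_index {d : ℕ} (i : Fin d) (n : ℕ) :
    mfact (Pi.single i n : Fin d → ℕ) = (n ! : ℝ) := by
  unfold mfact
  rw [Finset.prod_eq_single i (fun j _ hj => by simp [Pi.single_eq_of_ne hj]) (by simp)]
  simp

theorem len_single_index {d : ℕ} (i : Fin d) (n : ℕ) : len (Pi.single i n : Fin d → ℕ) = n := by
  simp [len]

/-- The space `Σ_s^σ(ℝ^d)` is trivial if `s + σ = 1` and `d ≥ 1`. -/
theorem sigmaSpace_apply_eq_zero {s σ : ℝ} (hs : 0 < s) (hsσ : s + σ = 1) {d : ℕ} (i : Fin d)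
    (f : SigmaSpace s σ d) (x : Eucl d) : f x = 0 := by
  have hσ : 1 - s = σ := by linarith
  set c : ℕ → ℝ → ℂ := fun m t => mderiv (Pi.single i m) f (x + t • stdVec i) with hc
  have hd : ∀ m t, HasDerivAt (c m) (c (m + 1) t) t := by
    intro m t
    have h1 : HasDerivAt (fun t : ℝ => x + t • stdVec i) (stdVec i) t := by
      simpa using ((hasDerivAt_id t).smul_const (stdVec i)).const_add x
    have h2 : HasFDerivAt (mderiv (Pi.single i m) f) _ (x + t • stdVec i) :=
      ((mderiv_smooth f.smooth (Pi.single i m)).differentiable (by simp) _).hasFDerivAt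
    have h3 := h2.comp_hasDerivAt t h1
    have e : c (m + 1) t = fderiv ℝ (mderiv (Pi.single i m) f) (x + t • stdVec i) (stdVec i) := by
      simp only [hc, Pi.single_add]
      rw [mderiv_add_single f.smooth]
      rfl
    rw [e]
    exact h3
  have hb : ∀ h : ℝ, 0 < h → ∀ m t, ‖c m t‖ ≤
      gsNorm s σ h f * h ^ m * (m ! : ℝ) ^ (1 - s) := by
    intro h hh m t
    have := monom_mderiv_le f hh 0 (Pi.single i m) (x + t • stdVec i)
    rw [len_single_index, mfact_single_index] at this
    rw [hσ]
    simpa [mul_assoc] using this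
  have hmom : ∀ k : ℝ, 0 < k → ∀ (n : ℕ) (t : ℝ), |x i + t| ^ n * ‖c 0 t‖ ≤
      gsNorm s σ k f * k ^ n * (n ! : ℝ) ^ s := by
    intro k hk n t
    have := monom_mderiv_le f hk (Pi.single i n) 0 (x + t • stdVec i)
    rw [len_single_index, mfact_single_index, monom_single_index] at this
    have e : (x + t • stdVec i) i = x i + t := by simp [stdVec]
    rw [e, abs_pow] at this
    simpa [hc, mul_assoc] using this
  -- Then s(2h)^{1/s} = 1/2, the type required of the entire extension. Here and for k it is
  -- essential that the bounds hold for every positive constant.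
  set h : ℝ := (1 / (2 * s)) ^ s / 2 with hh
  have hh0 : 0 < h := by positivity
  have hN : 0 ≤ gsNorm s σ h f := gsNorm_nonneg hh0 _
  obtain ⟨F, hF, hFs, hFb⟩ := exists_entire_of_bound hs hh0 hN (fun m => hb h hh0 m 0)
  have hF0 : F 0 = f x := by
    have h1 := hasSum_single (f := fun m => c m 0 / m ! * (0 : ℂ) ^ m) 0
      fun m hm => by simp [hm]
    rw [(hFs 0).unique h1]
    simp [hc, mderiv_zero_index]
  rw [← hF0]
  -- The moment criterion gives the rate s/(2k^{1/s}) = 2·2^{1/s} in |x_i + t|, that is, the rate 2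
  -- in t once |x_i + t| ≥ t/2.
  set k : ℝ := (s / 4) ^ s / 2 with hk
  have hk0 : 0 < k := by positivity
  have hpow : ∀ {u : ℝ}, 0 < u → (u ^ s) ^ (1 / s) = u := fun {u} hu => by
    rw [← Real.rpow_mul hu.le, mul_one_div_cancel hs.ne', Real.rpow_one]
  refine entire_eq_zero_of_decay hs hF (C := 2 * gsNorm s σ h f) (fun z => (hFb z).trans_eq ?_)
    (D := 2 ^ s * gsNorm s σ k f) ?_
  · congr 2
    rw [hh, mul_div_cancel₀ _ (two_ne_zero' ℝ), Real.mul_rpow (by positivity) (norm_nonneg z),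
      hpow (by positivity)]
    field_simp
  · filter_upwards [eventually_gt_atTop 0, eventually_ge_atTop (2 * |x i|)] with t ht ht2
    have e : F t = c 0 t := (hasSum_taylor_of_bound hs hh0 hN hd (hb h hh0) ht (hFs t)).symm
    rw [e, Real.exp_neg, ← div_eq_mul_inv, le_div_iff₀ (Real.exp_pos _)]
    refine le_trans ?_ (mul_exp_le_of_moments (abs_nonneg (x i + t)) (norm_nonneg (c 0 t))
      (gsNorm_nonneg hk0 _) hk0 hs fun n => hmom k hk0 n t)
    refine mul_le_mul_of_nonneg_left (Real.exp_le_exp.2 ?_) (norm_nonneg _)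
    have h1 : t / 2 ≤ |x i + t| := by
      have := neg_abs_le (x i)
      exact le_trans (by linarith) (le_abs_self _)
    have h2 := Real.rpow_le_rpow (by positivity) h1 (show 0 ≤ 1 / s by positivity)
    have hq : (0 : ℝ) < (2 : ℝ) ^ (1 / s) := by positivity
    rw [Real.div_rpow ht.le (by norm_num)] at h2
    have h3 : k ^ (1 / s) = s / 4 / 2 ^ (1 / s) := by
      rw [hk, Real.div_rpow (by positivity) (by norm_num), hpow (by positivity)]
    rw [h3]
    calc 2 * t ^ (1 / s) = s / (2 * (s / 4 / 2 ^ (1 / s))) * (t ^ (1 / s) / 2 ^ (1 / s)) := by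
          field_simp
          norm_num
      _ ≤ _ := by gcongr

theorem subsingleton_sigmaSpace {s σ : ℝ} (hs : 0 < s) (hsσ : s + σ = 1) {d : ℕ} (hd : d ≠ 0) :
    Subsingleton (SigmaSpace s σ d) := by
  have i : Fin d := ⟨0, Nat.pos_of_ne_zero hd⟩
  exact ⟨fun f g => Subtype.ext (funext fun x => by
    rw [sigmaSpace_apply_eq_zero hs hsσ i f x, sigmaSpace_apply_eq_zero hs hsσ i g x])⟩

end Trivial

end GelfandShilov

end

theorem mainTheorem2 (d : ℕ) (A : Matrix (Fin d) (Fin d) ℝ) (s σ : ℝ) (hs : 0 < s)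
    (hσ : 0 < σ) (hsσ : 1 ≤ s + σ) (hne : (s, σ) ≠ (1 / 2, 1 / 2))
    (a : Eucl d × Eucl d → ℂ) (ha : a ∈ GammaZero s σ σ s d) :
    (∀ f g : SigmaSpace s σ d, Integrable (fun p => a p * kernelTest A (tensor g f) p)) ∧
    ∃ T : SigmaSpace s σ d →L[ℂ] SigmaSpace s σ d,
      (∀ f g : SigmaSpace s σ d, toDual (T f) g = Op A a f g) ∧
      ∃ T' : SigmaDual s σ d →L[ℂ] SigmaDual s σ d,
        (∀ f : SigmaSpace s σ d, T' (toDual f) = toDual (T f)) ∧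
        ∀ G : SigmaDual s σ d → SigmaDual s σ d, Continuous G →
          (∀ f : SigmaSpace s σ d, G (toDual f) = toDual (T f)) → G = T' := by
  by_cases hd : d = 0
  · subst hd
    exact exists_continuous_extension_of_admissible A hs hσ admissible_zero ha
  · rcases hsσ.lt_or_eq with h | h
    -- The strict inequality provides the factorial surplus; on the line s + σ = 1 the space is zero
    -- for d ≥ 1.
    · exact exists_continuous_extension_of_admissible A hs hσ (admissible_of_one_lt h) ha
    · have := subsingleton_sigmaSpace hs h.symm hd
      exact exists_continuous_extension_of_subsingleton A a
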